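/- Fix a smooth dyadic partition of unity in frequency: $\chi,\varphi\in C_c^\infty(\mathbb R^3)$, $\varphi$ supported in an annulus centred at $0$, $\chi(\xi)+\sum_{q\ge 0}\varphi(2^{-q}\xi)=1$ for all $\xi$. Put $\Delta_{-1}=\chi(D)$, $\Delta_n=\varphi(2^{-n}D)$ for $n\ge 0$, and $S_j=\chi(2^{-j}D)$. For non-integer $\sigma\in\mathbb R$ let $C^\sigma(\mathbb R^3)$ be the space of tempered distributions $u$ with $\|u\|_\sigma=\sup_{n\ge -1}2^{n\sigma}\|\Delta_n u\|_{L^\infty}<\infty$; vector fields are treated componentwise, with the maximum of the norms of the components, and elements of $C^\sigma$ with $\sigma>0$ are identified with their bounded continuous representatives. For an open set $P\subset\mathbb R^3$ and a distribution $f$, the product $1_P f$ is the limit of $1_P\,S_jf$ in $\mathcal S'(\mathbb R^3)$, when each $S_jf$ is bounded and the limit exists. Let $\|1_P\|_{\mathcal L(C^{\sigma})}\in[0,\infty]$ be the norm of $f\mapsto 1_Pf$ as an operator on $C^{\sigma}(\mathbb R^3)$ (equal to $\infty$ if this is not a bounded operator on $C^{\sigma}(\mathbb R^3)$). An open set $P$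 is of class $C^{1+r}$ if every point of $\partial P$ has an open neighbourhood $U$ and a $C^1$ function $f:U\to\mathbb R$ with $r$-Hölder continuous and nowhere vanishing gradient such that $P\cap U=\{f<0\}$. A continuous vector field $w$ is tangent to $\partial P$ if $w\cdot\nabla f=0$ at the points of $\partial P\cap U$ for all such local defining functions $f$, that is, if $w\cdot n=0$ on $\partial P$, where $n$ is the normal. **Proposition.** Let $0<s<1$. There is a function $C:[0,\infty)\to[0,\infty)$, depending only on $s$ (and on the fixed dyadic partition), with the following property. Let $s\le r<1$ and let $P\subset\mathbb R^3$ be an open set of class $C^{1+r}$. 1. If $P$ is bounded, then $K:=\|1_P\|_{\mathcal L(C^{s-1})}$ is finite. 2. Whenever $K=\|1_P\|_{\mathcal L(C^{s-1})}$ is finite, then for all vector fields $\omega_{0i},\omega_{0e}\in C^r(\mathbb R^3;\mathbb R^3)$ and every vector field $w\in C^s(\mathbb R^3;\mathbb R^3)$ tangent to $\partial P$, setting $\omega_0=\omega_{0i}1_P+\omega_{0e}1_{\mathbb R^3\setminus\overline P}$ on $\mathbb R^3$, the field $\operatorname{div}(w\otimes\omega_0)=\sum_{i=1}^3\partial_i(w^i\omega_0)$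 (in the sense of distributions) belongs to $C^{s-1}(\mathbb R^3)$, and $$\|\operatorname{div}(w\otimes\omega_0)\|_{s-1}\le C(K)\,\|w\|_{L^\infty}\big(\|\omega_{0i}\|_s+\|\omega_{0e}\|_s\big)+C(K)\,\|\omega_0\|_{L^\infty(\mathbb R^3)}\|w\|_s .$$ -/

import Mathlib

open MeasureTheory Filter Topology
open scoped ENNReal NNReal SchwartzMap LineDeriv BoundedContinuousFunction

noncomputable section

/-- Three-dimensional Euclidean space. -/
abbrev E3 : Type := EuclideanSpace ℝ (Fin 3)

/-! ### Littlewood-Paley decomposition and Hölder (Besov) norms -/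

/-- The two symbols of a dyadic decomposition of the frequency space: `χ` is supported in a ball
and `φ` in an annulus, both centred at the origin, and `χ + ∑_{q ≥ 0} φ(2^{-q} ·) = 1`. -/
structure DyadicPartition where
  χ : E3 → ℝ
  φ : E3 → ℝ
  contDiff_χ : ContDiff ℝ (⊤ : ℕ∞) χ
  contDiff_φ : ContDiff ℝ (⊤ : ℕ∞) φ
  hasCompactSupport_χ : HasCompactSupport χ
  hasCompactSupport_φ : HasCompactSupport φ
  zero_notMem_tsupport_φ : (0 : E3) ∉ tsupport φ
  hasSum_φ : ∀ ξ : E3, HasSum (fun q : ℕ => φ ((2 : ℝ)⁻¹ ^ q • ξ)) (1 - χ ξ)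

/-- The `L^∞` norm of a tempered distribution; it is `⊤` when the distribution is not given by
an essentially bounded function. -/
def distLinftyNorm (u : 𝓢'(E3, ℂ)) : ℝ≥0∞ :=
  ⨅ (g : Lp ℂ ∞ (volume : Measure E3)) (_ : (g : 𝓢'(E3, ℂ)) = u), ‖g‖ₑ

namespace DyadicPartition

/-- The dyadic blocks, with the index shifted by one: `block 0` is `Δ_{-1} = χ(D)` and
`block (n + 1)` is `Δ_n = φ(2^{-n} D)`. -/
def block (𝔇 : DyadicPartition) : ℕ → 𝓢'(E3, ℂ) → 𝓢'(E3, ℂ)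
  | 0 => TemperedDistribution.fourierMultiplierCLM ℂ (fun ξ => (𝔇.χ ξ : ℂ))
  | n + 1 => TemperedDistribution.fourierMultiplierCLM ℂ
      (fun ξ => (𝔇.φ ((2 : ℝ)⁻¹ ^ n • ξ) : ℂ))

/-- The low-frequency cut-off `S_j = χ(2^{-j} D) = ∑_{n < j} Δ_n`. -/
def lowFreq (𝔇 : DyadicPartition) (j : ℕ) : 𝓢'(E3, ℂ) → 𝓢'(E3, ℂ) :=
  TemperedDistribution.fourierMultiplierCLM ℂ (fun ξ => (𝔇.χ ((2 : ℝ)⁻¹ ^ j • ξ) : ℂ))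

/-- The norm of `C^σ_*(ℝ³) = B^σ_{∞,∞}(ℝ³)`, that is `sup_{n ≥ -1} 2^{nσ} ‖Δ_n u‖_∞`,
with value `⊤` outside this space. -/
def holderNorm (𝔇 : DyadicPartition) (σ : ℝ) (u : 𝓢'(E3, ℂ)) : ℝ≥0∞ :=
  ⨆ n : ℕ, ENNReal.ofReal ((2 : ℝ) ^ (((n : ℝ) - 1) * σ)) * distLinftyNorm (𝔇.block n u)

/-- The `C^σ` norm of a vector field with distributional components. -/
def vecHolderNorm (𝔇 : DyadicPartition) (σ : ℝ) (u : Fin 3 → 𝓢'(E3, ℂ)) : ℝ≥0∞ :=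
  ⨆ k, 𝔇.holderNorm σ (u k)

/-- The product `1_P f` of the characteristic function of `P` and a tempered distribution `f`
exists and is equal to `g`: the products `1_P S_j f`, in which every `S_j f` is a bounded
function, converge to `g` in the sense of tempered distributions. -/
def IsCharMul (𝔇 : DyadicPartition) (P : Set E3) (f g : 𝓢'(E3, ℂ)) : Prop :=
  ∃ F : ℕ → Lp ℂ ∞ (volume : Measure E3), (∀ j, (F j : 𝓢'(E3, ℂ)) = 𝔇.lowFreq j f) ∧
    ∀ ψ : 𝓢(E3, ℂ), Tendsto (fun j => ∫ x in P, ψ x * F j x) atTop (𝓝 (g ψ))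

/-- The norm of the multiplication by `1_P` as a linear operator in `C^σ(ℝ³)`, with value `⊤` when
this multiplication is not a bounded operator from `C^σ(ℝ³)` to itself. -/
def charMultiplierNorm (𝔇 : DyadicPartition) (σ : ℝ) (P : Set E3) : ℝ≥0∞ :=
  ⨅ (K : ℝ≥0) (_ : ∀ f : 𝓢'(E3, ℂ), 𝔇.holderNorm σ f < ⊤ →
    ∃ g, 𝔇.IsCharMul P f g ∧ 𝔇.holderNorm σ g ≤ K * 𝔇.holderNorm σ f), (K : ℝ≥0∞)

end DyadicPartition

/-! ### Bounded functions as distributions -/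

open Classical in
/-- The tempered distribution given by an essentially bounded real function (`0` for any other
function). -/
def boundedDist (u : E3 → ℝ) : 𝓢'(E3, ℂ) :=
  if h : MemLp (fun x => (u x : ℂ)) ∞ (volume : Measure E3) then
    ((h.toLp _ : Lp ℂ ∞ (volume : Measure E3)) : 𝓢'(E3, ℂ)) else 0

theorem boundedDist_apply {u : E3 → ℝ} (h : MemLp u ∞ (volume : Measure E3)) (ψ : 𝓢(E3, ℂ)) :
    boundedDist u ψ = ∫ x, ψ x * (u x : ℂ) := by
  have h' : MemLp (fun x => (u x : ℂ)) ∞ (volume : Measure E3) := h.ofReal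
  rw [boundedDist, dif_pos h', Lp.toTemperedDistribution_apply]
  apply integral_congr_ae
  filter_upwards [h'.coeFn_toLp] with x hx
  rw [hx, smul_eq_mul]

/-- The components of a vector field, as distributions. -/
def fieldDist (u : E3 → E3) (k : Fin 3) : 𝓢'(E3, ℂ) := boundedDist (fun x => u x k)

/-- The vector field `div (w ⊗ ω) = ∑ i, ∂_i (w^i ω)`, in the sense of distributions. -/
def divTensor (w ω : E3 → E3) (k : Fin 3) : 𝓢'(E3, ℂ) :=
  ∑ i : Fin 3, ∂_{EuclideanSpace.single i (1 : ℝ)} (boundedDist (fun x => w x i * ω x k))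

/-- The field `ω_i 1_P + ω_e 1_{ℝ³ ∖ closure P}`. -/
def patchField (P : Set E3) (ωi ωe : E3 → E3) (x : E3) : E3 :=
  P.indicator ωi x + (closure P)ᶜ.indicator ωe x

theorem memLp_patchField {P : Set E3} (hP : IsOpen P) (ωi ωe : E3 →ᵇ E3) :
    MemLp (patchField P ωi ωe) ∞ (volume : Measure E3) := by
  have hb : ∀ u : E3 →ᵇ E3, MemLp u ∞ (volume : Measure E3) := fun u =>
    memLp_top_of_bound u.continuous.aestronglyMeasurable ‖u‖ (.of_forall u.norm_coe_le_norm)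
  exact ((hb ωi).indicator hP.measurableSet).add
    ((hb ωe).indicator isClosed_closure.measurableSet.compl)

theorem memLp_mul_patchField {P : Set E3} (hP : IsOpen P) (w ωi ωe : E3 →ᵇ E3) (i k : Fin 3) :
    MemLp (fun x => w x i * patchField P ωi ωe x k) ∞ (volume : Measure E3) := by
  have hw : MemLp (fun x => w x i) ∞ (volume : Measure E3) :=
    memLp_top_of_bound (by fun_prop) ‖w‖
      (.of_forall fun x => (PiLp.norm_apply_le (w x) i).trans (w.norm_coe_le_norm x))
  have hω : MemLp (fun x => patchField P ωi ωe x k) ∞ (volume : Measure E3) :=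
    (memLp_patchField hP ωi ωe).continuousLinearMap_comp (EuclideanSpace.proj (𝕜 := ℝ) k)
  exact hω.mul hw

/-! ### Open sets of class `C^{1+r}` and tangent vector fields -/

/-- `f` is a defining function, of class `C^{1+r}` on the open neighbourhood `U` of `x`, of the
open set `P`: near `x`, `P` is the set `{f < 0}`, and the differential of `f` does not vanish. -/
structure IsLocalDefiningFunction (r : ℝ) (P : Set E3) (x : E3) (U : Set E3) (f : E3 → ℝ) :
    Prop where
  isOpen : IsOpen U
  mem : x ∈ U
  contDiffOn : ContDiffOn ℝ 1 f U
  holder : ∃ M : ℝ, ∀ y ∈ U, ∀ z ∈ U, ‖fderiv ℝ f y - fderiv ℝ f z‖ ≤ M * ‖y - z‖ ^ r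
  fderiv_ne_zero : ∀ y ∈ U, fderiv ℝ f y ≠ 0
  inter_eq : P ∩ U = {y ∈ U | f y < 0}

/-- `P` is an open set of class `C^{1+r}`. -/
def IsOpenOfClass (r : ℝ) (P : Set E3) : Prop :=
  IsOpen P ∧ ∀ x ∈ frontier P, ∃ U f, IsLocalDefiningFunction r P x U f

/-- The vector field `w` is tangent to the boundary of `P`, an open set of class `C^{1+r}`:
it is orthogonal there to the gradients of the local defining functions, that is, to the
normal. -/
def IsTangentToFrontier (r : ℝ) (w : E3 → E3) (P : Set E3) : Prop :=
  ∀ x ∈ frontier P, ∀ U f, IsLocalDefiningFunction r P x U f → fderiv ℝ f x (w x) = 0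

end

/-!
The proof works with averages instead of paraproducts. A Fourier multiplier `m(cD)` acts on a
bounded function `u` as `x ↦ ∫ k(y) u(x - c y) dy` with the fixed Schwartz kernel `k = 𝓕⁻ m`
(`scaleConv`, `IsGivenBy.fourierMultiplier`). Two facts about such averages, summed over dyadic
scales, give the elementary theory of the spaces `C^σ`: a function in `C^s` is `s`-Hölder
continuous (`DyadicPartition.exists_holder_of_holderNorm_le`), and the derivatives of a bounded
`s`-Hölder continuous function belong to `C^{s-1}`
(`DyadicPartition.exists_holderNorm_lineDerivOp_le`).

*Bounded sets are multipliers.* Let `f ∈ C^{s-1}` have the blocks `v n`, of frequency `2ⁿ`. In order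
to bound the block of frequency `2ᵐ` of `1_P v n`, one tests `v n` against a Schwartz function
of scale `2⁻ᵐ` cut off to `P`. Such a function has an `L¹` modulus of continuity of order `‖h‖`,
because near its boundary `P` is the sublevel set of a function that is monotone at a linear rate
along a coordinate axis, so that `P` and its translates differ by a set which every line parallel
to this axis meets in a short piece (`exists_lintegral_translate_le`). Since `v n` is reproduced by
an average of mean zero, the result is at most a multiple of `2^{m-n} ‖v n‖` when `n ≥ m`; together
with the trivial bound for `n < m` this sums to `2^{m(1-s)}`, which is the estimate in `C^{s-1}`
(`DyadicPartition.charMultiplierNorm_lt_top`).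

*The divergence estimate.* Let `θ` be a component of the patch `ω₀`, and let `a`, `b` be the
components of the interior and exterior fields, truncated at the level `‖ω₀‖_∞`. The truncation does
not change `ω₀`, as the boundary has measure zero, and it preserves Hölder bounds. Then
`θ = b + 1_P (a - b)` almost everywhere, hence `div(θ w) = div(b w) + div(1_P V)` with
`V = (a - b) w`, and the first term is the divergence of a Hölder continuous field. For the second
one, `V` is again Hölder continuous and tangent to the boundary, and the point is the identity
`div(1_P V) = 1_P div V` (`DyadicPartition.IsCharMul.eq_sum_lineDerivOp`): it bounds the second
term by `K` times the norm of `div V` in `C^{s-1}`.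

To prove this identity, `1_P` is replaced by smooth functions of the local defining function `f`
that vary in a layer `|f| ≤ ε`. Their gradients are of size `ε⁻¹`, but the layer has a volume of
order `ε`, so they are bounded in `L¹`; and as `∇f · V` vanishes on the boundary it is small in the
layer, so that the contribution of the layer to the integration by parts tends to zero
(`IsLocalDefiningFunction.exists_hasTangentialCutoffs`). A partition of unity and the density of the
compactly supported functions in the Schwartz space conclude.
-/

open scoped FourierTransform

/-! ### Averages against rescaled kernels -/

/-- The average `∫ k(y) u(x - c y) dy`. For `c > 0` it is the convolution of `u` with the rescaled
kernel `c⁻³ k(c⁻¹ ·)`; in this form no change of variables is needed to let `c` vary. -/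
noncomputable def scaleConv (k : E3 → ℂ) (c : ℝ) (u : E3 → ℂ) (x : E3) : ℂ :=
  ∫ y, k y * u (x - c • y)

section ScaleConv

variable {k φ u : E3 → ℂ} {B c : ℝ}

theorem integrable_mul_of_bounded (hk : Integrable k) (hu : Measurable u)
    (hB : ∀ x, ‖u x‖ ≤ B) : Integrable fun y => k y * u y :=
  hk.mul_bdd hu.aestronglyMeasurable (.of_forall hB)

theorem integrable_scaleConv_integrand (hk : Integrable k) (hu : Measurable u)
    (hB : ∀ x, ‖u x‖ ≤ B) (c : ℝ) (x : E3) : Integrable fun y => k y * u (x - c • y) :=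
  integrable_mul_of_bounded hk (u := fun y => u (x - c • y)) (hu.comp (by fun_prop))
    fun _ => hB _

theorem norm_scaleConv_le (hk : Integrable k) (hB : ∀ x, ‖u x‖ ≤ B) (c : ℝ) (x : E3) :
    ‖scaleConv k c u x‖ ≤ (∫ y, ‖k y‖) * B := by
  rw [scaleConv, ← integral_mul_const]
  refine norm_integral_le_of_norm_le (hk.norm.mul_const B) (.of_forall fun y => ?_)
  rw [norm_mul]
  gcongr
  exact hB _

/-- A kernel with an `L¹` modulus of continuity `V ‖h‖` produces Lipschitz averages. -/
theorem norm_scaleConv_sub_le {V : ℝ} (hk : Integrable k)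
    (hV : ∀ h, ∫ y, ‖k (y + h) - k y‖ ≤ V * ‖h‖) (hu : Measurable u) (hB : ∀ x, ‖u x‖ ≤ B)
    (hc : 0 < c) (x x' : E3) :
    ‖scaleConv k c u x - scaleConv k c u x'‖ ≤ V * B * (‖x - x'‖ / c) := by
  have hB0 : 0 ≤ B := (norm_nonneg _).trans (hB 0)
  set h : E3 := c⁻¹ • (x - x') with hh
  have key : scaleConv k c u x = ∫ y, k (y + h) * u (x' - c • y) := by
    rw [scaleConv, ← integral_add_right_eq_self _ h]
    congr 1 with y
    congr 2
    rw [hh, smul_add, smul_smul, mul_inv_cancel₀ hc.ne']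
    module
  have hk' : Integrable fun y => k (y + h) := hk.comp_add_right h
  rw [key, scaleConv, ← integral_sub (integrable_scaleConv_integrand hk' hu hB c x')
    (integrable_scaleConv_integrand hk hu hB c x')]
  calc ‖∫ y, (k (y + h) * u (x' - c • y) - k y * u (x' - c • y))‖
      ≤ ∫ y, ‖k (y + h) - k y‖ * B := by
        refine norm_integral_le_of_norm_le ((hk'.sub hk).norm.mul_const B)
          (.of_forall fun y => ?_)
        rw [← sub_mul, norm_mul]
        gcongr
        exact hB _
    _ ≤ V * ‖h‖ * B := by
        rw [integral_mul_const]
        gcongr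
        exact hV h
    _ = V * B * (‖x - x'‖ / c) := by
        rw [hh, norm_smul, norm_inv, Real.norm_of_nonneg hc.le]
        ring

theorem continuous_scaleConv {V : ℝ} (hk : Integrable k)
    (hV : ∀ h, ∫ y, ‖k (y + h) - k y‖ ≤ V * ‖h‖) (hu : Measurable u) (hB : ∀ x, ‖u x‖ ≤ B)
    (hc : 0 < c) : Continuous (scaleConv k c u) := by
  refine (LipschitzWith.of_dist_le' (K := V * B / c) fun x x' => ?_).continuous
  rw [dist_eq_norm, dist_eq_norm]
  refine (norm_scaleConv_sub_le hk hV hu hB hc x x').trans_eq ?_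
  ring

/-- Duality, with the averages taken of the pairings with the translates of the test function. -/
theorem integral_mul_scaleConv (hk : Integrable k) (hφ : Integrable φ) (hu : Measurable u)
    (hB : ∀ x, ‖u x‖ ≤ B) (c : ℝ) :
    ∫ x, φ x * scaleConv k c u x = ∫ y, k y * ∫ z, φ (z + c • y) * u z := by
  have hint : Integrable (Function.uncurry fun x y => φ x * (k y * u (x - c • y)))
      (volume.prod volume) := by
    have h1 : Integrable (fun p : E3 × E3 => φ p.1 * k p.2) (volume.prod volume) :=
      hφ.mul_prod hk
    have h2 : Measurable fun p : E3 × E3 => u (p.1 - c • p.2) := hu.comp (by fun_prop)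
    refine (h1.mul_bdd (c := B) h2.aestronglyMeasurable (.of_forall fun _ => hB _)).congr
      (.of_forall fun p => ?_)
    simp only [Function.uncurry]
    ring
  calc ∫ x, φ x * scaleConv k c u x = ∫ x, ∫ y, φ x * (k y * u (x - c • y)) := by
        simp_rw [scaleConv, integral_const_mul]
    _ = ∫ y, ∫ x, φ x * (k y * u (x - c • y)) := integral_integral_swap hint
    _ = ∫ y, k y * ∫ z, φ (z + c • y) * u z := by
        congr 1 with y
        rw [← integral_const_mul, ← integral_add_right_eq_self _ (c • y)]
        congr 1 with z
        rw [add_sub_cancel_right]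
        ring

/-- Duality, with the averages taken of the test function. -/
theorem integral_mul_scaleConv' (hk : Integrable k) (hφ : Integrable φ) (hu : Measurable u)
    (hB : ∀ x, ‖u x‖ ≤ B) (c : ℝ) :
    ∫ x, φ x * scaleConv k c u x = ∫ z, (∫ y, k y * φ (z + c • y)) * u z := by
  rw [integral_mul_scaleConv hk hφ hu hB]
  have hint : Integrable (Function.uncurry fun y z => k y * (φ (z + c • y) * u z))
      (volume.prod volume) := by
    have h1 : Integrable (fun p : E3 × E3 => k p.1 * φ (p.2 + c • p.1)) (volume.prod volume) := by
      rw [integrable_prod_iff]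
      · refine ⟨.of_forall fun y => (hφ.comp_add_right (c • y)).const_mul (k y), ?_⟩
        simp_rw [norm_mul, integral_const_mul]
        refine (hk.norm.mul_const (∫ z, ‖φ z‖)).congr (.of_forall fun y => ?_)
        simp only
        rw [integral_add_right_eq_self (fun z => ‖φ z‖)]
      · refine (hk.1.comp_quasiMeasurePreserving Measure.quasiMeasurePreserving_fst).mul
          (hφ.1.comp_quasiMeasurePreserving ?_)
        refine ⟨by fun_prop, ?_⟩
        have : MeasurePreserving (fun p : E3 × E3 => (p.1, p.2 + c • p.1))
            (volume.prod volume) (volume.prod volume) :=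
          (MeasurePreserving.id _).skew_product (g := fun y z => z + c • y) (by fun_prop)
            (.of_forall fun y => (measurePreserving_add_right volume (c • y)).map_eq)
        exact (Measure.quasiMeasurePreserving_snd.comp
          this.quasiMeasurePreserving).absolutelyContinuous
    have h2 : Measurable fun p : E3 × E3 => u p.2 := hu.comp measurable_snd
    refine (h1.mul_bdd (c := B) h2.aestronglyMeasurable (.of_forall fun _ => hB _)).congr
      (.of_forall fun p => ?_)
    simp only [Function.uncurry]
    ring
  calc ∫ y, k y * ∫ z, φ (z + c • y) * u z = ∫ y, ∫ z, k y * (φ (z + c • y) * u z) := by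
        simp_rw [integral_const_mul]
    _ = ∫ z, ∫ y, k y * (φ (z + c • y) * u z) := integral_integral_swap hint
    _ = _ := by
        congr 1 with z
        rw [← integral_mul_const]
        congr 1 with y
        ring

/-- Averages of a Hölder continuous function differ from the function by a power of the scale;
when the kernel has mean zero this bounds the average itself. -/
theorem norm_scaleConv_sub_integral_mul_le {s M : ℝ} (hk : Integrable k)
    (hks : Integrable fun y => ‖k y‖ * ‖y‖ ^ s) (hu : Measurable u) (hB : ∀ x, ‖u x‖ ≤ B)
    (hM : ∀ x y, ‖u x - u y‖ ≤ M * ‖x - y‖ ^ s) (hc : 0 ≤ c) (x : E3) :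
    ‖scaleConv k c u x - (∫ y, k y) * u x‖ ≤ M * c ^ s * ∫ y, ‖k y‖ * ‖y‖ ^ s := by
  rw [scaleConv, ← integral_mul_const, ← integral_sub
    (integrable_scaleConv_integrand hk hu hB c x) (hk.mul_const _), ← integral_const_mul]
  refine norm_integral_le_of_norm_le (hks.const_mul _) (.of_forall fun y => ?_)
  rw [← mul_sub, norm_mul]
  have := hM (x - c • y) x
  rw [sub_sub_cancel_left, norm_neg, norm_smul, Real.norm_of_nonneg hc,
    Real.mul_rpow hc (norm_nonneg _)] at this
  calc ‖k y‖ * ‖u (x - c • y) - u x‖ ≤ ‖k y‖ * (M * (c ^ s * ‖y‖ ^ s)) := by gcongr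
    _ = _ := by ring

theorem tendsto_scaleConv {c : ℕ → ℝ} (hc : Tendsto c atTop (𝓝 0)) (hk : Integrable k)
    (hu : Continuous u) (hB : ∀ x, ‖u x‖ ≤ B) (x : E3) :
    Tendsto (fun j => scaleConv k (c j) u x) atTop (𝓝 ((∫ y, k y) * u x)) := by
  rw [← integral_mul_const]
  refine tendsto_integral_of_dominated_convergence (fun y => ‖k y‖ * B)
    (fun j => (integrable_scaleConv_integrand hk hu.measurable hB (c j) x).1)
    (hk.norm.mul_const B) (fun j => .of_forall fun y => ?_) (.of_forall fun y => ?_)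
  · rw [norm_mul]
    gcongr
    exact hB _
  · refine tendsto_const_nhds.mul ((hu.tendsto x).comp ?_)
    simpa using (tendsto_const_nhds (x := x)).sub (hc.smul_const y)

end ScaleConv

/-! ### Schwartz kernels -/

/-- The integrable weight `(1 + ‖z‖)⁻⁴` on `ℝ³` that dominates Schwartz functions. -/
noncomputable def decayWeight (z : E3) : ℝ := ((1 + ‖z‖) ^ 4)⁻¹

theorem decayWeight_nonneg (z : E3) : 0 ≤ decayWeight z := by
  unfold decayWeight
  positivity

theorem integrable_decayWeight : Integrable decayWeight := by
  refine (integrable_one_add_norm (E := E3) (r := 4) (by simp; norm_num)).congr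
    (.of_forall fun z => ?_)
  simp only [decayWeight]
  rw [Real.rpow_neg (by positivity)]
  norm_cast

theorem decayWeight_le_of_norm_sub_le {y z : E3} (h : ‖y - z‖ ≤ 1) :
    decayWeight z ≤ 16 * decayWeight y := by
  have h1 : ‖y‖ ≤ ‖z‖ + 1 := by
    linarith [norm_le_norm_add_norm_sub z y, norm_sub_rev y z]
  have h2 : (1 + ‖y‖) ^ 4 ≤ (2 * (1 + ‖z‖)) ^ 4 := by
    gcongr
    linarith [norm_nonneg z]
  rw [decayWeight, decayWeight, ← div_eq_mul_inv, inv_eq_one_div,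
    div_le_div_iff₀ (by positivity) (by positivity)]
  nlinarith [h2]

/-- The `L¹` modulus of continuity of a function controlled, with its derivative, by the decay
weight. -/
theorem integral_norm_translate_sub_le {k : E3 → ℂ} {D : ℝ} (hk : Differentiable ℝ k)
    (h0 : ∀ z, ‖k z‖ ≤ D * decayWeight z) (h1 : ∀ z, ‖fderiv ℝ k z‖ ≤ D * decayWeight z)
    (h : E3) :
    ∫ y, ‖k (y + h) - k y‖ ≤ 16 * (∫ z, decayWeight z) * D * ‖h‖ := by
  have hD : 0 ≤ D := by
    have := (norm_nonneg _).trans (h0 0)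
    simpa [decayWeight] using this
  have hW : 0 ≤ ∫ z, decayWeight z := integral_nonneg decayWeight_nonneg
  have hki : Integrable k := (integrable_decayWeight.const_mul D).mono'
    hk.continuous.aestronglyMeasurable (.of_forall h0)
  have hki' : Integrable fun y => k (y + h) := hki.comp_add_right h
  -- the mean value inequality for short translations, the triangle inequality for long ones
  rcases le_total ‖h‖ 1 with hh | hh
  · calc ∫ y, ‖k (y + h) - k y‖ ≤ ∫ y, D * (16 * decayWeight y) * ‖h‖ := by
          refine integral_mono (hki'.sub hki).norm
            (((integrable_decayWeight.const_mul 16).const_mul D).mul_const _) fun y => ?_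
          have := (convex_segment y (y + h)).norm_image_sub_le_of_norm_fderiv_le (f := k) (𝕜 := ℝ)
            (C := D * (16 * decayWeight y)) (fun z _ => hk z) (fun z hz => ?_)
            (left_mem_segment ℝ y (y + h)) (right_mem_segment ℝ y (y + h))
          · simpa using this
          · refine (h1 z).trans ?_
            gcongr
            refine decayWeight_le_of_norm_sub_le ?_
            rw [segment_eq_image'] at hz
            obtain ⟨t, ht, rfl⟩ := hz
            simp only [add_sub_cancel_left, sub_add_cancel_left, norm_neg, norm_smul]
            rw [Real.norm_of_nonneg ht.1]
            nlinarith [ht.2, norm_nonneg h]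
      _ = _ := by
          rw [integral_mul_const, integral_const_mul, integral_const_mul]
          ring
  · have hle : ∫ y, ‖k y‖ ≤ D * ∫ z, decayWeight z := by
      rw [← integral_const_mul]
      exact integral_mono hki.norm (integrable_decayWeight.const_mul D) h0
    calc ∫ y, ‖k (y + h) - k y‖ ≤ ∫ y, (‖k (y + h)‖ + ‖k y‖) :=
          integral_mono (hki'.sub hki).norm (hki'.norm.add hki.norm) fun y => norm_sub_le _ _
      _ = 2 * ∫ y, ‖k y‖ := by
          rw [integral_add hki'.norm hki.norm, integral_add_right_eq_self (fun y => ‖k y‖)]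
          ring
      _ ≤ 16 * (∫ z, decayWeight z) * D * 1 := by nlinarith [mul_nonneg hD hW]
      _ ≤ _ := by gcongr

/-- A continuous seminorm on the Schwartz space that controls a function and its derivative by the
decay weight. -/
noncomputable def decaySeminorm : Seminorm ℂ 𝓢(E3, ℂ) :=
  2 ^ 4 • (Finset.Iic (4, 1)).sup fun m => SchwartzMap.seminorm ℂ m.1 m.2

theorem norm_le_decaySeminorm (k : 𝓢(E3, ℂ)) (z : E3) :
    ‖k z‖ ≤ decaySeminorm k * decayWeight z := by
  have := SchwartzMap.one_add_le_sup_seminorm_apply (𝕜 := ℂ) (m := (4, 1)) (k := 4) (n := 0)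
    le_rfl zero_le_one k z
  rw [norm_iteratedFDeriv_zero] at this
  rw [decayWeight, ← div_eq_mul_inv, le_div_iff₀ (by positivity), mul_comm]
  simpa [decaySeminorm, show (2 : ℝ) ^ 4 = 16 by norm_num] using this

theorem norm_fderiv_le_decaySeminorm (k : 𝓢(E3, ℂ)) (z : E3) :
    ‖fderiv ℝ k z‖ ≤ decaySeminorm k * decayWeight z := by
  have := SchwartzMap.one_add_le_sup_seminorm_apply (𝕜 := ℂ) (m := (4, 1)) (k := 4) (n := 1)
    le_rfl le_rfl k z
  rw [norm_iteratedFDeriv_one] at this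
  rw [decayWeight, ← div_eq_mul_inv, le_div_iff₀ (by positivity), mul_comm]
  simpa [decaySeminorm, show (2 : ℝ) ^ 4 = 16 by norm_num] using this

theorem SchwartzMap.integral_norm_translate_sub_le (k : 𝓢(E3, ℂ)) (h : E3) :
    ∫ y, ‖k (y + h) - k y‖ ≤ 16 * (∫ z, decayWeight z) * decaySeminorm k * ‖h‖ :=
  _root_.integral_norm_translate_sub_le k.differentiable (norm_le_decaySeminorm k)
    (norm_fderiv_le_decaySeminorm k) h

theorem SchwartzMap.integrable_norm_mul_rpow (k : 𝓢(E3, ℂ)) {s : ℝ} (hs₀ : 0 ≤ s) (hs₁ : s ≤ 1) :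
    Integrable fun y => ‖k y‖ * ‖y‖ ^ s := by
  refine (k.integrable.norm.add (k.integrable_pow_mul volume 1)).mono'
    (k.continuous.norm.mul
      (continuous_norm.rpow_const fun _ => .inr hs₀)).aestronglyMeasurable
    (.of_forall fun y => ?_)
  rw [Real.norm_of_nonneg (by positivity), Pi.add_apply, pow_one, mul_comm ‖y‖, ← mul_one_add]
  gcongr
  rcases le_total ‖y‖ 1 with h | h
  · exact (Real.rpow_le_one (norm_nonneg _) h hs₀).trans (by linarith [norm_nonneg y])
  · exact (Real.rpow_le_rpow_of_exponent_le h hs₁).trans (by simp)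

/-- The integral of the kernel is the value of the symbol at the origin. -/
theorem integral_fourierInv (m : 𝓢(E3, ℂ)) : ∫ y, (𝓕⁻ m : 𝓢(E3, ℂ)) y = m 0 := by
  have h : (𝓕 (𝓕⁻ m) : 𝓢(E3, ℂ)) 0 = m 0 := by rw [FourierTransform.fourier_fourierInv_eq]
  rw [SchwartzMap.fourier_coe, Real.fourier_eq'] at h
  simpa using h

theorem hasTemperateGrowth_comp_smul (m : 𝓢(E3, ℂ)) (c : ℝ) :
    (fun ξ => m (c • ξ)).HasTemperateGrowth :=
  m.hasTemperateGrowth.comp (g := m) (f := fun ξ : E3 => c • ξ) (by fun_prop)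

/-- The transpose of the Fourier multiplier `m(c D)` is an average against the kernel `𝓕⁻ m`. -/
theorem fourier_smulLeftCLM_fourierInv_apply (m ψ : 𝓢(E3, ℂ)) (c : ℝ) (z : E3) :
    (𝓕 (SchwartzMap.smulLeftCLM ℂ (fun ξ => m (c • ξ)) (𝓕⁻ ψ)) : 𝓢(E3, ℂ)) z =
      ∫ y, (𝓕⁻ m : 𝓢(E3, ℂ)) y * ψ (z + c • y) := by
  set k : 𝓢(E3, ℂ) := 𝓕⁻ m with hk
  set θ : 𝓢(E3, ℂ) := 𝓕⁻ ψ with hθ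
  have hm : m = 𝓕 k := by rw [hk, FourierTransform.fourier_fourierInv_eq]
  have hψ : ψ = 𝓕 θ := by rw [hθ, FourierTransform.fourier_fourierInv_eq]
  rw [SchwartzMap.fourier_coe, Real.fourier_eq', hψ]
  simp_rw [SchwartzMap.smulLeftCLM_apply_apply (hasTemperateGrowth_comp_smul m c)]
  rw [hm]
  simp_rw [SchwartzMap.fourier_coe, Real.fourier_eq', smul_eq_mul]
  have hint : Integrable (Function.uncurry fun (ξ y : E3) =>
      Complex.exp (↑(-2 * Real.pi * inner ℝ ξ z) * Complex.I) *
        (Complex.exp (↑(-2 * Real.pi * inner ℝ y (c • ξ)) * Complex.I) * k y * θ ξ))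
      (volume.prod volume) := by
    have h1 : Integrable (fun p : E3 × E3 => θ p.1 * k p.2) (volume.prod volume) :=
      θ.integrable.mul_prod k.integrable
    have h2 : Continuous fun p : E3 × E3 =>
        Complex.exp (↑(-2 * Real.pi * inner ℝ p.1 z) * Complex.I) *
        Complex.exp (↑(-2 * Real.pi * inner ℝ p.2 (c • p.1)) * Complex.I) := by fun_prop
    refine (h1.mul_bdd (c := 1) h2.aestronglyMeasurable (.of_forall fun p => ?_)).congr
      (.of_forall fun p => ?_)
    · rw [norm_mul, Complex.norm_exp_ofReal_mul_I, Complex.norm_exp_ofReal_mul_I, one_mul]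
    · simp only [Function.uncurry]
      ring
  simp_rw [← integral_mul_const, ← integral_const_mul]
  rw [integral_integral_swap hint]
  congr 1 with y
  congr 1 with ξ
  have : Complex.exp (↑(-2 * Real.pi * inner ℝ ξ (z + c • y)) * Complex.I) =
      Complex.exp (↑(-2 * Real.pi * inner ℝ ξ z) * Complex.I) *
        Complex.exp (↑(-2 * Real.pi * inner ℝ y (c • ξ)) * Complex.I) := by
    rw [← Complex.exp_add, inner_add_right, inner_smul_right, inner_smul_right,
      real_inner_comm ξ y]
    push_cast
    ring_nf
  rw [this]
  ring

/-! ### Bounded functions as tempered distributions -/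

/-- The tempered distribution `T` is integration against the measurable function `v`, which is
bounded everywhere by `B`. -/
structure IsGivenBy (T : 𝓢'(E3, ℂ)) (v : E3 → ℂ) (B : ℝ) : Prop where
  measurable : Measurable v
  bound : ∀ x, ‖v x‖ ≤ B
  apply_eq : ∀ ψ : 𝓢(E3, ℂ), T ψ = ∫ x, ψ x * v x

theorem toTemperedDistribution_injective {g g' : Lp ℂ ∞ (volume : Measure E3)}
    (h : (g : 𝓢'(E3, ℂ)) = g') : g = g' := by
  have hk := Lp.ker_toTemperedDistributionCLM_eq_bot (F := ℂ) (μ := (volume : Measure E3)) (p := ∞)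
  exact (LinearMap.ker_eq_bot.1 hk) h

theorem memLp_top_of_measurable_of_bound {v : E3 → ℂ} {B : ℝ} (hv : Measurable v)
    (hB : ∀ x, ‖v x‖ ≤ B) : MemLp v ∞ (volume : Measure E3) :=
  memLp_top_of_bound hv.aestronglyMeasurable B (.of_forall hB)

namespace IsGivenBy

variable {T T' : 𝓢'(E3, ℂ)} {v v' : E3 → ℂ} {B B' : ℝ}

theorem memLp (h : IsGivenBy T v B) : MemLp v ∞ (volume : Measure E3) :=
  memLp_top_of_measurable_of_bound h.measurable h.bound

theorem toLp_eq (h : IsGivenBy T v B) : ((h.memLp.toLp v : Lp ℂ ∞ volume) : 𝓢'(E3, ℂ)) = T := by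
  ext ψ
  rw [h.apply_eq, Lp.toTemperedDistribution_apply]
  refine integral_congr_ae ?_
  filter_upwards [h.memLp.coeFn_toLp] with x hx
  rw [hx, smul_eq_mul]

theorem distLinftyNorm_le (h : IsGivenBy T v B) : distLinftyNorm T ≤ ENNReal.ofReal B := by
  refine (iInf₂_le (h.memLp.toLp v) h.toLp_eq).trans ?_
  rw [Lp.enorm_toLp, eLpNorm_exponent_top]
  exact eLpNormEssSup_le_of_ae_bound (.of_forall h.bound)

theorem ae_eq_of_coe_eq (h : IsGivenBy T v B) {g : Lp ℂ ∞ (volume : Measure E3)}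
    (hg : (g : 𝓢'(E3, ℂ)) = T) : g =ᵐ[volume] v := by
  rw [toTemperedDistribution_injective (hg.trans h.toLp_eq.symm)]
  exact h.memLp.coeFn_toLp

theorem ae_eq (h : IsGivenBy T v B) (h' : IsGivenBy T v' B') : v =ᵐ[volume] v' :=
  (h.ae_eq_of_coe_eq h'.toLp_eq).symm.trans h'.memLp.coeFn_toLp

theorem eq_of_continuous (h : IsGivenBy T v B) (h' : IsGivenBy T v' B') (hv : Continuous v)
    (hv' : Continuous v') : v = v' :=
  Continuous.ae_eq_iff_eq volume hv hv' |>.1 (h.ae_eq h')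

theorem add (h : IsGivenBy T v B) (h' : IsGivenBy T' v' B') :
    IsGivenBy (T + T') (fun x => v x + v' x) (B + B') where
  measurable := h.measurable.add h'.measurable
  bound x := (norm_add_le _ _).trans (add_le_add (h.bound x) (h'.bound x))
  apply_eq ψ := by
    change T ψ + T' ψ = _
    rw [h.apply_eq, h'.apply_eq, ← integral_add
      (integrable_mul_of_bounded ψ.integrable h.measurable h.bound)
      (integrable_mul_of_bounded ψ.integrable h'.measurable h'.bound)]
    simp_rw [mul_add]

theorem const_smul (h : IsGivenBy T v B) (c : ℂ) :
    IsGivenBy (c • T) (fun x => c * v x) (‖c‖ * B) where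
  measurable := h.measurable.const_mul c
  bound x := by
    rw [norm_mul]
    gcongr
    exact h.bound x
  apply_eq ψ := by
    change c • T ψ = _
    rw [h.apply_eq, smul_eq_mul, ← integral_const_mul]
    congr 1 with x
    ring

theorem sum {ι : Type*} (s : Finset ι) {T : ι → 𝓢'(E3, ℂ)} {v : ι → E3 → ℂ} {B : ι → ℝ}
    (h : ∀ i ∈ s, IsGivenBy (T i) (v i) (B i)) :
    IsGivenBy (∑ i ∈ s, T i) (fun x => ∑ i ∈ s, v i x) (∑ i ∈ s, B i) where
  measurable := Finset.measurable_fun_sum s fun i hi => (h i hi).measurable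
  bound x := norm_sum_le_of_le s fun i hi => (h i hi).bound x
  apply_eq ψ := by
    rw [sum_apply]
    simp_rw [Finset.mul_sum]
    rw [integral_finsetSum _ fun i hi =>
      integrable_mul_of_bounded ψ.integrable (h i hi).measurable (h i hi).bound]
    exact Finset.sum_congr rfl fun i hi => (h i hi).apply_eq ψ

theorem mono_bound (h : IsGivenBy T v B) (hB' : ∀ x, ‖v x‖ ≤ B') : IsGivenBy T v B' :=
  ⟨h.measurable, hB', h.apply_eq⟩

/-- Fourier multipliers with a Schwartz symbol act on bounded functions as averages. -/
theorem fourierMultiplier (h : IsGivenBy T v B) (m : 𝓢(E3, ℂ)) {c : ℝ} (hc : 0 < c) :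
    IsGivenBy (TemperedDistribution.fourierMultiplierCLM ℂ (fun ξ => m (c • ξ)) T)
      (scaleConv (𝓕⁻ m : 𝓢(E3, ℂ)) c v) ((∫ y, ‖(𝓕⁻ m : 𝓢(E3, ℂ)) y‖) * B) where
  measurable := (continuous_scaleConv (SchwartzMap.integrable _)
    (SchwartzMap.integral_norm_translate_sub_le _) h.measurable h.bound hc).measurable
  bound := norm_scaleConv_le (SchwartzMap.integrable _) h.bound c
  apply_eq ψ := by
    rw [TemperedDistribution.fourierMultiplierCLM_apply_apply, h.apply_eq,
      integral_mul_scaleConv' (SchwartzMap.integrable _) ψ.integrable h.measurable h.bound]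
    simp_rw [fourier_smulLeftCLM_fourierInv_apply]

end IsGivenBy

/-- A distribution of finite `L^∞` norm is given by a function which is bounded everywhere by this
norm. -/
theorem exists_isGivenBy {T : 𝓢'(E3, ℂ)} {B : ℝ} (hB : 0 ≤ B)
    (h : distLinftyNorm T ≤ ENNReal.ofReal B) : ∃ v, IsGivenBy T v B := by
  have : ∃ g : Lp ℂ ∞ (volume : Measure E3), (g : 𝓢'(E3, ℂ)) = T := by
    by_contra! hne
    have : distLinftyNorm T = ⊤ := by simp [distLinftyNorm, hne]
    simp [this] at h
  obtain ⟨g, rfl⟩ := this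
  have hg : ‖g‖ₑ ≤ ENNReal.ofReal B := by
    refine le_trans (le_iInf₂ fun g' hg' => ?_) h
    rw [toTemperedDistribution_injective hg']
  have hgB : ∀ᵐ x, ‖g x‖ ≤ B := by
    rw [Lp.enorm_def, eLpNorm_exponent_top] at hg
    filter_upwards [ae_le_eLpNormEssSup (f := g) (μ := volume)] with x hx
    have := hx.trans hg
    rwa [← ofReal_norm, ENNReal.ofReal_le_ofReal_iff hB] at this
  have hgm : Measurable g := (Lp.stronglyMeasurable g).measurable
  -- the representative is set to zero on the null set where it exceeds the norm
  refine ⟨{x | ‖g x‖ ≤ B}.indicator g, ?_, fun x => ?_, fun ψ => ?_⟩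
  · exact hgm.indicator (measurableSet_le hgm.norm measurable_const)
  · by_cases hx : ‖g x‖ ≤ B <;> simp [Set.indicator, hx, hB]
  · rw [Lp.toTemperedDistribution_apply]
    refine integral_congr_ae ?_
    filter_upwards [hgB] with x hx
    simp [Set.indicator, hx]

theorem isGivenBy_boundedDist {u : E3 → ℝ} {B : ℝ} (hu : Measurable u) (hB : ∀ x, |u x| ≤ B) :
    IsGivenBy (boundedDist u) (fun x => (u x : ℂ)) B where
  measurable := Complex.measurable_ofReal.comp hu
  bound x := by simpa using hB x
  apply_eq := boundedDist_apply
    (memLp_top_of_bound hu.aestronglyMeasurable B (.of_forall fun x => by simpa using hB x))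

theorem boundedDist_congr_ae {u u' : E3 → ℝ} (h : u =ᵐ[volume] u') :
    boundedDist u = boundedDist u' := by
  have hc : (fun x => (u x : ℂ)) =ᵐ[volume] fun x => (u' x : ℂ) := by
    filter_upwards [h] with x hx
    rw [hx]
  have hm := memLp_congr_ae (p := ∞) hc
  unfold boundedDist
  by_cases hu : MemLp (fun x => (u x : ℂ)) ∞ (volume : Measure E3)
  · rw [dif_pos hu, dif_pos (hm.1 hu)]
    congr 1
    exact (MemLp.toLp_eq_toLp_iff _ _).2 hc
  · rw [dif_neg hu, dif_neg (fun h' => hu (hm.2 h'))]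

theorem distLinftyNorm_add_le (T T' : 𝓢'(E3, ℂ)) :
    distLinftyNorm (T + T') ≤ distLinftyNorm T + distLinftyNorm T' := by
  rcases eq_or_ne (distLinftyNorm T) ⊤ with h | h
  · simp [h]
  rcases eq_or_ne (distLinftyNorm T') ⊤ with h' | h'
  · simp [h']
  obtain ⟨v, hv⟩ := exists_isGivenBy (T := T) ENNReal.toReal_nonneg (ENNReal.ofReal_toReal h).ge
  obtain ⟨v', hv'⟩ := exists_isGivenBy (T := T') ENNReal.toReal_nonneg
    (ENNReal.ofReal_toReal h').ge
  refine (hv.add hv').distLinftyNorm_le.trans_eq ?_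
  rw [ENNReal.ofReal_add ENNReal.toReal_nonneg ENNReal.toReal_nonneg, ENNReal.ofReal_toReal h,
    ENNReal.ofReal_toReal h']

/-! ### Symbols of the dyadic blocks -/

/-- The dilated function `m(c ·)`. -/
noncomputable def SchwartzMap.dilate (m : 𝓢(E3, ℂ)) (c : ℝˣ) : 𝓢(E3, ℂ) :=
  SchwartzMap.compCLMOfContinuousLinearEquiv ℂ (ContinuousLinearEquiv.smulLeft c) m

theorem SchwartzMap.dilate_apply (m : 𝓢(E3, ℂ)) (c : ℝˣ) (ξ : E3) :
    m.dilate c ξ = m ((c : ℝ) • ξ) := rfl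

/-- The symbol `2πi ⟨ξ, e⟩ m(ξ)` of the composition of the multiplier `m(D)` with the derivative in
the direction `e`. -/
noncomputable def diffSymbol (e : E3) (m : 𝓢(E3, ℂ)) : 𝓢(E3, ℂ) :=
  (2 * Real.pi * Complex.I) • SchwartzMap.smulLeftCLM ℂ (fun ξ => inner ℝ ξ e) m

theorem diffSymbol_apply (e : E3) (m : 𝓢(E3, ℂ)) (ξ : E3) :
    diffSymbol e m ξ = 2 * Real.pi * Complex.I * (((inner ℝ ξ e : ℝ) : ℂ) * m ξ) := by
  have h : (fun ξ : E3 => inner ℝ ξ e).HasTemperateGrowth := by fun_prop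
  simp [diffSymbol, SchwartzMap.smulLeftCLM_apply_apply h]

theorem diffSymbol_zero (e : E3) (m : 𝓢(E3, ℂ)) : diffSymbol e m 0 = 0 := by
  simp [diffSymbol_apply]

theorem fourierInv_diffSymbol (e : E3) (m : 𝓢(E3, ℂ)) :
    (𝓕⁻ (diffSymbol e m) : 𝓢(E3, ℂ)) = ∂_{e} (𝓕⁻ m : 𝓢(E3, ℂ)) :=
  (SchwartzMap.lineDerivOp_fourierInv_eq m e).symm

theorem fourierMultiplierCLM_add {g₁ g₂ : E3 → ℂ} (h₁ : g₁.HasTemperateGrowth)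
    (h₂ : g₂.HasTemperateGrowth) (T : 𝓢'(E3, ℂ)) :
    TemperedDistribution.fourierMultiplierCLM ℂ (g₁ + g₂) T =
      TemperedDistribution.fourierMultiplierCLM ℂ g₁ T +
        TemperedDistribution.fourierMultiplierCLM ℂ g₂ T := by
  simp [TemperedDistribution.fourierMultiplierCLM_apply, TemperedDistribution.smulLeftCLM_add h₁ h₂,
    FourierTransform.fourierInv_add]

theorem fourierMultiplierCLM_lineDerivOp (m : 𝓢(E3, ℂ)) {c : ℝ} (hc : c ≠ 0) (e : E3)
    (T : 𝓢'(E3, ℂ)) :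
    TemperedDistribution.fourierMultiplierCLM ℂ (fun ξ => m (c • ξ)) (∂_{e} T) =
      (c⁻¹ : ℂ) • TemperedDistribution.fourierMultiplierCLM ℂ
        (fun ξ => diffSymbol e m (c • ξ)) T := by
  have h : (fun ξ : E3 => ((inner ℝ ξ e : ℝ) : ℂ)).HasTemperateGrowth := by fun_prop
  have hm := hasTemperateGrowth_comp_smul m c
  have hs : (fun ξ => diffSymbol e m (c • ξ)) = (2 * Real.pi * Complex.I * c) •
      ((fun ξ : E3 => ((inner ℝ ξ e : ℝ) : ℂ)) * fun ξ => m (c • ξ)) := by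
    ext ξ
    simp only [diffSymbol_apply, Pi.smul_apply, Pi.mul_apply, inner_smul_left, smul_eq_mul]
    push_cast
    simp
    ring
  rw [TemperedDistribution.lineDeriv_eq_fourierMultiplierCLM, map_smul,
    TemperedDistribution.fourierMultiplierCLM_fourierMultiplierCLM_apply h hm, hs,
    TemperedDistribution.fourierMultiplierCLM_smul (h.mul hm)]
  rw [smul_apply, smul_smul]
  have hc' : (c : ℂ) ≠ 0 := by exact_mod_cast hc
  congr 1
  field_simp

namespace DyadicPartition

variable (𝔇 : DyadicPartition)

/-- The low-frequency symbol `χ` as a Schwartz function. -/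
noncomputable def lowSymbol : 𝓢(E3, ℂ) :=
  HasCompactSupport.toSchwartzMap (f := fun ξ => (𝔇.χ ξ : ℂ))
    (𝔇.hasCompactSupport_χ.comp_left (g := fun t : ℝ => (t : ℂ)) Complex.ofReal_zero)
    (Complex.ofRealCLM.contDiff.comp 𝔇.contDiff_χ)

theorem lowSymbol_apply (ξ : E3) : 𝔇.lowSymbol ξ = (𝔇.χ ξ : ℂ) := rfl

/-- The sum of the dyadic partition telescopes, so that `χ` determines `φ`. -/
theorem φ_eq (ξ : E3) : 𝔇.φ ξ = 𝔇.χ ((2 : ℝ)⁻¹ • ξ) - 𝔇.χ ξ := by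
  have h1 := 𝔇.hasSum_φ ξ
  have h2 := 𝔇.hasSum_φ ((2 : ℝ)⁻¹ • ξ)
  have h3 := (hasSum_nat_add_iff' 1).2 h1
  simp only [Finset.range_one, Finset.sum_singleton, pow_zero, one_smul] at h3
  have h4 := h3.unique (h2.congr_fun fun q => by rw [smul_smul, pow_succ])
  linarith

theorem exists_χ_eq_one : ∃ a > 0, ∀ ξ : E3, ‖ξ‖ < a → 𝔇.χ ξ = 1 := by
  obtain ⟨a, ha, hsub⟩ := Metric.isOpen_iff.1 (isClosed_tsupport 𝔇.φ).isOpen_compl 0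
    𝔇.zero_notMem_tsupport_φ
  refine ⟨a, ha, fun ξ hξ => ?_⟩
  have h0 : ∀ q : ℕ, 𝔇.φ ((2 : ℝ)⁻¹ ^ q • ξ) = 0 := fun q => by
    refine image_eq_zero_of_notMem_tsupport (hsub ?_)
    rw [mem_ball_zero_iff, norm_smul, norm_pow, norm_inv, Real.norm_two]
    refine lt_of_le_of_lt (mul_le_of_le_one_left (norm_nonneg _) ?_) hξ
    exact pow_le_one₀ (by norm_num) (by norm_num)
  have := (𝔇.hasSum_φ ξ).unique (by simp only [h0]; exact hasSum_zero)
  linarith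

theorem exists_χ_eq_zero : ∃ R > 0, ∀ ξ : E3, R ≤ ‖ξ‖ → 𝔇.χ ξ = 0 := by
  obtain ⟨R, hR, h⟩ := 𝔇.hasCompactSupport_χ.isCompact.isBounded.subset_ball_lt 0 0
  refine ⟨R, hR, fun ξ hξ => image_eq_zero_of_notMem_tsupport fun hmem => ?_⟩
  exact absurd (mem_ball_zero_iff.1 (h hmem)) hξ.not_gt

/-- The symbol of the `n`-th block at unit scale: the block is the multiplier with symbol
`baseSymbol n (2⁻ⁿ ·)`. -/
noncomputable def baseSymbol : ℕ → 𝓢(E3, ℂ)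
  | 0 => 𝔇.lowSymbol
  | _ + 1 => 𝔇.lowSymbol - 𝔇.lowSymbol.dilate (Units.mk0 2 two_ne_zero)

theorem block_eq (n : ℕ) (T : 𝓢'(E3, ℂ)) :
    𝔇.block n T = TemperedDistribution.fourierMultiplierCLM ℂ
      (fun ξ => 𝔇.baseSymbol n ((2 : ℝ)⁻¹ ^ n • ξ)) T := by
  cases n with
  | zero => simp [block, baseSymbol, lowSymbol_apply]
  | succ n =>
    simp only [block]
    congr 2
    ext ξ
    rw [φ_eq, smul_smul, ← pow_succ', baseSymbol, sub_apply, SchwartzMap.dilate_apply,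
      lowSymbol_apply, lowSymbol_apply, Units.val_mk0, smul_smul, pow_succ' _ n, ← mul_assoc]
    simp

theorem lowFreq_eq (j : ℕ) (T : 𝓢'(E3, ℂ)) :
    𝔇.lowFreq j T = TemperedDistribution.fourierMultiplierCLM ℂ
      (fun ξ => 𝔇.lowSymbol ((2 : ℝ)⁻¹ ^ j • ξ)) T := rfl

theorem lowFreq_eq_sum (j : ℕ) (T : 𝓢'(E3, ℂ)) :
    𝔇.lowFreq j T = ∑ n ∈ Finset.range (j + 1), 𝔇.block n T := by
  induction j with
  | zero => simp [lowFreq_eq, block_eq, baseSymbol]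
  | succ j ih =>
    rw [Finset.sum_range_succ, ← ih, lowFreq_eq, lowFreq_eq, block_eq,
      ← fourierMultiplierCLM_add (hasTemperateGrowth_comp_smul _ _)
        (hasTemperateGrowth_comp_smul _ _)]
    congr 2
    ext ξ
    simp only [Pi.add_apply, baseSymbol, sub_apply, SchwartzMap.dilate_apply, Units.val_mk0,
      smul_smul]
    rw [pow_succ' _ j, ← mul_assoc]
    simp

theorem block_add (n : ℕ) (T T' : 𝓢'(E3, ℂ)) :
    𝔇.block n (T + T') = 𝔇.block n T + 𝔇.block n T' := by
  simp only [block_eq, map_add]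

theorem block_lineDerivOp (n : ℕ) (e : E3) (T : 𝓢'(E3, ℂ)) :
    𝔇.block n (∂_{e} T) = ((2 : ℂ) ^ n) • TemperedDistribution.fourierMultiplierCLM ℂ
      (fun ξ => diffSymbol e (𝔇.baseSymbol n) ((2 : ℝ)⁻¹ ^ n • ξ)) T := by
  rw [block_eq, fourierMultiplierCLM_lineDerivOp _ (by positivity)]
  congr 1
  push_cast
  rw [inv_pow, inv_inv]

theorem holderNorm_add_le (σ : ℝ) (T T' : 𝓢'(E3, ℂ)) :
    𝔇.holderNorm σ (T + T') ≤ 𝔇.holderNorm σ T + 𝔇.holderNorm σ T' := by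
  refine iSup_le fun n => ?_
  rw [block_add]
  calc _ ≤ ENNReal.ofReal ((2 : ℝ) ^ (((n : ℝ) - 1) * σ)) *
        (distLinftyNorm (𝔇.block n T) + distLinftyNorm (𝔇.block n T')) := by
        gcongr
        exact distLinftyNorm_add_le _ _
    _ ≤ _ := by
        rw [mul_add]
        exact add_le_add
          (le_iSup (fun n : ℕ => ENNReal.ofReal ((2 : ℝ) ^ (((n : ℝ) - 1) * σ)) *
            distLinftyNorm (𝔇.block n T)) n)
          (le_iSup (fun n : ℕ => ENNReal.ofReal ((2 : ℝ) ^ (((n : ℝ) - 1) * σ)) *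
            distLinftyNorm (𝔇.block n T')) n)

/-- There are symbols equal to `1` on the support of the symbols of the blocks; for the blocks of
positive index the same one can be used at unit scale, and it vanishes at the origin. -/
theorem exists_fatSymbol : ∃ fat : ℕ → 𝓢(E3, ℂ), (∀ n, fat (n + 1) = fat 1) ∧ fat 1 0 = 0 ∧
    ∀ n ξ, 𝔇.baseSymbol n ξ * fat n ξ = 𝔇.baseSymbol n ξ := by
  obtain ⟨a, ha, h1⟩ := 𝔇.exists_χ_eq_one
  obtain ⟨R, hR, h0⟩ := 𝔇.exists_χ_eq_zero
  -- a dilation factor so large that the rescaled cut-offs are constant on the annulus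
  -- `a / 2 ≤ |ξ| ≤ R`
  set b : ℝ := 2 * R / a + 1 with hb
  have hb0 : 0 < b := by positivity
  have hba : R < b * (a / 2) := by
    rw [hb, add_mul]
    have : 2 * R / a * (a / 2) = R := by field_simp
    linarith
  set low := 𝔇.lowSymbol.dilate (Units.mk0 b⁻¹ (by positivity)) with hlow
  set high := 𝔇.lowSymbol.dilate (Units.mk0 b hb0.ne') with hhigh
  have hlow_apply : ∀ ξ, ‖ξ‖ < R → low ξ = 1 := fun ξ hξ => by
    rw [hlow, SchwartzMap.dilate_apply, lowSymbol_apply, h1, Complex.ofReal_one]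
    rw [Units.val_mk0, norm_smul, norm_inv, Real.norm_of_nonneg hb0.le, inv_mul_lt_iff₀ hb0]
    nlinarith
  have hhigh_apply : ∀ ξ, a / 2 ≤ ‖ξ‖ → high ξ = 0 := fun ξ hξ => by
    rw [hhigh, SchwartzMap.dilate_apply, lowSymbol_apply, h0, Complex.ofReal_zero]
    rw [Units.val_mk0, norm_smul, Real.norm_of_nonneg hb0.le]
    exact hba.le.trans (by gcongr)
  refine ⟨fun n => if n = 0 then low else low - high, fun n => by simp, ?_, fun n ξ => ?_⟩
  · simp [hlow, hhigh, SchwartzMap.dilate_apply]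
  · cases n with
    | zero =>
      rcases lt_or_ge ‖ξ‖ R with h | h
      · simp [hlow_apply ξ h]
      · simp [baseSymbol, lowSymbol_apply, h0 ξ h]
    | succ n =>
      rcases lt_or_ge ‖ξ‖ R with h | h
      · rcases lt_or_ge ‖ξ‖ (a / 2) with h' | h'
        · have h2 : 𝔇.χ ((2 : ℝ) • ξ) = 1 := h1 _ (by
            rw [norm_smul, Real.norm_two]
            linarith)
          have h3 : 𝔇.χ ξ = 1 := h1 _ (by linarith)
          simp [baseSymbol, SchwartzMap.dilate_apply, lowSymbol_apply, h2, h3]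
        · simp [hlow_apply ξ h, hhigh_apply ξ h']
      · have h2 : 𝔇.χ ((2 : ℝ) • ξ) = 0 := h0 _ (by
          rw [norm_smul, Real.norm_two]
          linarith)
        simp [baseSymbol, SchwartzMap.dilate_apply, lowSymbol_apply, h2, h0 ξ h]

/-- A bounded block has a continuous representative, which is reproduced by averages against a fixed
Schwartz kernel at the scale of the block. For the blocks of positive index this kernel does not
depend on the index and has mean zero. -/
theorem exists_fatKernel : ∃ k : ℕ → 𝓢(E3, ℂ), (∀ n, k (n + 1) = k 1) ∧ ∫ y, k 1 y = 0 ∧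
    ∀ n (T : 𝓢'(E3, ℂ)) (B : ℝ), 0 ≤ B → distLinftyNorm (𝔇.block n T) ≤ ENNReal.ofReal B →
      ∃ v, IsGivenBy (𝔇.block n T) v B ∧ Continuous v ∧ v = scaleConv (k n) ((2 : ℝ)⁻¹ ^ n) v := by
  obtain ⟨fat, hfat, hfat0, hmul⟩ := 𝔇.exists_fatSymbol
  refine ⟨fun n => 𝓕⁻ (fat n), fun n => by simp only [hfat n],
    by rw [integral_fourierInv, hfat0], fun n T B hB hT => ?_⟩
  obtain ⟨v, hv⟩ := exists_isGivenBy hB hT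
  have hc : (0 : ℝ) < (2 : ℝ)⁻¹ ^ n := by positivity
  have hblock : TemperedDistribution.fourierMultiplierCLM ℂ
      (fun ξ => fat n ((2 : ℝ)⁻¹ ^ n • ξ)) (𝔇.block n T) = 𝔇.block n T := by
    rw [block_eq, TemperedDistribution.fourierMultiplierCLM_fourierMultiplierCLM_apply
      (hasTemperateGrowth_comp_smul _ _) (hasTemperateGrowth_comp_smul _ _)]
    congr 2
    ext ξ
    exact hmul n _
  have hcont : ∀ {w : E3 → ℂ} {B'}, IsGivenBy (𝔇.block n T) w B' →
      Continuous (scaleConv (𝓕⁻ (fat n) : 𝓢(E3, ℂ)) ((2 : ℝ)⁻¹ ^ n) w) := fun h =>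
    continuous_scaleConv (SchwartzMap.integrable _)
      (SchwartzMap.integral_norm_translate_sub_le _) h.measurable h.bound hc
  have h1 := hv.fourierMultiplier (fat n) hc
  rw [hblock] at h1
  set v₁ := scaleConv (𝓕⁻ (fat n) : 𝓢(E3, ℂ)) ((2 : ℝ)⁻¹ ^ n) v with hv₁
  have h2 := h1.fourierMultiplier (fat n) hc
  rw [hblock] at h2
  have hbound : ∀ x, ‖v₁ x‖ ≤ B := by
    have hae : ∀ᵐ x, ‖v₁ x‖ ≤ B := by
      filter_upwards [h1.ae_eq hv] with x hx
      rw [hx]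
      exact hv.bound x
    have hcl : IsClosed {x | ‖v₁ x‖ ≤ B} := isClosed_le (hcont hv).norm continuous_const
    have hd := Measure.dense_of_ae hae
    exact fun x => hcl.closure_subset (hd x)
  exact ⟨v₁, h1.mono_bound hbound, hcont hv, h1.eq_of_continuous h2 (hcont hv) (hcont h1)⟩

end DyadicPartition

/-! ### Besov norms and Hölder continuity -/

/-- With truncated subtraction the exponent `(n - m) + (m - n)` is the distance of `n` and `m`. -/
theorem sum_pow_sub_add_sub_le {q : ℝ} (hq₀ : 0 ≤ q) (hq₁ : q < 1) (m J : ℕ) :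
    ∑ n ∈ Finset.range J, q ^ ((n - m) + (m - n)) ≤ 2 / (1 - q) := by
  have hgeom : ∀ N : ℕ, ∑ i ∈ Finset.range N, q ^ i ≤ 1 / (1 - q) := fun N => by
    rw [one_div, ← tsum_geometric_of_lt_one hq₀ hq₁]
    exact (summable_geometric_of_lt_one hq₀ hq₁).sum_le_tsum _ fun i _ => pow_nonneg hq₀ i
  calc ∑ n ∈ Finset.range J, q ^ ((n - m) + (m - n))
      ≤ ∑ n ∈ Finset.range (m + J), q ^ ((n - m) + (m - n)) := by
        refine Finset.sum_le_sum_of_subset_of_nonneg ?_ fun i _ _ => pow_nonneg hq₀ _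
        exact Finset.range_mono (Nat.le_add_left _ _)
    _ = ∑ n ∈ Finset.range m, q ^ ((n - m) + (m - n)) +
          ∑ i ∈ Finset.range J, q ^ ((m + i - m) + (m - (m + i))) := Finset.sum_range_add _ _ _
    _ ≤ ∑ i ∈ Finset.range m, q ^ i + ∑ i ∈ Finset.range J, q ^ i := by
        refine add_le_add ?_ (Finset.sum_le_sum fun i _ => le_of_eq ?_)
        · rw [← Finset.sum_range_reflect]
          refine Finset.sum_le_sum fun i hi => pow_le_pow_of_le_one hq₀ hq₁.le ?_
          have := Finset.mem_range.1 hi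
          omega
        · congr 1
          omega
    _ ≤ 1 / (1 - q) + 1 / (1 - q) := add_le_add (hgeom _) (hgeom _)
    _ = 2 / (1 - q) := by ring

/-- The two-sided geometric sum behind all the estimates: frequencies below `2ᵐ` contribute
through growth of exponent `1 - s > 0`, frequencies above `2ᵐ` through decay of exponent `s > 0`. -/
theorem exists_sum_min_le {s : ℝ} (hs₀ : 0 < s) (hs₁ : s < 1) : ∃ C : ℝ, 0 ≤ C ∧ ∀ m J : ℕ,
    ∑ n ∈ Finset.range J, (2 : ℝ) ^ ((n : ℝ) * (1 - s)) * min 1 (2 ^ m * (2 : ℝ)⁻¹ ^ n) ≤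
      C * (2 : ℝ) ^ ((m : ℝ) * (1 - s)) := by
  set q : ℝ := (2 : ℝ) ^ (-min s (1 - s)) with hq
  have hmin : 0 < min s (1 - s) := lt_min hs₀ (by linarith)
  have hq₀ : 0 ≤ q := by positivity
  have hq₁ : q < 1 := Real.rpow_lt_one_of_one_lt_of_neg one_lt_two (by linarith)
  refine ⟨2 / (1 - q), div_nonneg two_pos.le (by linarith), fun m J => ?_⟩
  have hterm : ∀ n : ℕ, (2 : ℝ) ^ ((n : ℝ) * (1 - s)) * min 1 (2 ^ m * (2 : ℝ)⁻¹ ^ n) ≤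
      q ^ ((n - m) + (m - n)) * (2 : ℝ) ^ ((m : ℝ) * (1 - s)) := fun n => by
    rw [hq, ← Real.rpow_natCast _ ((n - m) + (m - n)), ← Real.rpow_mul two_pos.le,
      ← Real.rpow_add two_pos]
    rcases le_total n m with h | h
    · have hc : (((n - m) + (m - n) : ℕ) : ℝ) = m - n := by
        rw [Nat.sub_eq_zero_of_le h, zero_add, Nat.cast_sub h]
      rw [hc]
      refine (mul_le_of_le_one_right (by positivity) (min_le_left _ _)).trans ?_
      refine Real.rpow_le_rpow_of_exponent_le one_le_two ?_
      have h1 : (0 : ℝ) ≤ m - n := by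
        rw [sub_nonneg]
        exact_mod_cast h
      nlinarith [mul_le_mul_of_nonneg_right (min_le_right s (1 - s)) h1]
    · have hc : (((n - m) + (m - n) : ℕ) : ℝ) = n - m := by
        rw [Nat.sub_eq_zero_of_le h, add_zero, Nat.cast_sub h]
      have h2 : (2 : ℝ) ^ m * (2 : ℝ)⁻¹ ^ n = (2 : ℝ) ^ ((m : ℝ) - n) := by
        rw [Real.rpow_sub two_pos, Real.rpow_natCast, Real.rpow_natCast, inv_pow, div_eq_mul_inv]
      rw [hc, h2]
      refine (mul_le_mul_of_nonneg_left (min_le_right _ _) (by positivity)).trans ?_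
      rw [← Real.rpow_add two_pos]
      refine Real.rpow_le_rpow_of_exponent_le one_le_two ?_
      have h1 : (0 : ℝ) ≤ n - m := by
        rw [sub_nonneg]
        exact_mod_cast h
      nlinarith [mul_le_mul_of_nonneg_right (min_le_left s (1 - s)) h1]
  refine (Finset.sum_le_sum fun n _ => hterm n).trans ?_
  rw [← Finset.sum_mul]
  gcongr
  exact sum_pow_sub_add_sub_le hq₀ hq₁ m J

/-- For each distance `d` there is a dyadic scale at which the interpolation `min 1 (2ⁿ d)` between
the trivial and the Lipschitz bound is controlled by the terms of `exists_sum_min_le`. -/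
theorem exists_dyadic_scale {s d : ℝ} (hs₀ : 0 < s) (hd : 0 < d) : ∃ m : ℕ,
    (2 : ℝ)⁻¹ ^ m * (2 : ℝ) ^ ((m : ℝ) * (1 - s)) ≤ 2 ^ s * d ^ s ∧
    ∀ n : ℕ, min 1 (2 ^ n * d) ≤ 2 ^ n * (2 : ℝ)⁻¹ ^ m * min 1 (2 ^ m * (2 : ℝ)⁻¹ ^ n) := by
  have hcancel : ∀ n : ℕ, (2 : ℝ) ^ n * (2 : ℝ)⁻¹ ^ n = 1 := fun n => by
    rw [← mul_pow, mul_inv_cancel₀ two_ne_zero, one_pow]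
  have hmul : ∀ m n : ℕ, (2 : ℝ) ^ n * (2 : ℝ)⁻¹ ^ m * min 1 (2 ^ m * (2 : ℝ)⁻¹ ^ n) =
      min (2 ^ n * (2 : ℝ)⁻¹ ^ m) 1 := fun m n => by
    rw [mul_min_of_nonneg _ _ (by positivity), mul_one]
    congr 1
    linear_combination (2 : ℝ) ^ n * (2 : ℝ)⁻¹ ^ n * hcancel m + hcancel n
  rcases le_total d 1 with h | h
  -- `m` is determined by `2⁻ᵐ⁻¹ < d ≤ 2⁻ᵐ`, and it is `0` when `d ≥ 1`
  · obtain ⟨m, hm1, hm2⟩ := exists_nat_pow_near_of_lt_one hd h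
      (by norm_num : (0 : ℝ) < (2 : ℝ)⁻¹) (by norm_num)
    refine ⟨m, ?_, fun n => ?_⟩
    · have h1 : (2 : ℝ)⁻¹ ^ m * (2 : ℝ) ^ ((m : ℝ) * (1 - s)) = ((2 : ℝ)⁻¹ ^ m) ^ s := by
        rw [inv_pow, ← Real.rpow_natCast, ← Real.rpow_neg two_pos.le, ← Real.rpow_add two_pos,
          ← Real.rpow_mul two_pos.le]
        congr 1
        ring
      rw [h1, ← Real.mul_rpow two_pos.le hd.le]
      refine Real.rpow_le_rpow (by positivity) ?_ hs₀.le
      rw [pow_succ] at hm1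
      linarith
    · rw [hmul, min_comm]
      exact min_le_min_right _ (by gcongr)
  · refine ⟨0, ?_, fun n => ?_⟩
    · simp only [pow_zero, Nat.cast_zero, zero_mul, Real.rpow_zero, mul_one]
      have h1 := Real.one_le_rpow h hs₀.le
      have h2 := Real.one_le_rpow one_le_two hs₀.le
      nlinarith
    · rw [hmul]
      refine (min_le_left _ _).trans (le_min ?_ le_rfl)
      rw [pow_zero, mul_one]
      exact one_le_pow₀ one_le_two

namespace DyadicPartition

variable (𝔇 : DyadicPartition)

theorem distLinftyNorm_block_le {σ N : ℝ} {T : 𝓢'(E3, ℂ)}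
    (h : 𝔇.holderNorm σ T ≤ ENNReal.ofReal N) (n : ℕ) :
    distLinftyNorm (𝔇.block n T) ≤ ENNReal.ofReal ((2 : ℝ) ^ ((1 - (n : ℝ)) * σ) * N) := by
  have h1 : ENNReal.ofReal ((2 : ℝ) ^ (((n : ℝ) - 1) * σ)) * distLinftyNorm (𝔇.block n T) ≤
      ENNReal.ofReal N :=
    (le_iSup (fun n : ℕ => ENNReal.ofReal ((2 : ℝ) ^ (((n : ℝ) - 1) * σ)) *
      distLinftyNorm (𝔇.block n T)) n).trans h
  have h2 : (2 : ℝ) ^ ((1 - (n : ℝ)) * σ) * (2 : ℝ) ^ (((n : ℝ) - 1) * σ) = 1 := by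
    rw [← Real.rpow_add two_pos, ← add_mul, sub_add_sub_cancel, sub_self, zero_mul,
      Real.rpow_zero]
  calc distLinftyNorm (𝔇.block n T) = ENNReal.ofReal ((2 : ℝ) ^ ((1 - (n : ℝ)) * σ)) *
        (ENNReal.ofReal ((2 : ℝ) ^ (((n : ℝ) - 1) * σ)) * distLinftyNorm (𝔇.block n T)) := by
        rw [← mul_assoc, ← ENNReal.ofReal_mul (by positivity), h2, ENNReal.ofReal_one, one_mul]
    _ ≤ _ := by
        rw [ENNReal.ofReal_mul (by positivity)]
        gcongr

theorem holderNorm_le_of_block_le {σ N : ℝ} {T : 𝓢'(E3, ℂ)}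
    (h : ∀ n : ℕ, distLinftyNorm (𝔇.block n T) ≤
      ENNReal.ofReal ((2 : ℝ) ^ ((1 - (n : ℝ)) * σ) * N)) :
    𝔇.holderNorm σ T ≤ ENNReal.ofReal N := by
  refine iSup_le fun n => ?_
  calc _ ≤ ENNReal.ofReal ((2 : ℝ) ^ (((n : ℝ) - 1) * σ)) *
        ENNReal.ofReal ((2 : ℝ) ^ ((1 - (n : ℝ)) * σ) * N) := by
        gcongr
        exact h n
    _ = ENNReal.ofReal N := by
        rw [← ENNReal.ofReal_mul (by positivity), ← mul_assoc, ← Real.rpow_add two_pos, ← add_mul,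
          sub_add_sub_cancel, sub_self, zero_mul, Real.rpow_zero, one_mul]

/-- A bounded continuous function in `C^s_*`, with `0 < s < 1`, is `s`-Hölder continuous. -/
theorem exists_holder_of_holderNorm_le {s : ℝ} (hs₀ : 0 < s) (hs₁ : s < 1) :
    ∃ C : ℝ, 0 ≤ C ∧ ∀ (u : E3 → ℝ) (B N : ℝ), Continuous u → (∀ x, |u x| ≤ B) → 0 ≤ N →
      𝔇.holderNorm s (boundedDist u) ≤ ENNReal.ofReal N →
      ∀ x y, |u x - u y| ≤ C * N * ‖x - y‖ ^ s := by
  obtain ⟨k, hk, -, hrepr⟩ := 𝔇.exists_fatKernel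
  obtain ⟨C₁, hC₁, hsum⟩ := exists_sum_min_le hs₀ hs₁
  set V : ℕ → ℝ := fun n => 16 * (∫ z, decayWeight z) * decaySeminorm (k n) with hV
  have hVnn : ∀ n, 0 ≤ V n := fun n => by
    have : 0 ≤ ∫ z, decayWeight z := integral_nonneg decayWeight_nonneg
    positivity
  set A : ℝ := 2 + V 0 + V 1 with hA
  have hVA : ∀ n, V n ≤ A := fun n => by
    cases n with
    | zero => linarith [hVnn 1]
    | succ n =>
      have : V (n + 1) = V 1 := by simp only [hV, hk n]
      linarith [hVnn 0]
  have hA2 : 2 ≤ A := by linarith [hVnn 0, hVnn 1]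
  refine ⟨2 ^ s * A * C₁ * 2 ^ s, by positivity, fun u B N hu hB hN hnorm x y => ?_⟩
  rcases eq_or_ne x y with rfl | hxy
  · rw [sub_self, abs_zero]
    positivity
  have hd : 0 < ‖x - y‖ := norm_pos_iff.2 (sub_ne_zero.2 hxy)
  set d := ‖x - y‖ with hd_def
  have hT := isGivenBy_boundedDist hu.measurable hB
  choose v hv hvc hvk using fun n => hrepr n (boundedDist u)
    ((2 : ℝ) ^ ((1 - (n : ℝ)) * s) * N) (by positivity) (𝔇.distLinftyNorm_block_le hnorm n)
  -- each block satisfies both the trivial and the Lipschitz bound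
  have hblock : ∀ n, ‖v n x - v n y‖ ≤
      A * ((2 : ℝ) ^ ((1 - (n : ℝ)) * s) * N) * min 1 (2 ^ n * d) := fun n => by
    set b := (2 : ℝ) ^ ((1 - (n : ℝ)) * s) * N with hb
    have hb0 : 0 ≤ b := by positivity
    rw [mul_min_of_nonneg _ _ (by positivity)]
    refine le_min ?_ ?_
    · refine (norm_sub_le _ _).trans ?_
      nlinarith [(hv n).bound x, (hv n).bound y]
    · rw [hvk n]
      refine (norm_scaleConv_sub_le (k n).integrable (k n).integral_norm_translate_sub_le
        (hv n).measurable (hv n).bound (by positivity) x y).trans ?_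
      rw [inv_pow, div_inv_eq_mul, mul_comm _ ((2 : ℝ) ^ n)]
      gcongr
      exact hVA n
  obtain ⟨m, hm1, hm2⟩ := exists_dyadic_scale (s := s) hs₀ hd
  have hterm : ∀ n : ℕ, A * ((2 : ℝ) ^ ((1 - (n : ℝ)) * s) * N) * min 1 (2 ^ n * d) ≤
      2 ^ s * A * N * (2 : ℝ)⁻¹ ^ m *
        ((2 : ℝ) ^ ((n : ℝ) * (1 - s)) * min 1 (2 ^ m * (2 : ℝ)⁻¹ ^ n)) := fun n => by
    refine (mul_le_mul_of_nonneg_left (hm2 n) (by positivity)).trans_eq ?_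
    have h1 : (2 : ℝ) ^ ((1 - (n : ℝ)) * s) * 2 ^ n = 2 ^ s * (2 : ℝ) ^ ((n : ℝ) * (1 - s)) := by
      rw [← Real.rpow_natCast, ← Real.rpow_add two_pos, ← Real.rpow_add two_pos]
      congr 1
      ring
    linear_combination A * N * (2 : ℝ)⁻¹ ^ m * min 1 (2 ^ m * (2 : ℝ)⁻¹ ^ n) * h1
  -- the low frequencies of `u`, which are finite sums of blocks, satisfy the claimed bound
  have hpartial : ∀ j : ℕ, ‖scaleConv (𝓕⁻ 𝔇.lowSymbol : 𝓢(E3, ℂ)) ((2 : ℝ)⁻¹ ^ j)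
      (fun x => (u x : ℂ)) x - scaleConv (𝓕⁻ 𝔇.lowSymbol : 𝓢(E3, ℂ)) ((2 : ℝ)⁻¹ ^ j)
      (fun x => (u x : ℂ)) y‖ ≤ 2 ^ s * A * C₁ * 2 ^ s * N * d ^ s := fun j => by
    have h1 := hT.fourierMultiplier 𝔇.lowSymbol (c := (2 : ℝ)⁻¹ ^ j) (by positivity)
    rw [← lowFreq_eq, lowFreq_eq_sum] at h1
    have h2 := IsGivenBy.sum (Finset.range (j + 1)) fun n _ => hv n
    have h3 := h1.eq_of_continuous h2 (continuous_scaleConv (SchwartzMap.integrable _)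
      (SchwartzMap.integral_norm_translate_sub_le _) hT.measurable hT.bound (by positivity))
      (continuous_finsetSum _ fun n _ => hvc n)
    rw [h3, ← Finset.sum_sub_distrib]
    calc _ ≤ ∑ n ∈ Finset.range (j + 1), 2 ^ s * A * N * (2 : ℝ)⁻¹ ^ m *
        ((2 : ℝ) ^ ((n : ℝ) * (1 - s)) * min 1 (2 ^ m * (2 : ℝ)⁻¹ ^ n)) :=
          norm_sum_le_of_le _ fun n _ => (hblock n).trans (hterm n)
      _ ≤ 2 ^ s * A * N * (2 : ℝ)⁻¹ ^ m * (C₁ * (2 : ℝ) ^ ((m : ℝ) * (1 - s))) := by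
          rw [← Finset.mul_sum]
          gcongr
          exact hsum m _
      _ = 2 ^ s * A * N * C₁ * ((2 : ℝ)⁻¹ ^ m * (2 : ℝ) ^ ((m : ℝ) * (1 - s))) := by ring
      _ ≤ 2 ^ s * A * N * C₁ * (2 ^ s * d ^ s) := by gcongr
      _ = _ := by ring
  have hc : Tendsto (fun j : ℕ => (2 : ℝ)⁻¹ ^ j) atTop (𝓝 0) :=
    tendsto_pow_atTop_nhds_zero_of_lt_one (by norm_num) (by norm_num)
  have hlim : ∀ z, Tendsto (fun j => scaleConv (𝓕⁻ 𝔇.lowSymbol : 𝓢(E3, ℂ)) ((2 : ℝ)⁻¹ ^ j)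
      (fun x => (u x : ℂ)) z) atTop (𝓝 (u z : ℂ)) := fun z => by
    have h1 : 𝔇.lowSymbol 0 = 1 := by
      obtain ⟨a, ha, h⟩ := 𝔇.exists_χ_eq_one
      rw [lowSymbol_apply, h 0 (by simpa using ha), Complex.ofReal_one]
    simpa [integral_fourierInv, h1] using tendsto_scaleConv hc
      (SchwartzMap.integrable (𝓕⁻ 𝔇.lowSymbol : 𝓢(E3, ℂ)))
      (u := fun x => (u x : ℂ)) (by fun_prop) hT.bound z
  have := le_of_tendsto ((hlim x).sub (hlim y)).norm (.of_forall hpartial)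
  rwa [← Complex.ofReal_sub, Complex.norm_real, Real.norm_eq_abs] at this

/-- The derivatives of a bounded `s`-Hölder continuous function belong to `C^{s-1}_*`, with a bound
that depends only on the Hölder seminorm: the kernels of the differentiated blocks have mean
zero. -/
theorem exists_holderNorm_lineDerivOp_le {s : ℝ} (hs₀ : 0 < s) (hs₁ : s < 1) :
    ∃ C : ℝ, 0 ≤ C ∧ ∀ (u : E3 → ℝ) (B M : ℝ) (i : Fin 3), Measurable u → (∀ x, |u x| ≤ B) →
      (∀ x y, |u x - u y| ≤ M * ‖x - y‖ ^ s) →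
      𝔇.holderNorm (s - 1) (∂_{EuclideanSpace.single i (1 : ℝ)} (boundedDist u)) ≤
        ENNReal.ofReal (C * M) := by
  set κ : Fin 3 → ℕ → 𝓢(E3, ℂ) := fun i n =>
    𝓕⁻ (diffSymbol (EuclideanSpace.single i (1 : ℝ)) (𝔇.baseSymbol n)) with hκ
  set I : Fin 3 → ℕ → ℝ := fun i n => ∫ y, ‖κ i n y‖ * ‖y‖ ^ s with hI
  have hI0 : ∀ i n, 0 ≤ I i n := fun i n => integral_nonneg fun y => by positivity
  set A : ℝ := ∑ i, (I i 0 + I i 1) with hA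
  have hIA : ∀ i n, I i n ≤ A := fun i n => by
    have h1 : I i n ≤ I i 0 + I i 1 := by
      cases n with
      | zero => linarith [hI0 i 1]
      | succ n => linarith [hI0 i 0, show I i (n + 1) = I i 1 from rfl]
    exact h1.trans (Finset.single_le_sum (f := fun i => I i 0 + I i 1)
      (fun i _ => add_nonneg (hI0 i 0) (hI0 i 1)) (Finset.mem_univ i))
  have hA0 : 0 ≤ A := (hI0 0 0).trans (hIA 0 0)
  refine ⟨2 * A, by positivity, fun u B M i hu hB hM => ?_⟩
  have hT := isGivenBy_boundedDist hu hB
  have hM0 : 0 ≤ M := by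
    have h1 := hM (EuclideanSpace.single 0 1) 0
    simp only [sub_zero, PiLp.norm_single, norm_one, Real.one_rpow, mul_one] at h1
    exact (abs_nonneg _).trans h1
  refine 𝔇.holderNorm_le_of_block_le fun n => ?_
  have hc : (0 : ℝ) < (2 : ℝ)⁻¹ ^ n := by positivity
  have hg := (hT.fourierMultiplier
    (diffSymbol (EuclideanSpace.single i (1 : ℝ)) (𝔇.baseSymbol n)) hc).const_smul ((2 : ℂ) ^ n)
  rw [← block_lineDerivOp] at hg
  refine (hg.mono_bound (B' := (2 : ℝ) ^ ((1 - (n : ℝ)) * (s - 1)) * (2 * A * M))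
    fun x => ?_).distLinftyNorm_le
  have h1 := norm_scaleConv_sub_integral_mul_le (κ i n).integrable
    ((κ i n).integrable_norm_mul_rpow hs₀.le hs₁.le) hT.measurable hT.bound
    (M := M) (fun x y => by
      rw [← Complex.ofReal_sub, Complex.norm_real]
      exact hM x y) hc.le x
  have h0 : ∫ y, κ i n y = 0 := by
    rw [hκ, integral_fourierInv, diffSymbol_zero]
  rw [h0, zero_mul, sub_zero] at h1
  rw [norm_mul, norm_pow, Complex.norm_two]
  calc _ ≤ (2 : ℝ) ^ n * (M * ((2 : ℝ)⁻¹ ^ n) ^ s * A) := by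
        gcongr
        exact h1.trans (by gcongr; exact hIA i n)
    _ = (2 : ℝ) ^ ((n : ℝ) * (1 - s)) * (A * M) := by
        have : (2 : ℝ) ^ n * ((2 : ℝ)⁻¹ ^ n) ^ s = (2 : ℝ) ^ ((n : ℝ) * (1 - s)) := by
          rw [inv_pow, ← Real.rpow_natCast, ← Real.rpow_neg two_pos.le, ← Real.rpow_mul two_pos.le,
            ← Real.rpow_add two_pos]
          congr 1
          ring
        rw [← this]
        ring
    _ ≤ (2 : ℝ) ^ ((n : ℝ) * (1 - s)) * (2 * A * M) * (2 : ℝ) ^ (s - 1) := by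
        have h2 : (2 : ℝ)⁻¹ ≤ (2 : ℝ) ^ (s - 1) := by
          rw [← Real.rpow_neg_one]
          exact Real.rpow_le_rpow_of_exponent_le one_le_two (by linarith)
        have h3 : 0 ≤ (2 : ℝ) ^ ((n : ℝ) * (1 - s)) * (A * M) := by positivity
        nlinarith
    _ = _ := by
        rw [mul_right_comm, ← Real.rpow_add two_pos]
        congr 2
        ring

end DyadicPartition

/-! ### Thin sets along a coordinate direction -/

/-- Every line in the `i`-th coordinate direction meets `A` in a set of diameter at most `δ`. -/
def HasSlices (i : Fin 3) (δ : ℝ) (A : Set E3) : Prop :=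
  ∀ y ∈ A, ∀ y' ∈ A, (∀ j, j ≠ i → y j = y' j) → |y i - y' i| ≤ δ

theorem HasSlices.mono {i : Fin 3} {δ : ℝ} {A A' : Set E3} (h : HasSlices i δ A) (hA : A' ⊆ A) :
    HasSlices i δ A' := fun y hy y' hy' => h y (hA hy) y' (hA hy')

theorem HasSlices.preimage {i : Fin 3} {δ : ℝ} {A : Set E3} (h : HasSlices i δ A) (x : E3) {c : ℝ}
    (hc : c ≠ 0) : HasSlices i (δ / |c|) ((fun y => x - c • y) ⁻¹' A) := by
  intro y hy y' hy' hyy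
  have h1 := h _ hy _ hy' fun j hj => by simp [hyy j hj]
  have h2 : (x - c • y) i - (x - c • y') i = -(c * (y i - y' i)) := by
    simp
    ring
  rw [h2, abs_neg, abs_mul] at h1
  rwa [le_div_iff₀' (abs_pos.2 hc)]

/-- By Fubini's theorem, the weighted volume of a set with thin slices is at most proportional to
its thickness. -/
theorem exists_lintegral_decayWeight_le : ∃ C : ℝ, 0 ≤ C ∧ ∀ (i : Fin 3) (δ : ℝ) (A : Set E3),
    MeasurableSet A → HasSlices i δ A →
      ∫⁻ z in A, ENNReal.ofReal (decayWeight z) ≤ ENNReal.ofReal (C * δ) := by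
  set w : (Fin 2 → ℝ) → ℝ := fun z => (1 + ‖z‖) ^ (-(4 : ℝ)) with hw
  have hwi : Integrable w := integrable_one_add_norm (by simp; norm_num)
  have hw0 : ∀ z, 0 ≤ w z := fun z => by positivity
  refine ⟨∫ z, w z, integral_nonneg hw0, fun i δ A hA hs => ?_⟩
  set Φ : ℝ × (Fin 2 → ℝ) → E3 := fun p => WithLp.toLp 2 (i.insertNth p.1 p.2) with hΦ
  have hΦm : MeasurePreserving Φ :=
    (PiLp.volume_preserving_toLp (Fin 3)).comp
      (volume_preserving_piFinSuccAbove (fun _ : Fin 3 => ℝ) i).symm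
  have hle : ∀ p, decayWeight (Φ p) ≤ w p.2 := fun p => by
    have h1 : ‖p.2‖ ≤ ‖Φ p‖ := by
      refine (pi_norm_le_iff_of_nonneg (norm_nonneg _)).2 fun j => ?_
      have := PiLp.norm_apply_le (Φ p) (i.succAbove j)
      simpa [hΦ] using this
    simp only [decayWeight, hw]
    rw [Real.rpow_neg (by positivity), show (4 : ℝ) = ((4 : ℕ) : ℝ) by norm_num,
      Real.rpow_natCast]
    gcongr
  have hslice : ∀ z : Fin 2 → ℝ, volume {t : ℝ | Φ (t, z) ∈ A} ≤ ENNReal.ofReal δ := fun z => by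
    refine (Real.volume_le_diam _).trans (Metric.ediam_le fun t ht t' ht' => ?_)
    rw [edist_dist, Real.dist_eq]
    refine ENNReal.ofReal_le_ofReal ?_
    have := hs _ ht _ ht' fun j hj => ?_
    · simpa [hΦ] using this
    · obtain ⟨j, rfl⟩ := Fin.exists_succAbove_eq hj
      simp [hΦ]
  have hAm : MeasurableSet (Φ ⁻¹' A) := hΦm.measurable hA
  calc ∫⁻ z in A, ENNReal.ofReal (decayWeight z)
      = ∫⁻ p in Φ ⁻¹' A, ENNReal.ofReal (decayWeight (Φ p)) := by
        refine (hΦm.setLIntegral_comp_preimage hA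
          (f := fun z => ENNReal.ofReal (decayWeight z)) ?_).symm
        unfold decayWeight
        fun_prop
    _ ≤ ∫⁻ p in Φ ⁻¹' A, ENNReal.ofReal (w p.2) :=
        lintegral_mono fun p => ENNReal.ofReal_le_ofReal (hle p)
    _ = ∫⁻ p : ℝ × (Fin 2 → ℝ), (Φ ⁻¹' A).indicator (fun p => ENNReal.ofReal (w p.2)) p := by
        rw [lintegral_indicator hAm]
    _ = ∫⁻ z, ∫⁻ t, (Φ ⁻¹' A).indicator (fun p => ENNReal.ofReal (w p.2)) (t, z) := by
        rw [Measure.volume_eq_prod, lintegral_prod_symm]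
        refine (Measurable.indicator ?_ hAm).aemeasurable
        fun_prop
    _ = ∫⁻ z, ENNReal.ofReal (w z) * volume {t : ℝ | Φ (t, z) ∈ A} := by
        congr 1 with z
        have hm : MeasurableSet {t : ℝ | Φ (t, z) ∈ A} :=
          (hΦm.measurable.comp measurable_prodMk_right) hA
        rw [← lintegral_indicator_const hm]
        rfl
    _ ≤ ∫⁻ z, ENNReal.ofReal (w z) * ENNReal.ofReal δ :=
        lintegral_mono fun z => mul_le_mul_right (hslice z) _
    _ = ENNReal.ofReal ((∫ z, w z) * δ) := by
        rw [lintegral_mul_const' _ _ ENNReal.ofReal_ne_top,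
          ← ofReal_integral_eq_lintegral_ofReal hwi (.of_forall hw0),
          ENNReal.ofReal_mul (integral_nonneg hw0)]

/-- The volume of the part of a thin set in a ball. -/
theorem exists_volume_le_of_hasSlices (R : ℝ) : ∃ C : ℝ, 0 ≤ C ∧
    ∀ (i : Fin 3) (δ : ℝ) (A : Set E3), MeasurableSet A → (∀ z ∈ A, ‖z‖ ≤ R) → HasSlices i δ A →
      volume A ≤ ENNReal.ofReal (C * δ) := by
  obtain ⟨C, hC, h⟩ := exists_lintegral_decayWeight_le
  refine ⟨(1 + |R|) ^ 4 * C, by positivity, fun i δ A hA hR hs => ?_⟩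
  calc volume A = ∫⁻ _ in A, 1 := by simp
    _ ≤ ∫⁻ z in A, ENNReal.ofReal ((1 + |R|) ^ 4) * ENNReal.ofReal (decayWeight z) := by
        refine setLIntegral_mono' hA fun z hz => ?_
        rw [← ENNReal.ofReal_mul (by positivity), ← ENNReal.ofReal_one]
        refine ENNReal.ofReal_le_ofReal ?_
        have h1 : ‖z‖ ≤ |R| := (hR z hz).trans (le_abs_self R)
        rw [decayWeight, ← div_eq_mul_inv, le_div_iff₀ (by positivity), one_mul]
        gcongr
    _ ≤ ENNReal.ofReal ((1 + |R|) ^ 4) * ENNReal.ofReal (C * δ) := by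
        rw [lintegral_const_mul' _ _ ENNReal.ofReal_ne_top]
        gcongr
        exact h i δ A hA hs
    _ = _ := by rw [← ENNReal.ofReal_mul (by positivity), mul_assoc]

/-! ### Boundaries of class `C¹` -/

namespace IsLocalDefiningFunction

variable {r : ℝ} {P U : Set E3} {x : E3} {f : E3 → ℝ}

theorem of_mem (h : IsLocalDefiningFunction r P x U f) {y : E3} (hy : y ∈ U) :
    IsLocalDefiningFunction r P y U f :=
  ⟨h.isOpen, hy, h.contDiffOn, h.holder, h.fderiv_ne_zero, h.inter_eq⟩

theorem contDiffAt (h : IsLocalDefiningFunction r P x U f) {y : E3} (hy : y ∈ U) :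
    ContDiffAt ℝ 1 f y := h.contDiffOn.contDiffAt (h.isOpen.mem_nhds hy)

theorem mem_iff (h : IsLocalDefiningFunction r P x U f) {y : E3} (hy : y ∈ U) :
    y ∈ P ↔ f y < 0 := by
  have := Set.ext_iff.1 h.inter_eq y
  simpa [hy] using this

theorem eq_zero_of_mem_frontier (h : IsLocalDefiningFunction r P x U f) (hP : IsOpen P) {y : E3}
    (hy : y ∈ U) (hyP : y ∈ frontier P) : f y = 0 := by
  rw [hP.frontier_eq] at hyP
  refine le_antisymm ?_ (not_lt.1 fun hlt => hyP.2 ((h.mem_iff hy).2 hlt))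
  by_contra! hpos
  have h1 : ∀ᶠ z in 𝓝 y, 0 < f z := (h.contDiffAt hy).continuousAt.eventually_const_lt hpos
  have h2 : ∀ᶠ z in 𝓝 y, z ∈ U := h.isOpen.mem_nhds hy
  obtain ⟨z, hzP, hz1, hz2⟩ := ((mem_closure_iff_frequently.1 hyP.1).and_eventually
    (h1.and h2)).exists
  exact hz1.not_gt ((h.mem_iff hz2).1 hzP)

/-- The zero set of a local defining function is contained in the boundary, because the differential
does not vanish. -/
theorem mem_frontier_of_eq_zero (h : IsLocalDefiningFunction r P x U f) (hP : IsOpen P) {y : E3}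
    (hy : y ∈ U) (hf : f y = 0) : y ∈ frontier P := by
  rw [hP.frontier_eq]
  refine ⟨?_, fun hyP => ((h.mem_iff hy).1 hyP).ne hf⟩
  by_contra hcl
  -- otherwise `f` has a local minimum at `y`, where its differential does not vanish
  have hev : ∀ᶠ z in 𝓝 y, f y ≤ f z := by
    filter_upwards [isClosed_closure.isOpen_compl.mem_nhds hcl, h.isOpen.mem_nhds hy] with z hz hzU
    rw [hf]
    by_contra! hlt
    exact hz (subset_closure ((h.mem_iff hzU).2 hlt))
  exact h.fderiv_ne_zero y hy (IsLocalMin.fderiv_eq_zero hev)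

/-- Near a point of the boundary, the defining function is Lipschitz continuous, and strictly
monotone with a linear rate in some coordinate direction. -/
theorem exists_chart (h : IsLocalDefiningFunction r P x U f) :
    ∃ (ρ κ L : ℝ) (i : Fin 3), 0 < ρ ∧ 0 < κ ∧ 0 ≤ L ∧ Metric.ball x ρ ⊆ U ∧
      (∀ y ∈ Metric.ball x ρ, ∀ y' ∈ Metric.ball x ρ, |f y - f y'| ≤ L * ‖y - y'‖) ∧
      ∀ y ∈ Metric.ball x ρ, ∀ y' ∈ Metric.ball x ρ, (∀ j, j ≠ i → y j = y' j) →
        κ * |y i - y' i| ≤ |f y - f y'| := by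
  have hne := h.fderiv_ne_zero x h.mem
  obtain ⟨i, hi⟩ : ∃ i : Fin 3, fderiv ℝ f x (EuclideanSpace.single i 1) ≠ 0 := by
    by_contra! hall
    refine hne (ContinuousLinearMap.coe_injective
      ((EuclideanSpace.basisFun (Fin 3) ℝ).toBasis.ext fun i => ?_))
    simpa using hall i
  set a := fderiv ℝ f x (EuclideanSpace.single i 1) with ha
  have ha0 : 0 < |a| := abs_pos.2 hi
  -- strict differentiability, with an error of half the size of the partial derivative
  set ε : ℝ≥0 := ⟨|a| / 2, by positivity⟩ with hε
  have hε0 : 0 < ε := by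
    rw [← NNReal.coe_pos]
    change 0 < |a| / 2
    positivity
  obtain ⟨S, hS, happ⟩ := ((h.contDiffAt h.mem).hasStrictFDerivAt
    one_ne_zero).approximates_deriv_on_nhds (Or.inr hε0)
  obtain ⟨ρ, hρ, hball⟩ := Metric.mem_nhds_iff.1 (inter_mem hS (h.isOpen.mem_nhds h.mem))
  refine ⟨ρ, |a| / 2, ‖fderiv ℝ f x‖ + ε, i, hρ, by positivity, by positivity,
    fun y hy => (hball hy).2, fun y hy y' hy' => ?_, fun y hy y' hy' hyy => ?_⟩
  · have h1 := happ y (hball hy).1 y' (hball hy').1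
    have h2 := (fderiv ℝ f x).le_opNorm (y - y')
    rw [← Real.norm_eq_abs]
    calc ‖f y - f y'‖ ≤ ‖f y - f y' - fderiv ℝ f x (y - y')‖ + ‖fderiv ℝ f x (y - y')‖ := by
          simpa using norm_add_le (f y - f y' - fderiv ℝ f x (y - y')) (fderiv ℝ f x (y - y'))
      _ ≤ _ := by linarith
  · have h1 := happ y (hball hy).1 y' (hball hy').1
    have h2 : y - y' = (y i - y' i) • EuclideanSpace.single i (1 : ℝ) := by
      ext j
      rcases eq_or_ne j i with rfl | hj
      · simp
      · simp [hyy j hj, hj]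
    have h3 : fderiv ℝ f x (y - y') = (y i - y' i) * a := by
      rw [h2, map_smul, smul_eq_mul]
    have h4 : ‖y - y'‖ = |y i - y' i| := by
      rw [h2, norm_smul]
      simp
    rw [h3, h4, Real.norm_eq_abs] at h1
    have h5 : |(y i - y' i) * a| ≤ |f y - f y' - (y i - y' i) * a| + |f y - f y'| := by
      rw [abs_sub_comm (f y - f y')]
      simpa using abs_add_le ((y i - y' i) * a - (f y - f y')) (f y - f y')
    rw [abs_mul] at h5
    change _ ≤ |a| / 2 * _ at h1
    linarith

/-- In a chart the layers around the boundary are thin. -/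
theorem hasSlices_of_chart {s : Set E3} {i : Fin 3} {κ : ℝ} (hκ : 0 < κ)
    (h : ∀ y ∈ s, ∀ y' ∈ s, (∀ j, j ≠ i → y j = y' j) → κ * |y i - y' i| ≤ |f y - f y'|)
    (δ : ℝ) : HasSlices i (2 * δ / κ) {y ∈ s | |f y| ≤ δ} := by
  intro y hy y' hy' hyy
  rw [le_div_iff₀' hκ]
  refine (h y hy.1 y' hy'.1 hyy).trans ((abs_sub _ _).trans ?_)
  linarith [hy.2, hy'.2]

end IsLocalDefiningFunction

theorem IsPreconnected.inter_frontier_nonempty_of_isOpen {X : Type*} [TopologicalSpace X]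
    {t s : Set X} (ht : IsPreconnected t) (hs : IsOpen s) (h1 : (t ∩ s).Nonempty)
    (h2 : (t ∩ sᶜ).Nonempty) : (t ∩ frontier s).Nonempty := by
  rw [hs.frontier_eq]
  by_contra hne
  have hcl : ∀ z ∈ t, z ∉ s → z ∉ closure s := fun z hz hzs hzc => hne ⟨z, hz, hzc, hzs⟩
  obtain ⟨z, -, hz1, hz2⟩ := ht s (closure s)ᶜ hs isClosed_closure.isOpen_compl
    (fun z hz => (em (z ∈ s)).imp id (hcl z hz)) h1
    (h2.imp fun z hz => ⟨hz.1, hcl z hz.1 hz.2⟩)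
  exact hz2 (subset_closure hz1)

theorem volume_frontier_eq_zero {r : ℝ} {P : Set E3} (hP : IsOpenOfClass r P) :
    volume (frontier P) = 0 := by
  refine measure_null_of_locally_null _ fun x hx => ?_
  obtain ⟨U, f, hf⟩ := hP.2 x hx
  obtain ⟨ρ, κ, L, i, hρ, hκ, -, hball, -, hmono⟩ := hf.exists_chart
  refine ⟨frontier P ∩ Metric.ball x ρ,
    inter_mem self_mem_nhdsWithin (mem_nhdsWithin_of_mem_nhds (Metric.ball_mem_nhds x hρ)), ?_⟩
  obtain ⟨C, -, hvol⟩ := exists_volume_le_of_hasSlices (‖x‖ + ρ)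
  have := hvol i (2 * 0 / κ) (frontier P ∩ Metric.ball x ρ)
    (isClosed_frontier.measurableSet.inter measurableSet_ball) (fun z hz => ?_)
    ((IsLocalDefiningFunction.hasSlices_of_chart hκ hmono 0).mono fun y hy => ⟨hy.2, ?_⟩)
  · simpa using this
  · have h1 := mem_ball_iff_norm.1 hz.2
    linarith [norm_le_norm_add_norm_sub x z, norm_sub_rev x z]
  · rw [hf.eq_zero_of_mem_frontier hP.1 (hball hy.2) hy.1, abs_zero]

/-- The weighted volume of the symmetric difference of a bounded open set of class `C¹` and its
translate by `h` is `O(h)`, uniformly over all the rescaled copies of the set. -/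
theorem exists_lintegral_translate_le {r : ℝ} {P : Set E3} (hP : IsOpenOfClass r P)
    (hb : Bornology.IsBounded P) : ∃ C : ℝ, 0 ≤ C ∧ ∀ (x h : E3) (c : ℝ), c ≠ 0 →
      ∫⁻ y in {y | ¬ (x - c • y ∈ P ↔ x - c • (y + h) ∈ P)}, ENNReal.ofReal (decayWeight y) ≤
        ENNReal.ofReal (C * ‖h‖) := by
  obtain ⟨C₀, hC₀, hslice⟩ := exists_lintegral_decayWeight_le
  choose! U f hf using hP.2
  choose! ρ κ L i hρ hκ hL hball hlip hmono using fun x hx => (hf x hx).exists_chart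
  have hcompact : IsCompact (frontier P) :=
    hb.isCompact_closure.of_isClosed_subset isClosed_frontier frontier_subset_closure
  obtain ⟨t, htP, hcover⟩ := hcompact.elim_nhds_subcover (fun x => Metric.ball x (ρ x))
    fun x hx => Metric.ball_mem_nhds x (hρ x hx)
  obtain ⟨δ, hδ, hleb⟩ := lebesgue_number_lemma_of_metric (c := fun a : t => Metric.ball a.1 (ρ a))
    hcompact (fun a => Metric.isOpen_ball) (by simpa [Set.iUnion_subtype] using hcover)
  obtain ⟨R, hR⟩ := hb.exists_norm_le
  have hR' : ∀ {y}, y ∈ P → ∀ j, |y j| ≤ |R| := fun hy j =>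
    (PiLp.norm_apply_le _ j).trans ((hR _ hy).trans (le_abs_self R))
  set C₁ : ℝ := ∑ a ∈ t, C₀ * (2 * L a / κ a) with hC₁
  have hterm : ∀ a ∈ t, 0 ≤ 2 * L a / κ a := fun a ha =>
    div_nonneg (mul_nonneg two_pos.le (hL a (htP a ha))) (hκ a (htP a ha)).le
  have hC₁0 : 0 ≤ C₁ := Finset.sum_nonneg fun a ha => mul_nonneg hC₀ (hterm a ha)
  refine ⟨C₁ + 2 * (C₀ * (2 * |R| / δ)), by positivity, fun x h c hc => ?_⟩
  have hca : 0 < |c| := abs_pos.2 hc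
  have hch : ‖c • h‖ = |c| * ‖h‖ := by rw [norm_smul, Real.norm_eq_abs]
  set Q : E3 → E3 := fun y => x - c • y with hQ
  have hQm : Measurable Q := by fun_prop
  have hQadd : ∀ y, x - c • (y + h) = Q y - c • h := fun y => by
    simp only [hQ, smul_add]
    abel
  set S : Set E3 := {z | ¬ (z ∈ P ↔ z - c • h ∈ P)} with hS
  have hSm : MeasurableSet S := by
    have h1 : MeasurableSet P := hP.1.measurableSet
    have h2 : MeasurableSet {z | z - c • h ∈ P} := (measurable_sub_const (c • h)) h1
    exact (h1.iff h2).compl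
  have hSset : {y | ¬ (x - c • y ∈ P ↔ x - c • (y + h) ∈ P)} = Q ⁻¹' S := by
    ext y
    simp only [hQadd, hS, Set.mem_preimage, Set.mem_ofPred_eq, hQ]
  rw [hSset]
  rcases lt_or_ge (|c| * ‖h‖) δ with hsmall | hlarge
  · -- short translations: a point of `S` lies in one of the charts, near the level set `f = 0`
    set A : E3 → Set E3 := fun a => S ∩ Metric.ball a (ρ a) ∩
      {z | z - c • h ∈ Metric.ball a (ρ a)} with hA
    have hAm : ∀ a, MeasurableSet (A a) := fun a => (hSm.inter measurableSet_ball).inter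
      ((measurable_sub_const (c • h)) measurableSet_ball)
    have hAs : ∀ a ∈ t, HasSlices (i a) (2 * (L a * (|c| * ‖h‖)) / κ a) (A a) := fun a ha => by
      have haP := htP a ha
      refine (IsLocalDefiningFunction.hasSlices_of_chart (hκ a haP) (hmono a haP) _).mono
        fun z hz => ⟨hz.1.2, ?_⟩
      have h1 := hlip a haP z hz.1.2 _ hz.2
      rw [sub_sub_cancel, hch] at h1
      refine le_trans ?_ h1
      have hSz := hz.1.1
      have hm1 := (hf a haP).mem_iff (hball a haP hz.1.2)
      have hm2 := (hf a haP).mem_iff (hball a haP hz.2)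
      simp only [hS, Set.mem_ofPred_eq, hm1, hm2] at hSz
      rcases lt_or_ge (f a z) 0 with h0 | h0
      · have h2 : 0 ≤ f a (z - c • h) := by
          by_contra! h3
          exact hSz ⟨fun _ => h3, fun _ => h0⟩
        rw [abs_of_neg h0, abs_of_neg (by linarith)]
        linarith
      · have h2 : f a (z - c • h) < 0 := by
          by_contra! h3
          exact hSz ⟨fun h4 => absurd h4 h0.not_gt, fun h4 => absurd h4 h3.not_gt⟩
        rw [abs_of_nonneg h0, abs_of_nonneg (by linarith)]
        linarith
    have hSA : S ⊆ ⋃ a ∈ t, A a := fun z hz => by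
      have hne : (segment ℝ z (z - c • h) ∩ frontier P).Nonempty := by
        refine (convex_segment _ _).isPreconnected.inter_frontier_nonempty_of_isOpen hP.1 ?_ ?_
        · by_cases hzP : z ∈ P
          · exact ⟨z, left_mem_segment ℝ _ _, hzP⟩
          · refine ⟨_, right_mem_segment ℝ _ _, ?_⟩
            by_contra hz'
            exact hz ⟨fun h => absurd h hzP, fun h => absurd h hz'⟩
        · by_cases hzP : z ∈ P
          · refine ⟨_, right_mem_segment ℝ _ _, fun hz' => hz ⟨fun _ => hz', fun _ => hzP⟩⟩
          · exact ⟨z, left_mem_segment ℝ _ _, hzP⟩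
      obtain ⟨p, hp, hpP⟩ := hne
      obtain ⟨a, ha⟩ := hleb p hpP
      rw [segment_eq_image'] at hp
      obtain ⟨θ, hθ, rfl⟩ := hp
      refine Set.mem_iUnion₂.2 ⟨a, a.2, ⟨hz, ha ?_⟩, ha ?_⟩
      · rw [mem_ball_iff_norm]
        have : z - (z + θ • (z - c • h - z)) = θ • (c • h) := by module
        rw [this, norm_smul, hch, Real.norm_of_nonneg hθ.1]
        nlinarith [hθ.2, norm_nonneg h, mul_nonneg hca.le (norm_nonneg h)]
      · rw [mem_ball_iff_norm]
        have : z - c • h - (z + θ • (z - c • h - z)) = (1 - θ) • -(c • h) := by module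
        rw [this, norm_smul, norm_neg, hch, Real.norm_of_nonneg (by linarith [hθ.2])]
        nlinarith [hθ.1, norm_nonneg h, mul_nonneg hca.le (norm_nonneg h)]
    calc ∫⁻ y in Q ⁻¹' S, ENNReal.ofReal (decayWeight y)
        ≤ ∫⁻ y in ⋃ a : t, Q ⁻¹' A a, ENNReal.ofReal (decayWeight y) := by
          refine lintegral_mono_set ?_
          rw [← Set.preimage_iUnion]
          exact Set.preimage_mono (by simpa [Set.iUnion_subtype] using hSA)
      _ ≤ ∑ a ∈ t, ∫⁻ y in Q ⁻¹' A a, ENNReal.ofReal (decayWeight y) := by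
          refine (lintegral_iUnion_le _ _).trans_eq ?_
          rw [tsum_fintype]
          exact Finset.sum_coe_sort t fun a => ∫⁻ y in Q ⁻¹' A a, ENNReal.ofReal (decayWeight y)
      _ ≤ ∑ a ∈ t, ENNReal.ofReal (C₀ * (2 * L a / κ a) * ‖h‖) := by
          refine Finset.sum_le_sum fun a ha => ?_
          refine (hslice _ _ _ (hQm (hAm a)) ((hAs a ha).preimage x hc)).trans_eq ?_
          congr 1
          field_simp
      _ = ENNReal.ofReal (C₁ * ‖h‖) := by
          rw [← ENNReal.ofReal_sum_of_nonneg fun a ha =>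
            mul_nonneg (mul_nonneg hC₀ (hterm a ha)) (norm_nonneg h), hC₁, Finset.sum_mul]
      _ ≤ _ := by
          refine ENNReal.ofReal_le_ofReal (mul_le_mul_of_nonneg_right ?_ (norm_nonneg h))
          linarith [show 0 ≤ 2 * (C₀ * (2 * |R| / δ)) by positivity]
  · -- long translations: it is enough that `P` and its translate are bounded
    have hs1 : HasSlices 0 (2 * |R| / δ * (|c| * ‖h‖)) P := fun y hy y' hy' _ => by
      have h1 : |y 0 - y' 0| ≤ 2 * |R| :=
        (abs_sub _ _).trans (by linarith [hR' hy 0, hR' hy' 0])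
      refine h1.trans ?_
      rw [div_mul_eq_mul_div, le_div_iff₀ hδ]
      gcongr
    have hs2 : HasSlices 0 (2 * |R| / δ * (|c| * ‖h‖)) {z | z - c • h ∈ P} :=
      fun y hy y' hy' hyy => by
      have := hs1 _ hy _ hy' fun j hj => by simp [hyy j hj]
      simpa using this
    have hSP : S ⊆ P ∪ {z | z - c • h ∈ P} := fun z hz => by
      by_contra hcon
      rw [Set.mem_union, not_or] at hcon
      exact hz ⟨fun h => absurd h hcon.1, fun h => absurd h hcon.2⟩
    have hP2 : MeasurableSet {z | z - c • h ∈ P} :=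
      (measurable_sub_const (c • h)) hP.1.measurableSet
    calc ∫⁻ y in Q ⁻¹' S, ENNReal.ofReal (decayWeight y)
        ≤ ∫⁻ y in Q ⁻¹' P ∪ Q ⁻¹' {z | z - c • h ∈ P}, ENNReal.ofReal (decayWeight y) := by
          refine lintegral_mono_set ?_
          rw [← Set.preimage_union]
          exact Set.preimage_mono hSP
      _ ≤ ENNReal.ofReal (C₀ * (2 * |R| / δ * (|c| * ‖h‖) / |c|)) +
          ENNReal.ofReal (C₀ * (2 * |R| / δ * (|c| * ‖h‖) / |c|)) :=
          (lintegral_union_le _ _ _).trans (add_le_add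
            (hslice _ _ _ (hQm hP.1.measurableSet) (hs1.preimage x hc))
            (hslice _ _ _ (hQm hP2) (hs2.preimage x hc)))
      _ = ENNReal.ofReal (2 * (C₀ * (2 * |R| / δ)) * ‖h‖) := by
          rw [← ENNReal.ofReal_add (by positivity) (by positivity)]
          congr 1
          field_simp
          ring
      _ ≤ _ := by
          refine ENNReal.ofReal_le_ofReal (mul_le_mul_of_nonneg_right ?_ (norm_nonneg h))
          linarith

/-! ### Multiplication by the characteristic function of a bounded set -/

/-- A function with an `L¹` modulus of continuity `V ‖h‖` is almost orthogonal to the functions of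
high frequency. -/
theorem norm_integral_mul_le_of_eq_scaleConv {k G v : E3 → ℂ} {c V B : ℝ} (hk : Integrable k)
    (hk0 : ∫ y, k y = 0) (hk1 : Integrable fun y => ‖k y‖ * ‖y‖) (hG : Integrable G)
    (hV : ∀ h, ∫ y, ‖G (y + h) - G y‖ ≤ V * ‖h‖) (hv : Measurable v) (hB : ∀ x, ‖v x‖ ≤ B)
    (hkv : v = scaleConv k c v) :
    ‖∫ y, G y * v y‖ ≤ |c| * V * B * ∫ y, ‖k y‖ * ‖y‖ := by
  have hB0 : 0 ≤ B := (norm_nonneg _).trans (hB 0)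
  have hGt : ∀ h, Integrable fun z => G (z + h) := fun h => hG.comp_add_right h
  have hdiff : ∀ y, ‖(∫ z, G (z + c • y) * v z) - ∫ z, G z * v z‖ ≤ |c| * V * B * ‖y‖ := fun y => by
    rw [← integral_sub (integrable_mul_of_bounded (hGt _) hv hB)
      (integrable_mul_of_bounded hG hv hB)]
    calc _ ≤ ∫ z, ‖G (z + c • y) - G z‖ * B := by
          refine norm_integral_le_of_norm_le (((hGt _).sub hG).norm.mul_const B)
            (.of_forall fun z => ?_)
          rw [← sub_mul, norm_mul]
          gcongr
          exact hB z
      _ ≤ V * ‖c • y‖ * B := by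
          rw [integral_mul_const]
          gcongr
          exact hV _
      _ = _ := by
          rw [norm_smul, Real.norm_eq_abs]
          ring
  -- the averages that reproduce `v` are moved onto `G`, and they have mean zero
  have hkey : ∫ y, G y * v y =
      ∫ y, k y * ((∫ z, G (z + c • y) * v z) - ∫ z, G z * v z) := by
    have h1 : Integrable fun y => k y * ∫ z, G (z + c • y) * v z := by
      have hb : ∀ y, ‖∫ z, G (z + c • y) * v z‖ ≤ (∫ z, ‖G z‖) * B := fun y => by
        rw [← integral_add_right_eq_self (fun z => ‖G z‖) (c • y), ← integral_mul_const]
        refine norm_integral_le_of_norm_le ((hGt _).norm.mul_const B) (.of_forall fun z => ?_)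
        rw [norm_mul]
        gcongr
        exact hB z
      refine hk.mul_bdd ?_ (.of_forall hb)
      -- the inner integral is a Lipschitz function of `y`
      refine Continuous.aestronglyMeasurable
        (LipschitzWith.of_dist_le' (K := V * |c| * B) fun y y' => ?_).continuous
      rw [dist_eq_norm, dist_eq_norm, ← integral_sub (integrable_mul_of_bounded (hGt _) hv hB)
        (integrable_mul_of_bounded (hGt _) hv hB)]
      calc _ ≤ ∫ z, ‖G (z + c • y) - G (z + c • y')‖ * B := by
            refine norm_integral_le_of_norm_le (((hGt _).sub (hGt _)).norm.mul_const B)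
              (.of_forall fun z => ?_)
            rw [← sub_mul, norm_mul]
            gcongr
            exact hB z
        _ = (∫ z, ‖G (z + (c • y - c • y')) - G z‖) * B := by
            rw [integral_mul_const, ← integral_add_right_eq_self
              (fun z => ‖G (z + (c • y - c • y')) - G z‖) (c • y')]
            congr 3 with z
            congr 3
            abel
        _ ≤ V * ‖c • y - c • y'‖ * B := by
            gcongr
            exact hV _
        _ = _ := by
            rw [← smul_sub, norm_smul, Real.norm_eq_abs]
            ring
    simp_rw [mul_sub]
    rw [integral_sub h1 (hk.mul_const _), integral_mul_const, hk0, zero_mul, sub_zero,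
      ← integral_mul_scaleConv hk hG hv hB, ← hkv]
  rw [hkey, ← integral_const_mul]
  refine norm_integral_le_of_norm_le (hk1.const_mul _) (.of_forall fun y => ?_)
  rw [norm_mul]
  calc _ ≤ ‖k y‖ * (|c| * V * B * ‖y‖) := by gcongr; exact hdiff y
    _ = _ := by ring

/-- The `L¹` modulus of continuity of a Schwartz function cut off to a rescaled copy of a bounded
open set of class `C¹`. -/
theorem exists_integral_norm_indicator_translate_le {r : ℝ} {P : Set E3} (hP : IsOpenOfClass r P)
    (hb : Bornology.IsBounded P) : ∃ C : ℝ, 0 ≤ C ∧ ∀ (k : 𝓢(E3, ℂ)) (x : E3) (c : ℝ), c ≠ 0 →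
      ∀ h, ∫ y, ‖((fun y => x - c • y) ⁻¹' P).indicator k (y + h) -
        ((fun y => x - c • y) ⁻¹' P).indicator k y‖ ≤ C * decaySeminorm k * ‖h‖ := by
  obtain ⟨C, hC, hS⟩ := exists_lintegral_translate_le hP hb
  have hW : 0 ≤ ∫ z, decayWeight z := integral_nonneg decayWeight_nonneg
  refine ⟨16 * (∫ z, decayWeight z) + C, by positivity, fun k x c hc h => ?_⟩
  set Q := (fun y => x - c • y) ⁻¹' P with hQ
  have hQm : MeasurableSet Q := (by fun_prop : Measurable fun y => x - c • y) hP.1.measurableSet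
  have hQm' : MeasurableSet {y | y + h ∈ Q} := (measurable_add_const h) hQm
  set S := {y | ¬ (y ∈ Q ↔ y + h ∈ Q)} with hSdef
  have hSm : MeasurableSet S := (hQm.iff hQm').compl
  have hSint : ∫ y in S, decayWeight y ≤ C * ‖h‖ := by
    have h1 := hS x h c hc
    change ∫⁻ y in S, _ ≤ _ at h1
    rw [← ofReal_integral_eq_lintegral_ofReal integrable_decayWeight.integrableOn
      (.of_forall decayWeight_nonneg)] at h1
    exact (ENNReal.ofReal_le_ofReal_iff (by positivity)).1 h1
  have hki : Integrable k := k.integrable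
  have hkt : Integrable fun y => k (y + h) := hki.comp_add_right h
  have hGi : Integrable (Q.indicator k) := hki.indicator hQm
  have hGt : Integrable fun y => Q.indicator k (y + h) := hGi.comp_add_right h
  have hsub : Integrable fun y => ‖k (y + h) - k y‖ := (hkt.sub hki).norm
  have hSi : Integrable (S.indicator decayWeight) := integrable_decayWeight.indicator hSm
  have hD : 0 ≤ decaySeminorm k := apply_nonneg _ _
  calc ∫ y, ‖Q.indicator k (y + h) - Q.indicator k y‖
      ≤ ∫ y, (‖k (y + h) - k y‖ + decaySeminorm k * S.indicator decayWeight y) := by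
        refine integral_mono (hGt.sub hGi).norm (hsub.add (hSi.const_mul _))
          fun y => ?_
        have h1 := norm_le_decaySeminorm k y
        have h2 : ‖k (y + h)‖ ≤ ‖k (y + h) - k y‖ + ‖k y‖ := by
          simpa using norm_add_le (k (y + h) - k y) (k y)
        have h3 := norm_nonneg (k (y + h) - k y)
        by_cases hy : y ∈ Q <;> by_cases hy' : y + h ∈ Q <;>
          simp [Set.indicator, hSdef, hy, hy'] <;> linarith
    _ ≤ 16 * (∫ z, decayWeight z) * decaySeminorm k * ‖h‖ + decaySeminorm k * (C * ‖h‖) := by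
        rw [integral_add hsub (hSi.const_mul _), integral_const_mul,
          integral_indicator hSm]
        gcongr
        exact k.integral_norm_translate_sub_le h
    _ = _ := by ring

namespace DyadicPartition

variable (𝔇 : DyadicPartition)

/-- Averages of the product of `1_P` with a block of frequency `2ⁿ`, at scale `|c|`: below the
scale `2⁻ⁿ` the trivial bound is used, above it the regularity of the boundary of `P`. -/
theorem exists_norm_scaleConv_indicator_le {r : ℝ} {P : Set E3} (hP : IsOpenOfClass r P)
    (hb : Bornology.IsBounded P) : ∃ C : ℝ, 0 ≤ C ∧
    ∀ (n : ℕ) (T : 𝓢'(E3, ℂ)) (B : ℝ), 0 ≤ B →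
      distLinftyNorm (𝔇.block n T) ≤ ENNReal.ofReal B → ∃ v, IsGivenBy (𝔇.block n T) v B ∧
        ∀ (k : 𝓢(E3, ℂ)) (x : E3) (c : ℝ), c ≠ 0 → |c| ≤ 1 →
          ‖scaleConv k c (P.indicator v) x‖ ≤
            C * decaySeminorm k * B * min 1 ((2 : ℝ)⁻¹ ^ n / |c|) := by
  obtain ⟨κ, hκ, hκ0, hrepr⟩ := 𝔇.exists_fatKernel
  obtain ⟨V, hV, hvar⟩ := exists_integral_norm_indicator_translate_le hP hb
  have hκ1 : Integrable fun y => ‖κ 1 y‖ * ‖y‖ := by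
    simpa using (κ 1).integrable_norm_mul_rpow zero_le_one le_rfl
  set J := ∫ y, ‖κ 1 y‖ * ‖y‖ with hJ
  have hJ0 : 0 ≤ J := integral_nonneg fun y => by positivity
  set W := ∫ z, decayWeight z with hW
  have hW0 : 0 ≤ W := integral_nonneg decayWeight_nonneg
  refine ⟨W + V * J, by positivity, fun n T B hB hT => ?_⟩
  obtain ⟨v, hv, -, hkv⟩ := hrepr n T B hB hT
  refine ⟨v, hv, fun k x c hc hc1 => ?_⟩
  have hD : 0 ≤ decaySeminorm k := apply_nonneg _ _
  have hca : 0 < |c| := abs_pos.2 hc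
  set Q := (fun y => x - c • y) ⁻¹' P with hQ
  have hQm : MeasurableSet Q := (by fun_prop : Measurable fun y => x - c • y) hP.1.measurableSet
  -- the substitution `y ↦ x - c y` turns `v` into a function of frequency `2ⁿ |c|`
  set u : E3 → ℂ := fun y => v (x - c • y) with hu
  have hum : Measurable u := hv.measurable.comp (by fun_prop)
  have huB : ∀ y, ‖u y‖ ≤ B := fun y => hv.bound _
  have huk : u = scaleConv (κ n) (-((2 : ℝ)⁻¹ ^ n / c)) u := by
    ext y
    rw [hu]
    conv_lhs => rw [hkv]
    simp only [scaleConv]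
    congr 1 with z
    congr 2
    rw [smul_sub, smul_smul, mul_neg, mul_div_cancel₀ _ hc]
    module
  have hGi : Integrable (Q.indicator k) := k.integrable.indicator hQm
  have heq : scaleConv k c (P.indicator v) x = ∫ y, Q.indicator k y * u y := by
    rw [scaleConv]
    congr 1 with y
    by_cases hy : x - c • y ∈ P <;> simp [hQ, hu, Set.indicator, hy]
  have htriv : ‖∫ y, Q.indicator k y * u y‖ ≤ W * decaySeminorm k * B := by
    calc _ ≤ ∫ y, decaySeminorm k * decayWeight y * B := by
          refine norm_integral_le_of_norm_le ((integrable_decayWeight.const_mul _).mul_const B)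
            (.of_forall fun y => ?_)
          rw [norm_mul]
          have h1 : ‖Q.indicator k y‖ ≤ decaySeminorm k * decayWeight y :=
            (norm_indicator_le_norm_self _ _).trans (norm_le_decaySeminorm k y)
          exact mul_le_mul h1 (huB y) (norm_nonneg _) ((norm_nonneg _).trans h1)
      _ = _ := by
          rw [integral_mul_const, integral_const_mul]
          ring
  rw [heq, mul_min_of_nonneg _ _ (by positivity), mul_one]
  have hWle : W * decaySeminorm k * B ≤ (W + V * J) * decaySeminorm k * B := by
    gcongr
    linarith [mul_nonneg hV hJ0]
  refine le_min (htriv.trans hWle) ?_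
  cases n with
  | zero =>
    refine (htriv.trans hWle).trans (le_mul_of_one_le_right (by positivity) ?_)
    rw [pow_zero]
    exact (one_le_div hca).2 hc1
  | succ n =>
    rw [hκ n] at huk
    refine (norm_integral_mul_le_of_eq_scaleConv (κ 1).integrable hκ0 hκ1 hGi
      (hvar k x c hc) hum huB huk).trans ?_
    rw [abs_neg, abs_div, abs_of_nonneg (by positivity : (0 : ℝ) ≤ (2 : ℝ)⁻¹ ^ (n + 1))]
    have h1 : V * J ≤ W + V * J := by linarith
    calc _ = V * J * (decaySeminorm k * B * ((2 : ℝ)⁻¹ ^ (n + 1) / |c|)) := by ring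
      _ ≤ (W + V * J) * (decaySeminorm k * B * ((2 : ℝ)⁻¹ ^ (n + 1) / |c|)) := by gcongr
      _ = _ := by ring

/-- A bounded open set of class `C¹` is a multiplier of `C^{s-1}_*` for `0 < s < 1`: the product
`1_P f` is the sum of the products of `1_P` with the blocks of `f`. -/
theorem charMultiplierNorm_lt_top {s r : ℝ} (hs₀ : 0 < s) (hs₁ : s < 1) {P : Set E3}
    (hP : IsOpenOfClass r P) (hb : Bornology.IsBounded P) :
    𝔇.charMultiplierNorm (s - 1) P < ⊤ := by
  obtain ⟨A, hA, hest⟩ := 𝔇.exists_norm_scaleConv_indicator_le hP hb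
  obtain ⟨C₁, hC₁, hsum⟩ := exists_sum_min_le hs₀ hs₁
  set D : ℕ → ℝ := fun n => decaySeminorm (𝓕⁻ (𝔇.baseSymbol n) : 𝓢(E3, ℂ)) with hD
  have hD0 : ∀ n, 0 ≤ D n := fun n => apply_nonneg _ _
  have hDle : ∀ n, D n ≤ D 0 + D 1 := fun n => by
    cases n with
    | zero => linarith [hD0 1]
    | succ n => linarith [hD0 0, show D (n + 1) = D 1 from rfl]
  have hDD : 0 ≤ D 0 + D 1 := add_nonneg (hD0 0) (hD0 1)
  set K : ℝ≥0 := ⟨A * (D 0 + D 1) * C₁, by positivity⟩ with hK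
  refine lt_of_le_of_lt (iInf₂_le K fun f hf => ?_) ENNReal.coe_lt_top
  set N : ℝ := (𝔇.holderNorm (s - 1) f).toReal with hN
  have hN0 : 0 ≤ N := ENNReal.toReal_nonneg
  have hfN : 𝔇.holderNorm (s - 1) f = ENNReal.ofReal N := (ENNReal.ofReal_toReal hf.ne).symm
  set b : ℕ → ℝ := fun n => (2 : ℝ) ^ ((1 - (n : ℝ)) * (s - 1)) * N with hbdef
  have hb0 : ∀ n, 0 ≤ b n := fun n => by positivity
  choose v hv hvest using fun n => hest n f (b n) (hb0 n) (𝔇.distLinftyNorm_block_le hfN.le n)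
  set g : ℕ → E3 → ℂ := fun n => P.indicator (v n) with hg
  have hgm : ∀ n, Measurable (g n) := fun n => (hv n).measurable.indicator hP.1.measurableSet
  have hgb : ∀ n x, ‖g n x‖ ≤ b n := fun n x =>
    (norm_indicator_le_norm_self _ _).trans ((hv n).bound x)
  -- summation over the blocks of `f`, seen at the scale `2⁻ᵐ`
  have hβ : ∀ m J : ℕ, ∑ n ∈ Finset.range J, b n * min 1 (2 ^ m * (2 : ℝ)⁻¹ ^ n) ≤
      C₁ * ((2 : ℝ) ^ ((1 - (m : ℝ)) * (s - 1)) * N) := fun m J => by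
    have hpow : ∀ n : ℕ, (2 : ℝ) ^ ((1 - (n : ℝ)) * (s - 1)) =
        (2 : ℝ) ^ (s - 1) * (2 : ℝ) ^ ((n : ℝ) * (1 - s)) := fun n => by
      rw [← Real.rpow_add two_pos]
      congr 1
      ring
    calc _ = (2 : ℝ) ^ (s - 1) * N * ∑ n ∈ Finset.range J,
          (2 : ℝ) ^ ((n : ℝ) * (1 - s)) * min 1 (2 ^ m * (2 : ℝ)⁻¹ ^ n) := by
          rw [Finset.mul_sum]
          refine Finset.sum_congr rfl fun n _ => ?_
          simp only [hbdef, hpow n]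
          ring
      _ ≤ (2 : ℝ) ^ (s - 1) * N * (C₁ * (2 : ℝ) ^ ((m : ℝ) * (1 - s))) := by
          gcongr
          exact hsum m J
      _ = _ := by
          rw [hpow m]
          ring
  have hβs : ∀ m, Summable fun n => b n * min 1 (2 ^ m * (2 : ℝ)⁻¹ ^ n) := fun m =>
    summable_of_sum_range_le (fun n => mul_nonneg (hb0 n) (by positivity)) (hβ m)
  have hβt : ∀ m : ℕ, ∑' n, b n * min 1 (2 ^ m * (2 : ℝ)⁻¹ ^ n) ≤
      C₁ * ((2 : ℝ) ^ ((1 - (m : ℝ)) * (s - 1)) * N) := fun m =>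
    Real.tsum_le_of_sum_range_le (fun n => mul_nonneg (hb0 n) (by positivity)) (hβ m)
  have hterm : ∀ (ψ : 𝓢(E3, ℂ)) n, ‖∫ x, ψ x * g n x‖ ≤
      A * decaySeminorm ψ * (b n * min 1 (2 ^ 0 * (2 : ℝ)⁻¹ ^ n)) := fun ψ n => by
    have h1 := hvest n ψ 0 (-1) (by norm_num) (by norm_num)
    simp only [scaleConv, neg_smul, one_smul, sub_neg_eq_add, zero_add, abs_neg, abs_one,
      div_one] at h1
    rw [pow_zero, one_mul, ← mul_assoc]
    exact h1
  have hψs : ∀ ψ : 𝓢(E3, ℂ), Summable fun n => ∫ x, ψ x * g n x := fun ψ =>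
    Summable.of_norm_bounded ((hβs 0).mul_left _) (hterm ψ)
  have hgi : ∀ (ψ : 𝓢(E3, ℂ)) n, Integrable fun x => ψ x * g n x := fun ψ n =>
    integrable_mul_of_bounded ψ.integrable (hgm n) (hgb n)
  -- the product `1_P f` is the sum of the products with the blocks of `f`
  let G₀ : 𝓢(E3, ℂ) →L[ℂ] ℂ := SchwartzMap.mkCLMtoNormedSpace (𝕜 := ℂ) (σ := RingHom.id ℂ)
    (fun ψ => ∑' n, ∫ x, ψ x * g n x)
    (fun ψ ψ' => by
      rw [← (hψs ψ).tsum_add (hψs ψ')]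
      congr 1 with n
      rw [← integral_add (hgi ψ n) (hgi ψ' n)]
      congr 1 with x
      rw [add_apply, add_mul])
    (fun a ψ => by
      rw [RingHom.id_apply, smul_eq_mul, ← tsum_mul_left]
      congr 1 with n
      rw [← integral_const_mul]
      congr 1 with x
      rw [smul_apply, smul_eq_mul, mul_assoc])
    ⟨Finset.Iic (4, 1), A * 2 ^ 4 * ∑' n, b n * min 1 (2 ^ 0 * (2 : ℝ)⁻¹ ^ n), 
      mul_nonneg (by positivity) (tsum_nonneg fun n => mul_nonneg (hb0 n) (by positivity)),
      fun ψ => by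
      refine (tsum_of_norm_bounded ((hβs 0).mul_left _).hasSum (hterm ψ)).trans_eq ?_
      rw [tsum_mul_left]
      have : decaySeminorm ψ =
          2 ^ 4 * ((Finset.Iic (4, 1)).sup (schwartzSeminormFamily ℂ E3 ℂ)) ψ := by
        rw [decaySeminorm, smul_apply, nsmul_eq_mul]
        norm_num
        rfl
      rw [this]
      ring⟩
  let G : 𝓢'(E3, ℂ) := ContinuousLinearMap.toPointwiseConvergenceCLM _ _ _ _ G₀
  have hGapply : ∀ ψ, G ψ = ∑' n, ∫ x, ψ x * g n x := fun ψ => rfl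
  refine ⟨G, ⟨fun j => (IsGivenBy.sum (Finset.range (j + 1)) fun n _ => hv n).memLp.toLp _,
    fun j => ?_, fun ψ => ?_⟩, ?_⟩
  · rw [lowFreq_eq_sum]
    exact (IsGivenBy.sum (Finset.range (j + 1)) fun n _ => hv n).toLp_eq
  · rw [hGapply]
    have h1 := ((hψs ψ).hasSum.tendsto_sum_nat).comp (tendsto_add_atTop_nat 1)
    refine h1.congr fun j => ?_
    have hj := IsGivenBy.sum (Finset.range (j + 1)) fun n _ => hv n
    rw [Function.comp_apply, ← integral_finsetSum _ fun n _ => hgi ψ n,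
      ← integral_indicator hP.1.measurableSet]
    refine integral_congr_ae ?_
    filter_upwards [hj.memLp.coeFn_toLp] with x hx
    by_cases hxP : x ∈ P
    · simp [hg, Set.indicator, hxP, hx, Finset.mul_sum]
    · simp [hg, Set.indicator, hxP]
  · rw [hfN, show (K : ℝ≥0∞) = ENNReal.ofReal (A * (D 0 + D 1) * C₁) from
      (ENNReal.ofReal_eq_coe_nnreal _).symm, ← ENNReal.ofReal_mul (by positivity)]
    refine 𝔇.holderNorm_le_of_block_le fun m => ?_
    have hc : (0 : ℝ) < (2 : ℝ)⁻¹ ^ m := by positivity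
    set k : 𝓢(E3, ℂ) := 𝓕⁻ (𝔇.baseSymbol m) with hk
    set F : ℕ → E3 → ℂ := fun n => scaleConv k ((2 : ℝ)⁻¹ ^ m) (g n) with hF
    have hFm : ∀ n, Measurable (F n) := fun n => (continuous_scaleConv k.integrable
      k.integral_norm_translate_sub_le (hgm n) (hgb n) hc).measurable
    have hFb : ∀ n x, ‖F n x‖ ≤ A * D m * (b n * min 1 (2 ^ m * (2 : ℝ)⁻¹ ^ n)) := fun n x => by
      refine (hvest n k x _ hc.ne' ?_).trans_eq ?_
      · rw [abs_of_pos hc]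
        exact pow_le_one₀ (by norm_num) (by norm_num)
      · rw [abs_of_pos hc, inv_pow 2 m, div_inv_eq_mul, mul_comm _ ((2 : ℝ) ^ m)]
        simp only [hD, ← hk]
        ring
    have hFs : ∀ x, HasSum (fun n => F n x) (∑' n, F n x) := fun x =>
      (Summable.of_norm_bounded ((hβs m).mul_left _) fun n => hFb n x).hasSum
    have hgiven : IsGivenBy (𝔇.block m G) (fun x => ∑' n, F n x)
        ((2 : ℝ) ^ ((1 - (m : ℝ)) * (s - 1)) * (A * (D 0 + D 1) * C₁ * N)) := by
      refine ⟨?_, fun x => ?_, fun ψ => ?_⟩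
      · refine measurable_of_tendsto_metrizable (f := fun J x => ∑ n ∈ Finset.range J, F n x)
          (fun J => Finset.measurable_fun_sum _ fun n _ => hFm n) ?_
        exact tendsto_pi_nhds.2 fun x => (hFs x).tendsto_sum_nat
      · refine (tsum_of_norm_bounded ((hβs m).mul_left _).hasSum fun n => hFb n x).trans ?_
        rw [tsum_mul_left]
        calc _ ≤ A * (D 0 + D 1) * (C₁ * ((2 : ℝ) ^ ((1 - (m : ℝ)) * (s - 1)) * N)) := 
              mul_le_mul (mul_le_mul_of_nonneg_left (hDle m) hA) (hβt m)
                (tsum_nonneg fun n => mul_nonneg (hb0 n) (by positivity)) (by positivity)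
          _ = _ := by ring
      · rw [block_eq, TemperedDistribution.fourierMultiplierCLM_apply_apply, hGapply]
        simp_rw [fourier_smulLeftCLM_fourierInv_apply, ← hk,
          fun n => (integral_mul_scaleConv' k.integrable ψ.integrable (hgm n) (hgb n)
            ((2 : ℝ)⁻¹ ^ m)).symm]
        have hFi : ∀ n, Integrable fun x => ψ x * F n x := fun n =>
          integrable_mul_of_bounded ψ.integrable (hFm n) (hFb n)
        have hFS : Summable fun n => ∫ x, ‖ψ x * F n x‖ := by
          refine Summable.of_nonneg_of_le (fun n => integral_nonneg fun x => norm_nonneg _)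
            (fun n => ?_) (((hβs m).mul_left (A * D m)).mul_left (∫ x, ‖ψ x‖))
          rw [← integral_mul_const]
          refine integral_mono (hFi n).norm (ψ.integrable.norm.mul_const _) fun x => ?_
          simp only [norm_mul]
          gcongr
          exact hFb n x
        rw [integral_tsum_of_summable_integral_norm hFi hFS]
        congr 1 with x
        rw [tsum_mul_left]
    exact hgiven.distLinftyNorm_le

end DyadicPartition

/-! ### Low frequencies of a divergence -/

/-- Integration by parts for averages against the derivative of a kernel. -/
theorem integral_mul_scaleConv_lineDerivOp (k : 𝓢(E3, ℂ)) (e : E3) {φ u : E3 → ℂ} {B c : ℝ}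
    (hφ : ContDiff ℝ 1 φ) (hφc : HasCompactSupport φ) (hu : Measurable u) (hB : ∀ x, ‖u x‖ ≤ B)
    (hc : c ≠ 0) :
    ∫ x, φ x * ((c⁻¹ : ℂ) * scaleConv (∂_{e} k : 𝓢(E3, ℂ)) c u x) =
      -∫ x, fderiv ℝ φ x e * scaleConv k c u x := by
  have hφi : Integrable φ := hφ.continuous.integrable_of_hasCompactSupport hφc
  have hφ' : Continuous fun x => fderiv ℝ φ x e :=
    (hφ.continuous_fderiv one_ne_zero).clm_apply continuous_const
  have hφ'c : HasCompactSupport fun x => fderiv ℝ φ x e := hφc.fderiv_apply ℝ e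
  have hφ'i : Integrable fun x => fderiv ℝ φ x e := hφ'.integrable_of_hasCompactSupport hφ'c
  have hcc : (c : ℂ) ≠ 0 := by exact_mod_cast hc
  -- integration by parts in the kernel
  have hparts : ∀ z, ∫ y, (∂_{e} k : 𝓢(E3, ℂ)) y * φ (z + c • y) =
      -(c * ∫ y, k y * fderiv ℝ φ (z + c • y) e) := fun z => by
    set θ : E3 → ℂ := fun y => φ (z + c • y) with hθ
    have hθd : ∀ y, HasFDerivAt θ (c • fderiv ℝ φ (z + c • y)) y := fun y => by
      have h1 : HasFDerivAt (fun y : E3 => z + c • y) (c • ContinuousLinearMap.id ℝ E3) y :=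
        ((hasFDerivAt_id y).const_smul c).const_add z
      have h2 := ((hφ.differentiable one_ne_zero) (z + c • y)).hasFDerivAt.comp y h1
      refine HasFDerivAt.congr_fderiv h2 ?_
      ext v
      simp
    have hθb : ∀ {g : E3 → ℂ}, Continuous g → HasCompactSupport g → ∀ k : 𝓢(E3, ℂ),
        Integrable fun y => k y * g (z + c • y) := fun {g} hg hgc k => by
      obtain ⟨D, hD⟩ := hgc.exists_bound_of_continuous hg
      exact integrable_mul_of_bounded k.integrable (hg.measurable.comp (by fun_prop))
        fun y => hD _
    have h1 : ∀ y, fderiv ℝ θ y e = c * fderiv ℝ φ (z + c • y) e := fun y => by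
      rw [(hθd y).fderiv]
      simp
    have h2 := integral_mul_fderiv_eq_neg_fderiv_mul_of_integrable (μ := (volume : Measure E3))
      (f := θ) (g := k) (v := e) ?_ ?_ ?_ (fun y _ => (hθd y).differentiableAt)
      (fun y _ => k.differentiableAt)
    · simp_rw [h1] at h2
      rw [← integral_const_mul, ← integral_neg]
      rw [← integral_neg] at h2
      calc _ = ∫ y, θ y * fderiv ℝ k y e := by
            congr 1 with y
            rw [SchwartzMap.lineDerivOp_apply_eq_fderiv, mul_comm]
        _ = _ := h2
        _ = _ := by
            congr 1 with y
            ring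
    · simp_rw [h1]
      refine ((hθb hφ' hφ'c k).const_mul (c : ℂ)).congr (.of_forall fun y => ?_)
      ring
    · refine (hθb hφ.continuous hφc (∂_{e} k : 𝓢(E3, ℂ))).congr (.of_forall fun y => ?_)
      simp only [SchwartzMap.lineDerivOp_apply_eq_fderiv]
      ring
    · refine (hθb hφ.continuous hφc k).congr (.of_forall fun y => ?_)
      ring
  calc _ = (c⁻¹ : ℂ) * ∫ x, φ x * scaleConv (∂_{e} k : 𝓢(E3, ℂ)) c u x := by
        rw [← integral_const_mul]
        congr 1 with x
        ring
    _ = _ := by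
        rw [integral_mul_scaleConv' (SchwartzMap.integrable _) hφi hu hB,
          integral_mul_scaleConv' k.integrable hφ'i hu hB, ← integral_const_mul, ← integral_neg]
        congr 1 with z
        rw [hparts]
        field_simp

namespace DyadicPartition

variable (𝔇 : DyadicPartition)

/-- The low frequencies of `div V` are tested against `C¹` functions by an integration by parts, up
to an error which only involves the gradient of the test function in `L¹`. -/
theorem exists_norm_integral_lowFreq_add_le {s B M : ℝ} (hs₀ : 0 < s) (hs₁ : s < 1) {V : E3 → E3}
    (hV : Continuous V) (hB : ∀ x i, |V x i| ≤ B)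
    (hM : ∀ i x y, |V x i - V y i| ≤ M * ‖x - y‖ ^ s) {F : ℕ → Lp ℂ ∞ (volume : Measure E3)}
    (hF : ∀ j, (F j : 𝓢'(E3, ℂ)) = 𝔇.lowFreq j
      (∑ i : Fin 3, ∂_{EuclideanSpace.single i (1 : ℝ)} (boundedDist fun x => V x i))) :
    ∃ ε : ℕ → ℝ, Tendsto ε atTop (𝓝 0) ∧ ∀ φ : E3 → ℂ, ContDiff ℝ 1 φ → HasCompactSupport φ →
      ∀ j, ‖(∫ x, φ x * F j x) + ∫ x, fderiv ℝ φ x (V x)‖ ≤ ε j * ∫ x, ‖fderiv ℝ φ x‖ := by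
  set k : 𝓢(E3, ℂ) := 𝓕⁻ 𝔇.lowSymbol with hk
  -- the integral of the kernel is `χ(0)`, so its averages converge to the function
  have hk1 : ∫ y, k y = 1 := by
    obtain ⟨a, ha, h⟩ := 𝔇.exists_χ_eq_one
    rw [hk, integral_fourierInv, lowSymbol_apply, h 0 (by simpa using ha), Complex.ofReal_one]
  set v : Fin 3 → E3 → ℂ := fun i x => (V x i : ℂ) with hv
  have hVi : ∀ i, Continuous fun x => V x i := fun i => by fun_prop
  have hvm : ∀ i, Measurable (v i) := fun i => Complex.measurable_ofReal.comp (hVi i).measurable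
  have hvB : ∀ i x, ‖v i x‖ ≤ B := fun i x => by simpa [hv] using hB x i
  have hgiven : ∀ j, ∃ B', IsGivenBy (F j : 𝓢'(E3, ℂ)) (fun x => ∑ i : Fin 3,
      ((((2 : ℝ)⁻¹ ^ j : ℝ) : ℂ)⁻¹ * scaleConv (∂_{EuclideanSpace.single i (1 : ℝ)} k : 𝓢(E3, ℂ))
        ((2 : ℝ)⁻¹ ^ j) (v i) x)) B' := fun j => by
    have h1 : ∀ i, ∃ B', IsGivenBy (TemperedDistribution.fourierMultiplierCLM ℂ
        (fun ξ => 𝔇.lowSymbol ((2 : ℝ)⁻¹ ^ j • ξ))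
        (∂_{EuclideanSpace.single i (1 : ℝ)} (boundedDist fun x => V x i)))
        (fun x => (((2 : ℝ)⁻¹ ^ j : ℝ) : ℂ)⁻¹ * scaleConv
          (∂_{EuclideanSpace.single i (1 : ℝ)} k : 𝓢(E3, ℂ)) ((2 : ℝ)⁻¹ ^ j) (v i) x) B' :=
      fun i => by
        rw [fourierMultiplierCLM_lineDerivOp _ (by positivity), hk, ← fourierInv_diffSymbol]
        exact ⟨_, ((isGivenBy_boundedDist (hVi i).measurable fun x => hB x i).fourierMultiplier _
          (by positivity)).const_smul _⟩
    choose B' hB' using h1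
    rw [hF j, lowFreq_eq, map_sum]
    exact ⟨_, IsGivenBy.sum Finset.univ fun i _ => hB' i⟩
  set I := ∫ y, ‖k y‖ * ‖y‖ ^ s with hI
  have happrox : ∀ j i x, ‖scaleConv k ((2 : ℝ)⁻¹ ^ j) (v i) x - v i x‖ ≤
      M * ((2 : ℝ)⁻¹ ^ j) ^ s * I := fun j i x => by
    have h1 := norm_scaleConv_sub_integral_mul_le k.integrable
      (k.integrable_norm_mul_rpow hs₀.le hs₁.le) (hvm i) (hvB i)
      (fun x y => by simpa [hv, ← Complex.ofReal_sub] using hM i x y)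
      (by positivity : (0 : ℝ) ≤ (2 : ℝ)⁻¹ ^ j) x
    rwa [hk1, one_mul] at h1
  refine ⟨fun j => 3 * (M * ((2 : ℝ)⁻¹ ^ j) ^ s * I), ?_, fun φ hφ hφc j => ?_⟩
  · have h1 : Tendsto (fun j : ℕ => ((2 : ℝ)⁻¹ ^ j) ^ s) atTop (𝓝 0) := by
      have := (tendsto_pow_atTop_nhds_zero_of_lt_one (by norm_num : (0 : ℝ) ≤ 2⁻¹)
        (by norm_num)).rpow_const (p := s) (.inr hs₀.le)
      rwa [Real.zero_rpow hs₀.ne'] at this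
    simpa using ((h1.const_mul M).mul_const I).const_mul 3
  set c : ℝ := (2 : ℝ)⁻¹ ^ j with hc
  have hc0 : 0 < c := by positivity
  have hφ' : ∀ e, Continuous fun x => fderiv ℝ φ x e := fun e =>
    (hφ.continuous_fderiv one_ne_zero).clm_apply continuous_const
  have hφi : Integrable φ := hφ.continuous.integrable_of_hasCompactSupport hφc
  have hφ'i : ∀ e, Integrable fun x => fderiv ℝ φ x e := fun e =>
    (hφ' e).integrable_of_hasCompactSupport (hφc.fderiv_apply ℝ e)
  have hφn : Integrable fun x => ‖fderiv ℝ φ x‖ :=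
    ((hφ.continuous_fderiv one_ne_zero).integrable_of_hasCompactSupport (hφc.fderiv ℝ)).norm
  set e : Fin 3 → E3 := fun i => EuclideanSpace.single i (1 : ℝ) with he
  have hsc : ∀ (k' : 𝓢(E3, ℂ)) i, Measurable (scaleConv k' c (v i)) := fun k' i =>
    (continuous_scaleConv k'.integrable k'.integral_norm_translate_sub_le (hvm i) (hvB i)
      hc0).measurable
  have hscB : ∀ (k' : 𝓢(E3, ℂ)) i x, ‖scaleConv k' c (v i) x‖ ≤ _ := fun k' i =>
    norm_scaleConv_le k'.integrable (hvB i) c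
  have h1 : ∫ x, φ x * F j x = -∑ i, ∫ x, fderiv ℝ φ x (e i) * scaleConv k c (v i) x := by
    obtain ⟨B', hgj⟩ := hgiven j
    have h2 : ∫ x, φ x * F j x = ∫ x, ∑ i, φ x * ((c⁻¹ : ℂ) *
        scaleConv (∂_{e i} k : 𝓢(E3, ℂ)) c (v i) x) := by
      refine integral_congr_ae ?_
      filter_upwards [hgj.ae_eq_of_coe_eq rfl] with x hx
      rw [hx, Finset.mul_sum]
    rw [h2, integral_finsetSum _ fun i _ => ?_, ← Finset.sum_neg_distrib]
    · exact Finset.sum_congr rfl fun i _ =>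
        integral_mul_scaleConv_lineDerivOp k (e i) hφ hφc (hvm i) (hvB i) hc0.ne'
    · refine ((integrable_mul_of_bounded hφi (hsc (∂_{e i} k) i) (hscB _ i)).const_mul
        (c⁻¹ : ℂ)).congr (.of_forall fun x => ?_)
      ring
  have h2 : ∀ x, fderiv ℝ φ x (V x) = ∑ i, fderiv ℝ φ x (e i) * v i x := fun x => by
    have hx : V x = ∑ i, V x i • e i := by
      simpa using ((EuclideanSpace.basisFun (Fin 3) ℝ).sum_repr (V x)).symm
    conv_lhs => rw [hx]
    simp [hv, mul_comm]
  have h3 : ∀ i, Integrable fun x => fderiv ℝ φ x (e i) * scaleConv k c (v i) x := fun i =>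
    integrable_mul_of_bounded (hφ'i _) (hsc k i) (hscB k i)
  have h4 : ∀ i, Integrable fun x => fderiv ℝ φ x (e i) * v i x := fun i =>
    integrable_mul_of_bounded (hφ'i _) (hvm i) (hvB i)
  rw [h1]
  simp_rw [h2]
  rw [integral_finsetSum _ fun i _ => h4 i, neg_add_eq_sub, ← Finset.sum_sub_distrib]
  calc _ ≤ ∑ _i : Fin 3, M * c ^ s * I * ∫ x, ‖fderiv ℝ φ x‖ := by
        refine norm_sum_le_of_le _ fun i _ => ?_
        rw [← integral_sub (h4 i) (h3 i), ← integral_const_mul]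
        refine norm_integral_le_of_norm_le (hφn.const_mul _) (.of_forall fun x => ?_)
        rw [← mul_sub, norm_mul, mul_comm, norm_sub_rev]
        refine mul_le_mul (happrox j i x) ?_ (norm_nonneg _) ((norm_nonneg _).trans (happrox j i x))
        simpa [he] using (fderiv ℝ φ x).le_opNorm (e i)
    _ = _ := by
        rw [Finset.sum_const, Finset.card_univ, Fintype.card_fin, nsmul_eq_mul]
        push_cast
        ring

end DyadicPartition

/-! ### Cut-offs along the boundary and tangent vector fields -/

/-- The function `1_P ψ` is a limit of compactly supported `C¹` functions, whose derivatives along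
the vector field `V` converge to those of `ψ` in `P`, without a contribution of the boundary of
`P`, and whose gradients are bounded in `L¹`. -/
def HasTangentialCutoffs (P : Set E3) (V : E3 → E3) (ψ : E3 → ℂ) : Prop :=
  ∃ (φ : ℕ → E3 → ℂ) (C : ℝ), (∀ n, ContDiff ℝ 1 (φ n)) ∧ (∀ n, HasCompactSupport (φ n)) ∧
    (∀ n x, ‖φ n x‖ ≤ ‖ψ x‖) ∧ (∀ x, Tendsto (fun n => φ n x) atTop (𝓝 (P.indicator ψ x))) ∧
    (∀ n, ∫ x, ‖fderiv ℝ (φ n) x‖ ≤ C) ∧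
    Tendsto (fun n => ∫ x, fderiv ℝ (φ n) x (V x)) atTop (𝓝 (∫ x in P, fderiv ℝ ψ x (V x)))

theorem fderiv_eq_zero_of_notMem_tsupport {ψ : E3 → ℂ} {x : E3} (hx : x ∉ tsupport ψ) :
    fderiv ℝ ψ x = 0 :=
  image_eq_zero_of_notMem_tsupport fun h => hx (tsupport_fderiv_subset ℝ h)

theorem hasTangentialCutoffs_of_tsupport_subset {P : Set E3} (V : E3 → E3) {ψ : E3 → ℂ}
    (hψ : ContDiff ℝ 1 ψ) (hψc : HasCompactSupport ψ) (h : tsupport ψ ⊆ P) :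
    HasTangentialCutoffs P V ψ := by
  have h1 : P.indicator ψ = ψ :=
    Set.indicator_eq_self.2 ((subset_tsupport ψ).trans h)
  refine ⟨fun _ => ψ, ∫ x, ‖fderiv ℝ ψ x‖, fun _ => hψ, fun _ => hψc, fun _ _ => le_rfl,
    fun x => by rw [h1]; exact tendsto_const_nhds, fun _ => le_rfl, ?_⟩
  rw [setIntegral_eq_integral_of_forall_compl_eq_zero fun x hx => ?_]
  · exact tendsto_const_nhds
  · rw [fderiv_eq_zero_of_notMem_tsupport fun hx' => hx (h hx')]
    rfl

theorem hasTangentialCutoffs_of_disjoint {P : Set E3} (hP : MeasurableSet P) (V : E3 → E3)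
    {ψ : E3 → ℂ} (h : tsupport ψ ⊆ Pᶜ) : HasTangentialCutoffs P V ψ := by
  have h1 : P.indicator ψ = 0 :=
    Set.indicator_eq_zero.2 (Set.disjoint_left.2 fun x hx hxP => h (subset_tsupport ψ hx) hxP)
  refine ⟨fun _ => 0, 0, fun _ => contDiff_const, fun _ => HasCompactSupport.zero,
    fun _ _ => by simp, fun x => by rw [h1]; exact tendsto_const_nhds, fun _ => by simp, ?_⟩
  rw [setIntegral_congr_fun hP (g := fun _ => 0) fun x hx => ?_]
  · simp
  · rw [fderiv_eq_zero_of_notMem_tsupport fun hx' => h hx' hx]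
    rfl

/-- On a compact set, a continuous function that vanishes on the zero set of `f` is small where `f`
is small. -/
theorem exists_forall_abs_lt_of_isCompact {K : Set E3} (hK : IsCompact K) {f q : E3 → ℝ}
    (hf : ContinuousOn f K) (hq : ContinuousOn q K) (h0 : ∀ y ∈ K, f y = 0 → q y = 0) {δ : ℝ}
    (hδ : 0 < δ) : ∃ η > 0, ∀ y ∈ K, |f y| < η → |q y| < δ := by
  have hS : IsCompact (K ∩ (fun y => |q y|) ⁻¹' Set.Ici δ) :=
    hK.of_isClosed_subset (hq.abs.preimage_isClosed_of_isClosed hK.isClosed isClosed_Ici)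
      Set.inter_subset_left
  rcases (K ∩ (fun y => |q y|) ⁻¹' Set.Ici δ).eq_empty_or_nonempty with he | hne
  · refine ⟨1, one_pos, fun y hy _ => not_le.1 fun hle => ?_⟩
    exact Set.notMem_empty y (he ▸ ⟨hy, hle⟩)
  · obtain ⟨z, hz, hmin⟩ := hS.exists_isMinOn hne (hf.abs.mono Set.inter_subset_left)
    refine ⟨|f z|, abs_pos.2 fun hfz => ?_, fun y hy hlt => not_le.1 fun hle => ?_⟩
    · have := hz.2
      simp only [Set.mem_preimage, h0 z hz.1 hfz, abs_zero, Set.mem_Ici] at this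
      linarith
    · exact hlt.not_ge (hmin ⟨hy, hle⟩)

theorem exists_abs_deriv_smoothTransition_le : ∃ D : ℝ, 0 ≤ D ∧
    (∀ t, |deriv Real.smoothTransition t| ≤ D) ∧
    ∀ t, t ∉ Set.Icc (0 : ℝ) 1 → deriv Real.smoothTransition t = 0 := by
  have h0 : ∀ t, t ∉ Set.Icc (0 : ℝ) 1 → deriv Real.smoothTransition t = 0 := fun t ht => by
    rw [Set.mem_Icc, not_and_or, not_le, not_le] at ht
    rcases ht with ht | ht
    · have h : Real.smoothTransition =ᶠ[𝓝 t] fun _ => 0 := by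
        filter_upwards [Iio_mem_nhds ht] with x hx
        exact Real.smoothTransition.zero_of_nonpos (le_of_lt hx)
      rw [h.deriv_eq, deriv_const]
    · have h : Real.smoothTransition =ᶠ[𝓝 t] fun _ => 1 := by
        filter_upwards [Ioi_mem_nhds ht] with x hx
        exact Real.smoothTransition.one_of_one_le (le_of_lt hx)
      rw [h.deriv_eq, deriv_const]
  have hc : Continuous (deriv Real.smoothTransition) :=
    (Real.smoothTransition.contDiff (n := 1)).continuous_deriv le_rfl
  obtain ⟨D, hD⟩ := isCompact_Icc.exists_bound_of_continuousOn (s := Set.Icc (0 : ℝ) 1)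
    hc.continuousOn
  have hD0 : 0 ≤ D := (norm_nonneg _).trans (hD 0 (by simp))
  refine ⟨D, hD0, fun t => ?_, h0⟩
  by_cases ht : t ∈ Set.Icc (0 : ℝ) 1
  · exact hD t ht
  · simpa [h0 t ht] using hD0

/-- Near a point of the boundary the cut-offs are functions of the defining function: their
gradients are of size `ε⁻¹` on a layer of width `ε`, where they are almost orthogonal to a vector
field which is tangent to the boundary. -/
theorem IsLocalDefiningFunction.exists_hasTangentialCutoffs {r : ℝ} {P U : Set E3} {x : E3}
    {f : E3 → ℝ} (h : IsLocalDefiningFunction r P x U f) (hP : IsOpen P) {V : E3 → E3}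
    (hV : Continuous V) (htan : IsTangentToFrontier r V P) :
    ∃ W, IsOpen W ∧ x ∈ W ∧ ∀ ψ : E3 → ℂ, ContDiff ℝ 1 ψ → HasCompactSupport ψ →
      tsupport ψ ⊆ W → HasTangentialCutoffs P V ψ := by
  obtain ⟨ρ, κ, L, i, hρ, hκ, -, hball, -, hmono⟩ := h.exists_chart
  obtain ⟨C₀, hC₀, hvol⟩ := exists_volume_le_of_hasSlices (‖x‖ + ρ)
  obtain ⟨D, hD, hHD, hH0⟩ := exists_abs_deriv_smoothTransition_le
  refine ⟨Metric.ball x ρ, Metric.isOpen_ball, Metric.mem_ball_self hρ,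
    fun ψ hψ hψc hψW => ?_⟩
  set K := tsupport ψ with hK
  have hKc : IsCompact K := hψc
  have hKU : K ⊆ U := hψW.trans hball
  have hfK : ContinuousOn f K := h.contDiffOn.continuousOn.mono hKU
  have hf'K : ContinuousOn (fderiv ℝ f) K :=
    (h.contDiffOn.continuousOn_fderiv_of_isOpen h.isOpen le_rfl).mono hKU
  have hfV : ContinuousOn (fun y => fderiv ℝ f y (V y)) K := hf'K.clm_apply hV.continuousOn
  obtain ⟨G, hG⟩ := hKc.exists_bound_of_continuousOn hf'K
  obtain ⟨Ψ, hΨ⟩ := hψc.exists_bound_of_continuous hψ.continuous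
  have hΨ0 : 0 ≤ Ψ := (norm_nonneg _).trans (hΨ 0)
  have hψ'c : Continuous (fderiv ℝ ψ) := hψ.continuous_fderiv one_ne_zero
  have hψ'i : Integrable fun y => ‖fderiv ℝ ψ y‖ :=
    (hψ'c.integrable_of_hasCompactSupport (hψc.fderiv ℝ)).norm
  -- the cut-offs: `H n` is `1` for `f ≤ -1 / a n` and `0` for `0 ≤ f`
  set a : ℕ → ℝ := fun n => (n : ℝ) + 1 with ha
  have ha0 : ∀ n, 0 < a n := fun n => by positivity
  set H : ℕ → E3 → ℝ := fun n y => Real.smoothTransition (-(a n * f y)) with hH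
  have hH1 : ∀ n y, 0 ≤ H n y ∧ H n y ≤ 1 := fun n y =>
    ⟨Real.smoothTransition.nonneg _, Real.smoothTransition.le_one _⟩
  have hHlim : ∀ y ∈ U, Tendsto (fun n => H n y) atTop (𝓝 (P.indicator 1 y)) := fun y hy => by
    by_cases hyP : y ∈ P
    · have hfy := (h.mem_iff hy).1 hyP
      rw [Set.indicator_of_mem hyP]
      refine tendsto_const_nhds.congr' ?_
      obtain ⟨N, hN⟩ := exists_nat_ge ((-f y)⁻¹)
      filter_upwards [eventually_ge_atTop N] with n hn
      refine (Real.smoothTransition.one_of_one_le ?_).symm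
      have h1 : (-f y)⁻¹ ≤ a n := hN.trans ((Nat.cast_le.2 hn).trans (by simp [ha]))
      rw [inv_le_iff_one_le_mul₀ (by linarith)] at h1
      linarith
    · have hfy := not_lt.1 fun hlt => hyP ((h.mem_iff hy).2 hlt)
      rw [Set.indicator_of_notMem hyP]
      refine tendsto_const_nhds.congr fun n => ?_
      refine (Real.smoothTransition.zero_of_nonpos ?_).symm
      have := mul_nonneg (ha0 n).le hfy
      linarith
  have hHc : ∀ n, ∀ y ∈ U, ContDiffAt ℝ 1 (H n) y := fun n y hy =>
    Real.smoothTransition.contDiff.contDiffAt.comp y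
      (((contDiffAt_const (c := a n)).mul (h.contDiffAt hy)).neg)
  set φ : ℕ → E3 → ℂ := fun n y => H n y • ψ y with hφ
  have hφ0 : ∀ n y, y ∉ K → φ n =ᶠ[𝓝 y] 0 := fun n y hy => by
    filter_upwards [(notMem_tsupport_iff_eventuallyEq.1 hy)] with z hz
    simp [hφ, hz]
  have hφC : ∀ n, ContDiff ℝ 1 (φ n) := fun n => contDiff_iff_contDiffAt.2 fun y => by
    by_cases hy : y ∈ K
    · exact (hHc n y (hKU hy)).smul hψ.contDiffAt
    · exact (contDiffAt_const (c := (0 : ℂ))).congr_of_eventuallyEq (hφ0 n y hy)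
  have hφc : ∀ n, HasCompactSupport (φ n) := fun n => hψc.smul_left (f := H n)
  -- the layers in which the cut-offs vary
  set A : ℕ → Set E3 := fun n => K ∩ f ⁻¹' Set.Icc (-(a n)⁻¹) (a n)⁻¹ with hA
  have hAm : ∀ n, MeasurableSet (A n) := fun n =>
    (hfK.preimage_isClosed_of_isClosed hKc.isClosed isClosed_Icc).measurableSet
  have hAvol : ∀ n, volume (A n) ≤ ENNReal.ofReal (C₀ * (2 * (a n)⁻¹ / κ)) := fun n => by
    refine hvol i _ _ (hAm n) (fun z hz => ?_)
      ((hasSlices_of_chart hκ hmono (a n)⁻¹).mono fun z hz => ⟨hψW hz.1, abs_le.2 hz.2⟩)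
    have := hψW hz.1
    rw [mem_ball_iff_norm] at this
    have h2 := norm_sub_norm_le z x
    linarith
  have hAfin : ∀ n, volume (A n) < ⊤ := fun n => (hAvol n).trans_lt ENNReal.ofReal_lt_top
  have hAreal : ∀ n, a n * volume.real (A n) ≤ 2 * C₀ / κ := fun n => by
    have h1 : volume.real (A n) ≤ C₀ * (2 * (a n)⁻¹ / κ) := by
      have := ha0 n
      exact ENNReal.toReal_le_of_le_ofReal (by positivity) (hAvol n)
    calc _ ≤ a n * (C₀ * (2 * (a n)⁻¹ / κ)) := by gcongr
      _ = 2 * C₀ / κ * (a n * (a n)⁻¹) := by ring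
      _ = _ := by rw [mul_inv_cancel₀ (ha0 n).ne', mul_one]
  set H' : ℕ → E3 → ℝ := fun n y => deriv Real.smoothTransition (-(a n * f y)) * -(a n) with hH'
  have hfd : ∀ n y, fderiv ℝ (φ n) y = H n y • fderiv ℝ ψ y +
      (H' n y • fderiv ℝ f y).smulRight (ψ y) := fun n y => by
    by_cases hy : y ∈ K
    · have h1 : HasFDerivAt (H n) (H' n y • fderiv ℝ f y) y := by
        have h2 := (((h.contDiffAt (hKU hy)).differentiableAt one_ne_zero).hasFDerivAt.const_mul
          (a n)).neg
        have h3 := ((Real.smoothTransition.contDiff (n := 1)).differentiable one_ne_zero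
          (-(a n * f y))).hasDerivAt.comp_hasFDerivAt y h2
        refine h3.congr_fderiv ?_
        simp only [hH', smul_smul, ← neg_smul, mul_neg]
      exact (h1.smul (hψ.differentiable one_ne_zero y).hasFDerivAt).fderiv
    · rw [(hφ0 n y hy).fderiv_eq, fderiv_eq_zero_of_notMem_tsupport hy,
        image_eq_zero_of_notMem_tsupport hy]
      ext v
      simp
  have hH'A : ∀ n, ∀ y ∈ K, y ∉ A n → H' n y = 0 := fun n y hy hyA => by
    rw [hH']
    simp only
    rw [hH0, zero_mul]
    rintro ⟨h1, h2⟩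
    have h3 : f y ≤ 0 := by
      by_contra! hpos
      have := mul_pos (ha0 n) hpos
      linarith
    refine hyA ⟨hy, ?_, h3.trans (inv_pos.2 (ha0 n)).le⟩
    have := ha0 n
    rw [neg_le, ← mul_le_mul_iff_of_pos_left this, mul_inv_cancel₀ this.ne']
    linarith
  have hH'D : ∀ n y, |H' n y| ≤ D * a n := fun n y => by
    rw [hH', abs_mul, abs_neg, abs_of_pos (ha0 n)]
    have := ha0 n
    gcongr
    exact hHD _
  -- the contribution of the layers
  have hlayer : ∀ n (B : ℝ) (b : E3 → ℝ), 0 ≤ B → (∀ y ∈ A n, |b y| ≤ B) → ∀ y,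
      |H' n y * b y| * ‖ψ y‖ ≤ (A n).indicator (fun _ => D * a n * B * Ψ) y :=
    fun n B b hB hb y => by
    have := ha0 n
    by_cases hyA : y ∈ A n
    · rw [Set.indicator_of_mem hyA, abs_mul]
      gcongr
      · exact hH'D n y
      · exact hb y hyA
      · exact hΨ y
    · rw [Set.indicator_of_notMem hyA]
      by_cases hy : y ∈ K
      · simp [hH'A n y hy hyA]
      · simp [image_eq_zero_of_notMem_tsupport hy]
  have hlayerint : ∀ n (B : ℝ), 0 ≤ B →
      ∫ y, (A n).indicator (fun _ => D * a n * B * Ψ) y ≤ D * B * Ψ * (2 * C₀ / κ) :=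
    fun n B hB => by
    rw [integral_indicator (hAm n), setIntegral_const, smul_eq_mul]
    calc _ = D * B * Ψ * (a n * volume.real (A n)) := by ring
      _ ≤ _ := by gcongr; exact hAreal n
  have hlayeri : ∀ n (B : ℝ), Integrable ((A n).indicator fun _ => D * a n * B * Ψ) := fun n B =>
    (integrable_indicator_iff (hAm n)).2 (integrableOn_const (hAfin n).ne)
  refine ⟨φ, (∫ y, ‖fderiv ℝ ψ y‖) + D * |G| * Ψ * (2 * C₀ / κ), hφC, hφc, fun n y => ?_,
    fun y => ?_, fun n => ?_, ?_⟩
  · rw [norm_smul, Real.norm_of_nonneg (hH1 n y).1]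
    exact mul_le_of_le_one_left (norm_nonneg _) (hH1 n y).2
  · by_cases hy : y ∈ K
    · have h1 := (hHlim y (hKU hy)).smul_const (ψ y)
      by_cases hyP : y ∈ P <;> simpa [hφ, Set.indicator, hyP] using h1
    · have h1 : ψ y = 0 := image_eq_zero_of_notMem_tsupport hy
      simp [hφ, h1, Set.indicator]
  · refine le_trans ?_ (add_le_add_right (hlayerint n |G| (abs_nonneg _)) _)
    rw [← integral_add hψ'i (hlayeri n _)]
    refine integral_mono (((hφC n).continuous_fderiv one_ne_zero).integrable_of_hasCompactSupport
      ((hφc n).fderiv ℝ)).norm (hψ'i.add (hlayeri n _)) fun y => ?_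
    simp only
    rw [hfd]
    refine (norm_add_le _ _).trans (add_le_add ?_ ?_)
    · rw [norm_smul, Real.norm_of_nonneg (hH1 n y).1]
      exact mul_le_of_le_one_left (norm_nonneg _) (hH1 n y).2
    · refine le_trans (le_of_eq ?_) (hlayer n |G| (fun y => ‖fderiv ℝ f y‖) (abs_nonneg _)
        (fun y hy => ?_) y)
      · rw [ContinuousLinearMap.norm_smulRight_apply, norm_smul, abs_mul, Real.norm_eq_abs,
          abs_norm]
      · rw [abs_norm]
        exact (hG y hy.1).trans (le_abs_self G)
  · have hψV : Continuous fun y => fderiv ℝ ψ y (V y) := hψ'c.clm_apply hV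
    have hψVc : HasCompactSupport fun y => fderiv ℝ ψ y (V y) :=
      HasCompactSupport.intro hKc fun y hy => by
        rw [fderiv_eq_zero_of_notMem_tsupport hy]
        rfl
    have hψVi : Integrable fun y => fderiv ℝ ψ y (V y) :=
      hψV.integrable_of_hasCompactSupport hψVc
    have hHψm : ∀ n, Continuous fun y => H n y • fderiv ℝ ψ y (V y) := fun n =>
      continuous_iff_continuousAt.2 fun y => by
        by_cases hy : y ∈ K
        · exact (hHc n y (hKU hy)).continuousAt.smul hψV.continuousAt
        · refine (continuousAt_const (y := (0 : ℂ))).congr ?_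
          filter_upwards [hKc.isClosed.isOpen_compl.mem_nhds hy] with z hz
          rw [fderiv_eq_zero_of_notMem_tsupport hz]
          simp
    have hHψb : ∀ n y, ‖H n y • fderiv ℝ ψ y (V y)‖ ≤ ‖fderiv ℝ ψ y (V y)‖ := fun n y => by
      rw [norm_smul, Real.norm_of_nonneg (hH1 n y).1]
      exact mul_le_of_le_one_left (norm_nonneg _) (hH1 n y).2
    have hlim1 : Tendsto (fun n => ∫ y, H n y • fderiv ℝ ψ y (V y)) atTop
        (𝓝 (∫ y in P, fderiv ℝ ψ y (V y))) := by
      rw [← integral_indicator hP.measurableSet]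
      refine tendsto_integral_of_dominated_convergence _ (fun n => (hHψm n).aestronglyMeasurable)
        hψVi.norm (fun n => .of_forall (hHψb n)) (.of_forall fun y => ?_)
      by_cases hy : y ∈ K
      · have h1 := (hHlim y (hKU hy)).smul_const (fderiv ℝ ψ y (V y))
        by_cases hyP : y ∈ P <;> simpa [Set.indicator, hyP] using h1
      · simp [fderiv_eq_zero_of_notMem_tsupport hy, Set.indicator]
    have hHψi : ∀ n, Integrable fun y => H n y • fderiv ℝ ψ y (V y) := fun n =>
      hψVi.mono (hHψm n).aestronglyMeasurable (.of_forall (hHψb n))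
    have hφVi : ∀ n, Integrable fun y => fderiv ℝ (φ n) y (V y) := fun n => by
      refine (((hφC n).continuous_fderiv one_ne_zero).clm_apply hV).integrable_of_hasCompactSupport
        (HasCompactSupport.intro (hφc n) fun y hy => ?_)
      rw [fderiv_eq_zero_of_notMem_tsupport hy]
      rfl
    have hlim2 : Tendsto (fun n => (∫ y, fderiv ℝ (φ n) y (V y)) -
        ∫ y, H n y • fderiv ℝ ψ y (V y)) atTop (𝓝 0) := by
      have hE : 0 ≤ D * Ψ * (2 * C₀ / κ) := by positivity
      refine Metric.tendsto_atTop.2 fun η hη => ?_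
      set δ := η / (D * Ψ * (2 * C₀ / κ) + 1) with hδ
      have hδ0 : 0 < δ := by positivity
      obtain ⟨τ, hτ, hsmall⟩ := exists_forall_abs_lt_of_isCompact hKc hfK hfV
        (fun y hy hfy => htan y (h.mem_frontier_of_eq_zero hP (hKU hy) hfy) U f
          (h.of_mem (hKU hy))) hδ0
      obtain ⟨N, hN⟩ := exists_nat_gt τ⁻¹
      refine ⟨N, fun n hn => ?_⟩
      have haτ : (a n)⁻¹ < τ := by
        rw [inv_lt_comm₀ (ha0 n) hτ]
        exact hN.trans_le ((Nat.cast_le.2 hn).trans (by simp [ha]))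
      rw [dist_zero_right, ← integral_sub (hφVi n) (hHψi n)]
      calc _ ≤ ∫ y, (A n).indicator (fun _ => D * a n * δ * Ψ) y := by
            refine norm_integral_le_of_norm_le (hlayeri n δ) (.of_forall fun y => ?_)
            refine le_trans (le_of_eq ?_) (hlayer n δ (fun y => fderiv ℝ f y (V y)) hδ0.le
              (fun y hy => (hsmall y hy.1 ((abs_le.2 hy.2).trans_lt haτ)).le) y)
            rw [hfd]
            simp
        _ ≤ D * δ * Ψ * (2 * C₀ / κ) := hlayerint n δ hδ0.le
        _ = δ * (D * Ψ * (2 * C₀ / κ)) := by ring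
        _ < δ * (D * Ψ * (2 * C₀ / κ) + 1) := by gcongr; linarith
        _ = η := div_mul_cancel₀ _ (by positivity)
    simpa using hlim2.add hlim1

/-! ### Density of the compactly supported test functions -/

/-- Truncations of a Schwartz function at larger and larger scales converge to it. -/
theorem SchwartzMap.exists_tendsto_hasCompactSupport (ψ : 𝓢(E3, ℂ)) :
    ∃ Ψ : ℕ → 𝓢(E3, ℂ), (∀ n, HasCompactSupport (Ψ n)) ∧ Tendsto Ψ atTop (𝓝 ψ) := by
  let b : ContDiffBump (0 : E3) := ⟨1, 2, one_pos, one_lt_two⟩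
  have hbC : ContDiff ℝ (⊤ : ℕ∞) b := b.contDiff
  set q : E3 → ℝ := fun y => 1 - b y with hq
  have hqC : ContDiff ℝ (⊤ : ℕ∞) q := contDiff_const.sub hbC
  set c : ℕ → ℝ := fun n => 1 / ((n : ℝ) + 1) with hc
  have hc0 : ∀ n, 0 < c n := fun n => by positivity
  have hc1 : ∀ n, c n ≤ 1 := fun n => div_le_one_of_le₀ (by simp) (by positivity)
  have hηc : ∀ n, HasCompactSupport fun x => b (c n • x) := fun n =>
    b.hasCompactSupport.comp_homeomorph (Homeomorph.smulOfNeZero (c n) (hc0 n).ne')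
  have hΨc : ∀ n, HasCompactSupport fun x => b (c n • x) • ψ x := fun n => (hηc n).smul_right
  refine ⟨fun n => (hΨc n).toSchwartzMap ((hbC.comp (by fun_prop)).smul (ψ.smooth _)),
    fun n => hΨc n, ?_⟩
  -- the derivatives of `1 - b(c ·)` are bounded, and they vanish for `c ‖x‖ < 1`
  have hbd : ∀ i : ℕ, ∃ M : ℝ, ∀ x, ‖iteratedFDeriv ℝ i q x‖ ≤ M := fun i => by
    cases i with
    | zero =>
      refine ⟨1, fun x => ?_⟩
      rw [norm_iteratedFDeriv_zero, hq, Real.norm_of_nonneg (by linarith [b.le_one (x := x)])]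
      linarith [b.nonneg (x := x)]
    | succ i =>
      have hbC' : ContDiff ℝ (i + 1 : ℕ) b := b.contDiff
      obtain ⟨M, hM⟩ := (b.hasCompactSupport.iteratedFDeriv (𝕜 := ℝ)
        (i + 1)).exists_bound_of_continuous (hbC'.continuous_iteratedFDeriv le_rfl)
      refine ⟨M, fun x => ?_⟩
      rw [hq, fun_iteratedFDeriv_sub contDiff_const hbC',
        iteratedFDeriv_const_of_ne (Nat.succ_ne_zero i)]
      simpa using hM x
  choose M hM using hbd
  have hM0 : ∀ i, 0 ≤ M i := fun i => (norm_nonneg _).trans (hM i 0)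
  have hq0 : ∀ i y, ‖y‖ < 1 → iteratedFDeriv ℝ i q y = 0 := fun i y hy => by
    have h1 : q =ᶠ[𝓝 y] fun _ => 0 := by
      filter_upwards [Metric.isOpen_ball.mem_nhds (mem_ball_zero_iff.2 hy)] with z hz
      rw [hq]
      simp only
      rw [b.one_of_mem_closedBall (Metric.ball_subset_closedBall hz), sub_self]
    rw [(h1.iteratedFDeriv ℝ i).eq_of_nhds]
    simp
  have hqn : ∀ n i x, ‖iteratedFDeriv ℝ i (fun z => q (c n • z)) x‖ ≤ M i * (c n * ‖x‖) :=
    fun n i x => by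
      rw [iteratedFDeriv_comp_const_smul _ (hqC.of_le (by exact_mod_cast le_top)), norm_smul,
        norm_pow, Real.norm_of_nonneg (hc0 n).le]
      have hn : ‖c n • x‖ = c n * ‖x‖ := by rw [norm_smul, Real.norm_of_nonneg (hc0 n).le]
      rcases lt_or_ge (c n * ‖x‖) 1 with hx | hx
      · rw [hq0 i _ (hn.trans_lt hx), norm_zero, mul_zero]
        have := hM0 i
        have := hc0 n
        positivity
      · refine (mul_le_of_le_one_left (norm_nonneg _)
          (pow_le_one₀ (hc0 n).le (hc1 n))).trans ((hM i _).trans ?_)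
        exact le_mul_of_one_le_right (hM0 i) hx
  rw [(schwartz_withSeminorms ℂ E3 ℂ).tendsto_nhds]
  rintro ⟨k, l⟩ ε hε
  set S := ∑ i ∈ Finset.range (l + 1), (l.choose i : ℝ) * M i *
    SchwartzMap.seminorm ℂ (k + 1) (l - i) ψ with hS
  have hS0 : 0 ≤ S := Finset.sum_nonneg fun i _ =>
    mul_nonneg (mul_nonneg (by positivity) (hM0 i)) (apply_nonneg _ _)
  have hlim : Tendsto (fun n => c n * S) atTop (𝓝 0) := by
    simpa [hc] using tendsto_one_div_add_atTop_nhds_zero_nat.mul_const S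
  filter_upwards [hlim.eventually_lt_const hε] with n hn
  refine lt_of_le_of_lt (SchwartzMap.seminorm_le_bound ℂ k l _ (mul_nonneg (hc0 n).le hS0)
    fun x => ?_) hn
  have hfun : ⇑((hΨc n).toSchwartzMap ((hbC.comp (by fun_prop)).smul (ψ.smooth _)) - ψ) =
      -fun x => q (c n • x) • ψ x := by
    ext x
    simp [hq]
    ring
  rw [hfun, iteratedFDeriv_neg_apply, norm_neg]
  have h1 := norm_iteratedFDeriv_smul_le (hqC.comp (by fun_prop : ContDiff ℝ (⊤ : ℕ∞)
    fun x : E3 => c n • x)) (ψ.smooth ⊤) x (n := l) (by exact_mod_cast le_top)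
  calc _ ≤ ‖x‖ ^ k * ∑ i ∈ Finset.range (l + 1), (l.choose i : ℝ) *
        ‖iteratedFDeriv ℝ i (fun z => q (c n • z)) x‖ * ‖iteratedFDeriv ℝ (l - i) ψ x‖ := by
        gcongr
        exact h1
    _ ≤ c n * S := by
        rw [Finset.mul_sum, Finset.mul_sum]
        refine Finset.sum_le_sum fun i _ => ?_
        calc _ ≤ ‖x‖ ^ k * ((l.choose i : ℝ) * (M i * (c n * ‖x‖)) *
              ‖iteratedFDeriv ℝ (l - i) ψ x‖) := by
              gcongr
              exact hqn n i x
          _ = c n * ((l.choose i : ℝ) * M i *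
              (‖x‖ ^ (k + 1) * ‖iteratedFDeriv ℝ (l - i) ψ x‖)) := by ring
          _ ≤ _ := by
              have := hM0 i
              have := (hc0 n).le
              gcongr
              exact SchwartzMap.le_seminorm ℂ (k + 1) (l - i) ψ x

/-- A tempered distribution is determined by its values on compactly supported functions. -/
theorem TemperedDistribution.eq_of_hasCompactSupport {T T' : 𝓢'(E3, ℂ)}
    (h : ∀ ψ : 𝓢(E3, ℂ), HasCompactSupport ψ → T ψ = T' ψ) : T = T' := by
  ext ψ
  obtain ⟨Ψ, hΨ, hlim⟩ := ψ.exists_tendsto_hasCompactSupport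
  have hT : ∀ S : 𝓢'(E3, ℂ), Tendsto (fun n => S (Ψ n)) atTop (𝓝 (S ψ)) := fun S =>
    ((map_continuous S).tendsto ψ).comp hlim
  exact tendsto_nhds_unique (hT T) ((hT T').congr fun n => (h _ (hΨ n)).symm)

/-! ### Products of characteristic functions and divergences of tangent vector fields -/

/-- A function with compact support is a finite sum of functions supported in the sets of an open
cover. -/
theorem exists_sum_eq_of_hasCompactSupport {ψ : E3 → ℂ} (hψ : ContDiff ℝ 1 ψ)
    (hψc : HasCompactSupport ψ) {W : E3 → Set E3} (hW : ∀ x, IsOpen (W x)) (hxW : ∀ x, x ∈ W x) :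
    ∃ (I : Finset E3) (Ψ : E3 → E3 → ℂ), (∀ x, ContDiff ℝ 1 (Ψ x)) ∧
      (∀ x, HasCompactSupport (Ψ x)) ∧ (∀ x, tsupport (Ψ x) ⊆ W x) ∧ ψ = ∑ x ∈ I, Ψ x := by
  obtain ⟨ρ, hρ⟩ := SmoothPartitionOfUnity.exists_isSubordinate (modelWithCornersSelf ℝ E3)
    isClosed_univ W hW fun x _ => Set.mem_iUnion.2 ⟨x, hxW x⟩
  have hfin := ρ.locallyFinite.finite_nonempty_inter_compact hψc
  refine ⟨hfin.toFinset, fun x y => ρ x y • ψ y, fun x => ?_, fun x => ?_, fun x => ?_, ?_⟩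
  · exact ((ρ x).contMDiff.contDiff.of_le (by exact_mod_cast le_top)).smul hψ
  · exact hψc.smul_left (f := ρ x)
  · exact (tsupport_smul_subset_left (ρ x) ψ).trans (hρ x)
  · ext y
    rw [Finset.sum_apply, ← Finset.sum_smul]
    by_cases hy : ψ y = 0
    · rw [hy, smul_zero]
    · rw [← finsum_eq_sum_of_support_subset (fun x => ρ x y) fun x hx => ?_,
        ρ.sum_eq_one (Set.mem_univ y), one_smul]
      simp only [Set.Finite.coe_toFinset, Set.mem_ofPred_eq]
      exact ⟨y, hx, subset_tsupport ψ hy⟩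

namespace DyadicPartition

variable (𝔇 : DyadicPartition)

/-- The product of the characteristic function of `P` and of the divergence of a vector field `V`
tangent to the boundary of `P` is the divergence of `1_P V`. -/
theorem IsCharMul.eq_sum_lineDerivOp {s r B M : ℝ} (hs₀ : 0 < s) (hs₁ : s < 1) {P : Set E3}
    (hP : IsOpenOfClass r P) {V : E3 → E3} (hV : Continuous V) (hB : ∀ x i, |V x i| ≤ B)
    (hM : ∀ i x y, |V x i - V y i| ≤ M * ‖x - y‖ ^ s) (htan : IsTangentToFrontier r V P)
    {g : 𝓢'(E3, ℂ)} (hg : 𝔇.IsCharMul P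
      (∑ i : Fin 3, ∂_{EuclideanSpace.single i (1 : ℝ)} (boundedDist fun x => V x i)) g) :
    g = ∑ i : Fin 3, ∂_{EuclideanSpace.single i (1 : ℝ)}
      (boundedDist (P.indicator fun x => V x i)) := by
  obtain ⟨F, hF, hFg⟩ := hg
  obtain ⟨ε, hε, hest⟩ := 𝔇.exists_norm_integral_lowFreq_add_le hs₀ hs₁ hV hB hM hF
  have hPm : MeasurableSet P := hP.1.measurableSet
  have hψF : ∀ {ψ : E3 → ℂ}, Continuous ψ → HasCompactSupport ψ → ∀ j,
      Integrable fun x => ψ x * F j x := fun hψ hψc j =>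
    (hψ.integrable_of_hasCompactSupport hψc).mul_of_top_left (Lp.memLp (F j))
  have hψV : ∀ {ψ : E3 → ℂ}, ContDiff ℝ 1 ψ → HasCompactSupport ψ →
      Integrable fun x => fderiv ℝ ψ x (V x) := fun {ψ} hψ hψc => by
    refine ((hψ.continuous_fderiv one_ne_zero).clm_apply hV).integrable_of_hasCompactSupport
      (HasCompactSupport.intro hψc fun y hy => ?_)
    rw [fderiv_eq_zero_of_notMem_tsupport hy]
    rfl
  have hcut : ∀ ψ : E3 → ℂ, ContDiff ℝ 1 ψ → HasCompactSupport ψ → HasTangentialCutoffs P V ψ →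
      Tendsto (fun j => ∫ x in P, ψ x * F j x) atTop (𝓝 (-∫ x in P, fderiv ℝ ψ x (V x))) := by
    rintro ψ hψ hψc ⟨φ, C, hφ, hφc, hφψ, hlim, hC, hV'⟩
    -- for fixed `j` the cut-offs may converge; the error is uniform, as their gradients are
    -- bounded in `L¹`
    have hbound : ∀ j, ‖(∫ x in P, ψ x * F j x) + ∫ x in P, fderiv ℝ ψ x (V x)‖ ≤ |ε j| * C :=
      fun j => by
      have h1 : Tendsto (fun n => ∫ x, φ n x * F j x) atTop (𝓝 (∫ x in P, ψ x * F j x)) := by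
        rw [← integral_indicator hPm]
        refine tendsto_integral_of_dominated_convergence _
          (fun n => (hψF (hφ n).continuous (hφc n) j).aestronglyMeasurable)
          (hψF hψ.continuous hψc j).norm (fun n => .of_forall fun x => ?_)
          (.of_forall fun x => ?_)
        · rw [norm_mul, norm_mul]
          gcongr
          exact hφψ n x
        · rw [Set.indicator_mul_left]
          exact (hlim x).mul_const _
      refine le_of_tendsto' (h1.add hV').norm fun n => (hest (φ n) (hφ n) (hφc n) j).trans ?_
      exact mul_le_mul (le_abs_self _) (hC n) (integral_nonneg fun _ => norm_nonneg _)
        (abs_nonneg _)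
    have h2 : Tendsto (fun j => (∫ x in P, ψ x * F j x) + ∫ x in P, fderiv ℝ ψ x (V x)) atTop
        (𝓝 0) := squeeze_zero_norm hbound (by simpa using hε.abs.mul_const C)
    simpa using h2.sub_const (∫ x in P, fderiv ℝ ψ x (V x))
  -- cut-offs exist locally: inside `P`, outside its closure, and along its boundary
  have hlocal : ∀ x, ∃ W, IsOpen W ∧ x ∈ W ∧ ∀ ψ : E3 → ℂ, ContDiff ℝ 1 ψ →
      HasCompactSupport ψ → tsupport ψ ⊆ W → HasTangentialCutoffs P V ψ := fun x => by
    by_cases hx : x ∈ P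
    · exact ⟨P, hP.1, hx, fun ψ hψ hψc h => hasTangentialCutoffs_of_tsupport_subset V hψ hψc h⟩
    by_cases hx' : x ∈ closure P
    · obtain ⟨U, f, hf⟩ := hP.2 x (by rw [hP.1.frontier_eq]; exact ⟨hx', hx⟩)
      exact hf.exists_hasTangentialCutoffs hP.1 hV htan
    · exact ⟨(closure P)ᶜ, isClosed_closure.isOpen_compl, hx', fun ψ _ _ h =>
        hasTangentialCutoffs_of_disjoint hPm V
          (h.trans (Set.compl_subset_compl.2 subset_closure))⟩
  choose W hW hxW hWcut using hlocal
  have hmain : ∀ ψ : E3 → ℂ, ContDiff ℝ 1 ψ → HasCompactSupport ψ →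
      Tendsto (fun j => ∫ x in P, ψ x * F j x) atTop (𝓝 (-∫ x in P, fderiv ℝ ψ x (V x))) :=
    fun ψ hψ hψc => by
    obtain ⟨I, Ψ, hΨ, hΨc, hΨW, rfl⟩ := exists_sum_eq_of_hasCompactSupport hψ hψc hW hxW
    have h1 : ∀ j, ∫ x in P, (∑ y ∈ I, Ψ y) x * F j x = ∑ y ∈ I, ∫ x in P, Ψ y x * F j x :=
      fun j => by
      simp_rw [Finset.sum_apply, Finset.sum_mul]
      exact integral_finsetSum _ fun y _ => (hψF (hΨ y).continuous (hΨc y) j).integrableOn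
    have h2 : ∫ x in P, fderiv ℝ (∑ y ∈ I, Ψ y) x (V x) =
        ∑ y ∈ I, ∫ x in P, fderiv ℝ (Ψ y) x (V x) := by
      rw [← integral_finsetSum _ fun y _ => (hψV (hΨ y) (hΨc y)).integrableOn]
      congr 1 with x
      rw [fderiv_sum fun y _ => (hΨ y).differentiable one_ne_zero x]
      simp
    simp_rw [h1, h2, ← Finset.sum_neg_distrib]
    exact tendsto_finsetSum _ fun y _ => hcut _ (hΨ y) (hΨc y)
      (hWcut y _ (hΨ y) (hΨc y) (hΨW y))
  refine TemperedDistribution.eq_of_hasCompactSupport fun ψ hψc => ?_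
  refine (tendsto_nhds_unique (hFg ψ) (hmain ψ (ψ.smooth 1) hψc)).trans ?_
  have hVi : ∀ i, Measurable (P.indicator fun x => V x i) := fun i =>
    (by fun_prop : Continuous fun x => V x i).measurable.indicator hPm
  have hgiven : ∀ i, IsGivenBy (boundedDist (P.indicator fun x => V x i)) _ B := fun i =>
    isGivenBy_boundedDist (hVi i) fun x =>
      (norm_indicator_le_norm_self (fun x => V x i) x).trans (hB x i)
  rw [sum_apply, ← integral_indicator hPm, ← integral_neg]
  have h3 : ∀ i : Fin 3, (∂_{EuclideanSpace.single i (1 : ℝ)}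
      (boundedDist (P.indicator fun x => V x i)) : 𝓢'(E3, ℂ)) ψ =
      -∫ x, (∂_{EuclideanSpace.single i (1 : ℝ)} ψ : 𝓢(E3, ℂ)) x *
        ((P.indicator (fun x => V x i) x : ℝ) : ℂ) := fun i => by
    rw [TemperedDistribution.lineDerivOp_apply_apply, map_neg, (hgiven i).apply_eq]
  have h4 : ∀ i : Fin 3, Integrable fun x =>
      -((∂_{EuclideanSpace.single i (1 : ℝ)} ψ : 𝓢(E3, ℂ)) x *
        ((P.indicator (fun x => V x i) x : ℝ) : ℂ)) := fun i =>
    (integrable_mul_of_bounded (SchwartzMap.integrable _) (hgiven i).measurable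
      (hgiven i).bound).neg
  simp_rw [h3, ← integral_neg]
  rw [← integral_finsetSum _ fun i _ => h4 i]
  congr 1 with x
  have hx : V x = ∑ i, V x i • EuclideanSpace.single i (1 : ℝ) := by
    simpa using ((EuclideanSpace.basisFun (Fin 3) ℝ).sum_repr (V x)).symm
  by_cases hxP : x ∈ P
  · simp only [Set.indicator_of_mem hxP, SchwartzMap.lineDerivOp_apply_eq_fderiv]
    conv_lhs => rw [hx]
    simp [mul_comm]
  · simp [hxP]

end DyadicPartition

/-! ### The divergence estimate -/

theorem boundedDist_add {u u' : E3 → ℝ} {B B' : ℝ} (hu : Measurable u) (hB : ∀ x, |u x| ≤ B)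
    (hu' : Measurable u') (hB' : ∀ x, |u' x| ≤ B') :
    boundedDist (fun x => u x + u' x) = boundedDist u + boundedDist u' := by
  have h1 := (isGivenBy_boundedDist hu hB).add (isGivenBy_boundedDist hu' hB')
  have h2 := isGivenBy_boundedDist (hu.add hu') fun x =>
    (abs_add_le _ _).trans (add_le_add (hB x) (hB' x))
  ext ψ
  rw [h1.apply_eq]
  refine (h2.apply_eq ψ).trans ?_
  simp

theorem abs_mul_sub_mul_le {f g : E3 → ℝ} {F G M N s : ℝ} (hF : ∀ x, |f x| ≤ F)
    (hG : ∀ x, |g x| ≤ G) (hM : ∀ x y, |f x - f y| ≤ M * ‖x - y‖ ^ s)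
    (hN : ∀ x y, |g x - g y| ≤ N * ‖x - y‖ ^ s) (x y : E3) :
    |f x * g x - f y * g y| ≤ (F * N + G * M) * ‖x - y‖ ^ s := by
  have hF0 : 0 ≤ F := (abs_nonneg _).trans (hF x)
  calc |f x * g x - f y * g y| = |f x * (g x - g y) + (f x - f y) * g y| := by
        congr 1
        ring
    _ ≤ |f x| * |g x - g y| + |f x - f y| * |g y| := by
        rw [← abs_mul, ← abs_mul]
        exact abs_add_le _ _
    _ ≤ F * (N * ‖x - y‖ ^ s) + M * ‖x - y‖ ^ s * G :=
        add_le_add (mul_le_mul (hF x) (hN x y) (abs_nonneg _) hF0)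
          (mul_le_mul (hM x y) (hG y) (abs_nonneg _) ((abs_nonneg _).trans (hM x y)))
    _ = _ := by ring

namespace DyadicPartition

variable (𝔇 : DyadicPartition)

theorem holderNorm_le_mul_of_le {s r : ℝ} (hsr : s ≤ r) (T : 𝓢'(E3, ℂ)) :
    𝔇.holderNorm s T ≤ ENNReal.ofReal ((2 : ℝ) ^ (r - s)) * 𝔇.holderNorm r T := by
  refine iSup_le fun n => le_trans ?_ (mul_le_mul_right (le_iSup (fun n : ℕ => ENNReal.ofReal
    ((2 : ℝ) ^ (((n : ℝ) - 1) * r)) * distLinftyNorm (𝔇.block n T)) n) _)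
  rw [← mul_assoc, ← ENNReal.ofReal_mul (by positivity), ← Real.rpow_add two_pos]
  gcongr
  · norm_num
  · nlinarith [mul_nonneg (Nat.cast_nonneg (α := ℝ) n) (sub_nonneg.2 hsr)]

/-- The divergence of a bounded `s`-Hölder continuous vector field belongs to `C^{s-1}_*`. -/
theorem exists_holderNorm_sum_lineDerivOp_le {s : ℝ} (hs₀ : 0 < s) (hs₁ : s < 1) :
    ∃ C : ℝ, 0 ≤ C ∧ ∀ (u : Fin 3 → E3 → ℝ) (B M : ℝ), 0 ≤ M → (∀ i, Measurable (u i)) →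
      (∀ i x, |u i x| ≤ B) → (∀ i x y, |u i x - u i y| ≤ M * ‖x - y‖ ^ s) →
      𝔇.holderNorm (s - 1) (∑ i : Fin 3, ∂_{EuclideanSpace.single i (1 : ℝ)} (boundedDist (u i))) ≤
        ENNReal.ofReal (C * M) := by
  obtain ⟨C, hC, h⟩ := 𝔇.exists_holderNorm_lineDerivOp_le hs₀ hs₁
  refine ⟨3 * C, by positivity, fun u B M hM hu hB hM' => ?_⟩
  have h1 := fun i => h (u i) B M i (hu i) (hB i) (hM' i)
  rw [Fin.sum_univ_three]
  calc _ ≤ ENNReal.ofReal (C * M) + ENNReal.ofReal (C * M) + ENNReal.ofReal (C * M) :=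
        (𝔇.holderNorm_add_le _ _ _).trans (add_le_add ((𝔇.holderNorm_add_le _ _ _).trans
          (add_le_add (h1 0) (h1 1))) (h1 2))
    _ = _ := by
        rw [← ENNReal.ofReal_add (by positivity) (by positivity),
          ← ENNReal.ofReal_add (by positivity) (by positivity)]
        congr 1
        ring

/-- The divergence of `θ w`, where `w` is tangent to the boundary of `P` and `θ` is equal to `a`
in `P` and to `b` outside: the vector field `θ w` is the sum of `b w` and of the product of `1_P`
with a tangent field. -/
theorem exists_holderNorm_div_le {s : ℝ} (hs₀ : 0 < s) (hs₁ : s < 1) :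
    ∃ C : ℝ, 0 ≤ C ∧ ∀ (r : ℝ) (P : Set E3), IsOpenOfClass r P → ∀ K : ℝ≥0,
      𝔇.charMultiplierNorm (s - 1) P < K → ∀ (w : E3 → E3) (a b θ : E3 → ℝ) (W A Mw Ma Mb : ℝ),
      Continuous w → (∀ i x, |w x i| ≤ W) → (∀ i x y, |w x i - w y i| ≤ Mw * ‖x - y‖ ^ s) →
      IsTangentToFrontier r w P → Continuous a → Continuous b → (∀ x, |a x| ≤ A) →
      (∀ x, |b x| ≤ A) → (∀ x y, |a x - a y| ≤ Ma * ‖x - y‖ ^ s) →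
      (∀ x y, |b x - b y| ≤ Mb * ‖x - y‖ ^ s) → 0 ≤ Mw → 0 ≤ Ma → 0 ≤ Mb →
      (θ =ᵐ[volume] fun x => b x + P.indicator (fun x => a x - b x) x) →
      𝔇.holderNorm (s - 1) (∑ i : Fin 3, ∂_{EuclideanSpace.single i (1 : ℝ)}
        (boundedDist fun x => w x i * θ x)) ≤
        ENNReal.ofReal (C * (1 + 2 * K) * (W * (Ma + Mb) + A * Mw)) := by
  obtain ⟨C, hC, hdiv⟩ := 𝔇.exists_holderNorm_sum_lineDerivOp_le hs₀ hs₁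
  refine ⟨C, hC, fun r P hP K hK w a b θ W A Mw Ma Mb hw hW hMw htan ha hb haA hbA hMa hMb
    hMw0 hMa0 hMb0 hθ => ?_⟩
  have hW0 : 0 ≤ W := (abs_nonneg _).trans (hW 0 0)
  have hA0 : 0 ≤ A := (abs_nonneg _).trans (haA 0)
  have hPm : MeasurableSet P := hP.1.measurableSet
  have hwi : ∀ i, Continuous fun x => w x i := fun i => by fun_prop
  set J : E3 → ℝ := fun x => a x - b x with hJ
  have hJA : ∀ x, |J x| ≤ 2 * A := fun x => (abs_sub _ _).trans (by linarith [haA x, hbA x])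
  have hJM : ∀ x y, |J x - J y| ≤ (Ma + Mb) * ‖x - y‖ ^ s := fun x y => by
    have h1 : J x - J y = (a x - a y) - (b x - b y) := by
      simp only [hJ]
      ring
    rw [h1, add_mul]
    exact (abs_sub _ _).trans (add_le_add (hMa x y) (hMb x y))
  set V : E3 → E3 := fun x => J x • w x with hV
  have hVc : Continuous V := (ha.sub hb).smul hw
  have hVi : ∀ i x, V x i = w x i * J x := fun i x => by simp [hV, mul_comm]
  have hVB : ∀ x i, |V x i| ≤ W * (2 * A) := fun x i => by
    rw [hVi, abs_mul]
    exact mul_le_mul (hW i x) (hJA x) (abs_nonneg _) hW0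
  have hVM : ∀ i x y, |V x i - V y i| ≤ (W * (Ma + Mb) + 2 * A * Mw) * ‖x - y‖ ^ s :=
    fun i x y => by
    rw [hVi, hVi]
    exact abs_mul_sub_mul_le (hW i) hJA (hMw i) hJM x y
  have hVtan : IsTangentToFrontier r V P := fun x hx U f hf => by
    simp [hV, htan x hx U f hf]
  have hVm : ∀ i, Measurable fun x => V x i := fun i =>
    (by fun_prop : Continuous fun x => V x i).measurable
  obtain ⟨K', hK'⟩ := iInf_lt_iff.1 hK
  obtain ⟨hmul, hK'K⟩ := iInf_lt_iff.1 hK'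
  have hdivV := hdiv (fun i x => V x i) _ _ (by positivity) hVm (fun i x => hVB x i) hVM
  obtain ⟨g, hg, hgK⟩ := hmul _ (hdivV.trans_lt ENNReal.ofReal_lt_top)
  have hgV := hg.eq_sum_lineDerivOp 𝔇 hs₀ hs₁ hP hVc hVB hVM hVtan
  have hbM : ∀ i x y, |w x i * b x - w y i * b y| ≤ (W * Mb + A * Mw) * ‖x - y‖ ^ s := fun i =>
    abs_mul_sub_mul_le (hW i) hbA (hMw i) hMb
  have hbB : ∀ i x, |w x i * b x| ≤ W * A := fun i x => by
    rw [abs_mul]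
    exact mul_le_mul (hW i x) (hbA x) (abs_nonneg _) hW0
  have hbm : ∀ i, Measurable fun x => w x i * b x := fun i => ((hwi i).mul hb).measurable
  have hdivb := hdiv (fun i x => w x i * b x) _ _ (by positivity) hbm hbB hbM
  have hsplit : ∀ i, boundedDist (fun x => w x i * θ x) =
      boundedDist (fun x => w x i * b x) + boundedDist (P.indicator fun x => V x i) := fun i => by
    rw [← boundedDist_add (hbm i) (hbB i) ((hVm i).indicator hPm) fun x =>
      (norm_indicator_le_norm_self (fun x => V x i) x).trans (hVB x i)]
    refine boundedDist_congr_ae ?_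
    filter_upwards [hθ] with x hx
    rw [hx, mul_add]
    by_cases hxP : x ∈ P <;> simp [Set.indicator, hxP, hVi]
  have hsum : (∑ i : Fin 3, ∂_{EuclideanSpace.single i (1 : ℝ)}
      (boundedDist fun x => w x i * θ x)) =
      (∑ i : Fin 3, ∂_{EuclideanSpace.single i (1 : ℝ)} (boundedDist fun x => w x i * b x)) +
        g := by
    rw [hgV, ← Finset.sum_add_distrib]
    refine Finset.sum_congr rfl fun i _ => ?_
    rw [hsplit, LineDeriv.lineDerivOp_add]
  rw [hsum]
  calc _ ≤ ENNReal.ofReal (C * (W * Mb + A * Mw)) +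
        K * ENNReal.ofReal (C * (W * (Ma + Mb) + 2 * A * Mw)) :=
        (𝔇.holderNorm_add_le _ _ _).trans (add_le_add hdivb (hgK.trans (by gcongr)))
    _ = ENNReal.ofReal (C * (W * Mb + A * Mw) + K * (C * (W * (Ma + Mb) + 2 * A * Mw))) := by
        rw [ENNReal.ofReal_add (by positivity) (by positivity),
          ENNReal.ofReal_mul (by positivity) (p := (K : ℝ)), ENNReal.ofReal_coe_nnreal]
    _ ≤ _ := by
        refine ENNReal.ofReal_le_ofReal ?_
        have h1 : 0 ≤ C * (W * Ma) := by positivity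
        have h2 : 0 ≤ (K : ℝ) * (C * (W * (Ma + Mb))) := by positivity
        linarith

end DyadicPartition

theorem norm_le_toReal_eLpNorm_top {E : Type*} [NormedAddCommGroup E] {u : E3 → E}
    (hu : MemLp u ∞ (volume : Measure E3)) :
    ∀ᵐ x, ‖u x‖ ≤ (eLpNorm u ∞ (volume : Measure E3)).toReal := by
  have h := hu.eLpNorm_ne_top
  rw [eLpNorm_exponent_top] at h ⊢
  filter_upwards [ae_le_eLpNormEssSup (f := u) (μ := (volume : Measure E3))] with x hx
  simpa using ENNReal.toReal_mono h hx

/-- Truncation of the values of a function at the levels `-A` and `A`. -/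
noncomputable def clip (A t : ℝ) : ℝ := max (-A) (min A t)

theorem abs_clip_le {A : ℝ} (hA : 0 ≤ A) (t : ℝ) : |clip A t| ≤ A :=
  abs_le.2 ⟨le_max_left _ _, max_le (by linarith) (min_le_left _ _)⟩

theorem clip_of_abs_le {A t : ℝ} (h : |t| ≤ A) : clip A t = t := by
  rw [clip, min_eq_right (abs_le.1 h).2, max_eq_right (abs_le.1 h).1]

theorem abs_clip_sub_clip_le (A t t' : ℝ) : |clip A t - clip A t'| ≤ |t - t'| :=
  by
  unfold clip
  refine (abs_max_sub_max_le_max _ _ _ _).trans ?_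
  have := abs_min_sub_min_le_max A t A t'
  simpa using this

theorem continuous_clip (A : ℝ) : Continuous (clip A) :=
  continuous_const.max (continuous_const.min continuous_id)

/-- A component of the patch is not changed by truncations at its essential supremum. They are
needed because the interior field can be large outside `P`, and the exterior one in `P`. -/
theorem patchField_ae_eq {r : ℝ} {P : Set E3} (hP : IsOpenOfClass r P) (ωi ωe : E3 →ᵇ E3)
    (k : Fin 3) {A : ℝ} (hA : ∀ᵐ x, ‖patchField P ωi ωe x‖ ≤ A) :
    (fun x => patchField P ωi ωe x k) =ᵐ[volume] fun x => clip A (ωe x k) +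
      P.indicator (fun x => clip A (ωi x k) - clip A (ωe x k)) x := by
  filter_upwards [hA, measure_eq_zero_iff_ae_notMem.1 (volume_frontier_eq_zero hP)] with x hx hxf
  have hk : |patchField P ωi ωe x k| ≤ A := (PiLp.norm_apply_le _ k).trans hx
  rw [hP.1.frontier_eq] at hxf
  by_cases hxP : x ∈ P
  · have hxc : x ∈ closure P := subset_closure hxP
    simp only [patchField, Set.indicator, hxP, hxc, Set.mem_compl_iff, not_true_eq_false, if_true,
      if_false, add_zero] at hk ⊢
    rw [clip_of_abs_le hk]
    ring
  · have hxc : x ∉ closure P := fun h => hxf ⟨h, hxP⟩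
    simp only [patchField, Set.indicator, hxP, hxc, Set.mem_compl_iff, not_false_eq_true, if_true,
      if_false, add_zero, zero_add] at hk ⊢
    rw [clip_of_abs_le hk]

theorem ENNReal.ofReal_mul_add_mul_toReal (D : ℝ≥0) {W A I E N : ℝ≥0∞} (hW : W ≠ ⊤) (hA : A ≠ ⊤)
    (hI : I ≠ ⊤) (hE : E ≠ ⊤) (hN : N ≠ ⊤) :
    ENNReal.ofReal (D * W.toReal * (I.toReal + E.toReal) + D * A.toReal * N.toReal) =
      D * W * (I + E) + D * A * N := by
  lift W to ℝ≥0 using hW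
  lift A to ℝ≥0 using hA
  lift I to ℝ≥0 using hI
  lift E to ℝ≥0 using hE
  lift N to ℝ≥0 using hN
  simp only [ENNReal.coe_toReal]
  norm_cast
  rw [ENNReal.ofReal_coe_nnreal]

theorem mainTheorem6 (𝔇 : DyadicPartition) (s : ℝ) (hs₀ : 0 < s) (hs₁ : s < 1) :
    ∃ C : ℝ≥0 → ℝ≥0, ∀ r : ℝ, s ≤ r → r < 1 → ∀ P : Set E3, IsOpenOfClass r P →
      (Bornology.IsBounded P → 𝔇.charMultiplierNorm (s - 1) P < ⊤) ∧
      (𝔇.charMultiplierNorm (s - 1) P < ⊤ →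
        ∀ ωi ωe w : E3 →ᵇ E3,
          𝔇.vecHolderNorm r (fieldDist ωi) < ⊤ →
          𝔇.vecHolderNorm r (fieldDist ωe) < ⊤ →
          𝔇.vecHolderNorm s (fieldDist w) < ⊤ →
          IsTangentToFrontier r w P →
          𝔇.vecHolderNorm (s - 1) (divTensor w (patchField P ωi ωe)) < ⊤ ∧
          𝔇.vecHolderNorm (s - 1) (divTensor w (patchField P ωi ωe)) ≤
            C (𝔇.charMultiplierNorm (s - 1) P).toNNReal * eLpNorm w ∞ volume *
                (𝔇.vecHolderNorm s (fieldDist ωi) + 𝔇.vecHolderNorm s (fieldDist ωe)) +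
              C (𝔇.charMultiplierNorm (s - 1) P).toNNReal *
                eLpNorm (patchField P ωi ωe) ∞ volume * 𝔇.vecHolderNorm s (fieldDist w)) := by
  obtain ⟨H, hH, hhol⟩ := 𝔇.exists_holder_of_holderNorm_le hs₀ hs₁
  obtain ⟨C, hC, hdiv⟩ := 𝔇.exists_holderNorm_div_le hs₀ hs₁
  refine ⟨fun K => (C * (1 + 2 * (K + 1)) * (1 + H)).toNNReal, fun r hsr hr P hP =>
    ⟨𝔇.charMultiplierNorm_lt_top hs₀ hs₁ hP, fun hK ωi ωe w hωi hωe hw htan => ?_⟩⟩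
  set K : ℝ≥0 := (𝔇.charMultiplierNorm (s - 1) P).toNNReal with hKdef
  -- the infimum that defines `K` need not be attained, but `K + 1` is a bound of the operator
  have hK1 : 𝔇.charMultiplierNorm (s - 1) P < ((K + 1 : ℝ≥0) : ℝ≥0∞) := by
    rw [← ENNReal.coe_toNNReal hK.ne, ← hKdef]
    exact_mod_cast lt_add_one K
  have hmono : ∀ u : E3 →ᵇ E3, 𝔇.vecHolderNorm r (fieldDist u) < ⊤ →
      𝔇.vecHolderNorm s (fieldDist u) < ⊤ := fun u hu => by
    refine lt_of_le_of_lt (iSup_le fun k => (𝔇.holderNorm_le_mul_of_le hsr _).trans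
      (mul_le_mul_right (le_iSup (fun k => 𝔇.holderNorm r (fieldDist u k)) k) _))
      (ENNReal.mul_lt_top ENNReal.ofReal_lt_top hu)
  have hi := hmono ωi hωi
  have he := hmono ωe hωe
  -- bounded fields with a finite norm are Hölder continuous
  have hholder : ∀ u : E3 →ᵇ E3, 𝔇.vecHolderNorm s (fieldDist u) < ⊤ → ∀ k x y,
      |u x k - u y k| ≤ H * (𝔇.vecHolderNorm s (fieldDist u)).toReal * ‖x - y‖ ^ s :=
    fun u hu k x y => by
    refine hhol (fun x => u x k) ‖u‖ _ (by fun_prop)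
      (fun x => (PiLp.norm_apply_le (u x) k).trans (u.norm_coe_le_norm x)) ENNReal.toReal_nonneg
      ?_ x y
    rw [ENNReal.ofReal_toReal hu.ne]
    exact le_iSup (fun k => 𝔇.holderNorm s (fieldDist u k)) k
  have hwL : MemLp w ∞ (volume : Measure E3) :=
    memLp_top_of_bound w.continuous.aestronglyMeasurable ‖w‖ (.of_forall w.norm_coe_le_norm)
  have hωL := memLp_patchField hP.1 ωi ωe
  set W := (eLpNorm w ∞ (volume : Measure E3)).toReal with hWdef
  set A := (eLpNorm (patchField P ωi ωe) ∞ (volume : Measure E3)).toReal with hAdef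
  -- the essential supremum bounds the continuous field `w` everywhere
  have hW : ∀ x, ‖w x‖ ≤ W := fun x =>
    (isClosed_le w.continuous.norm continuous_const).closure_subset
      (Measure.dense_of_ae (norm_le_toReal_eLpNorm_top hwL) x)
  have hA0 : 0 ≤ A := ENNReal.toReal_nonneg
  have hW0 : 0 ≤ W := ENNReal.toReal_nonneg
  set Ni := (𝔇.vecHolderNorm s (fieldDist ωi)).toReal with hNi
  set Ne := (𝔇.vecHolderNorm s (fieldDist ωe)).toReal with hNe
  set Nw := (𝔇.vecHolderNorm s (fieldDist w)).toReal with hNw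
  have hNi0 : 0 ≤ Ni := ENNReal.toReal_nonneg
  have hNe0 : 0 ≤ Ne := ENNReal.toReal_nonneg
  have hNw0 : 0 ≤ Nw := ENNReal.toReal_nonneg
  beta_reduce
  set D : ℝ≥0 := (C * (1 + 2 * (K + 1)) * (1 + H)).toNNReal with hDdef
  have hD : (D : ℝ) = C * (1 + 2 * (K + 1)) * (1 + H) := Real.coe_toNNReal _ (by positivity)
  have hbound : ∀ k, 𝔇.holderNorm (s - 1) (divTensor w (patchField P ωi ωe) k) ≤
      ENNReal.ofReal (D * W * (Ni + Ne) + D * A * Nw) := fun k => by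
    refine (hdiv r P hP (K + 1) hK1 w (fun x => clip A (ωi x k)) (fun x => clip A (ωe x k))
      (fun x => patchField P ωi ωe x k) W A (H * Nw) (H * Ni) (H * Ne) w.continuous
      (fun i x => (PiLp.norm_apply_le (w x) i).trans (hW x)) (hholder w hw) htan
      ((continuous_clip A).comp (by fun_prop)) ((continuous_clip A).comp (by fun_prop))
      (fun x => abs_clip_le hA0 _) (fun x => abs_clip_le hA0 _)
      (fun x y => (abs_clip_sub_clip_le _ _ _).trans (hholder ωi hi k x y))
      (fun x y => (abs_clip_sub_clip_le _ _ _).trans (hholder ωe he k x y))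
      (by positivity) (by positivity) (by positivity)
      (patchField_ae_eq hP ωi ωe k (norm_le_toReal_eLpNorm_top hωL))).trans
      (ENNReal.ofReal_le_ofReal ?_)
    -- the factor `H` in the Hölder bounds is absorbed into the constant as `1 + H`
    have h1 : 0 ≤ C * (1 + 2 * ((K : ℝ) + 1)) * (W * (Ni + Ne) + A * Nw) := by positivity
    rw [hD]
    push_cast
    linarith
  have hsup : 𝔇.vecHolderNorm (s - 1) (divTensor w (patchField P ωi ωe)) ≤
      ENNReal.ofReal (D * W * (Ni + Ne) + D * A * Nw) := iSup_le hbound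
  refine ⟨hsup.trans_lt ENNReal.ofReal_lt_top, hsup.trans_eq ?_⟩
  exact ENNReal.ofReal_mul_add_mul_toReal D hwL.eLpNorm_ne_top hωL.eLpNorm_ne_top hi.ne he.ne
    hw.ne
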